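/- **Setting.** Let $\hbar\in\mathbb C\setminus\{0\}$, $\tau\in\mathbb C$ and $\kappa\in\mathbb C\setminus(\{\kappa\ge 1\}\cup\{\kappa\le -1\})$. Let $Hol(\mathbb C^2)$ be the Fréchet space of entire functions of $(u,v)$ with uniform convergence on compact sets. All expressions are in the $(\kappa,\tau)$-ordering: for $\Lambda=\begin{pmatrix}0&\kappa-1\\ \kappa+1&\tau\end{pmatrix}$ and $(u_1,u_2)=(u,v)$, $$f*g=\sum_{k}\frac{(i\hbar)^k}{k!\,2^k}\Lambda^{i_1j_1}\cdots\Lambda^{i_kj_k}\,\partial_{u_{i_1}}\cdots\partial_{u_{i_k}}f\;\partial_{u_{j_1}}\cdots\partial_{u_{j_k}}g ,$$ a finite sum when $f$ or $g$ is a polynomial. Put $X=\frac1{i\hbar}uv:=\frac1{2i\hbar}(u*v+v*u)$ and let $$e_*^{tX}=\frac{2}{\Delta}\exp\Big(\frac1{i\hbar}\big(s^2\tau u^2+2s\,uv\big)\Big),\quad \Delta=(e^{t/2}+e^{-t/2})-\kappa(e^{t/2}-e^{-t/2}),\quad s=\frac{e^{t/2}-e^{-t/2}}{\Delta}$$ ($t\in\mathbb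 R$), the solution of $\frac{d}{dt}f_t=X*f_t$, $f_0=1$. Let $\mathbb N=\{0,1,2,\dots\}$ and $D=\mathbb C\setminus\{-(\mathbb N+\frac12)\}$. "Inverse" means two-sided inverse for $*$. **Theorem.** 1. For $\mathrm{Re}\,z>-\frac12$ the integrals $$(z+X)_{+*}^{-1}=\int_{-\infty}^0e^{tz}e_*^{tX}\,dt,\qquad (z-X)_{-*}^{-1}=\int_{-\infty}^0e^{tz}e_*^{-tX}\,dt$$ converge in $Hol(\mathbb C^2)$ (absolutely at each point and uniformly on compact sets). As functions of $z$ they extend to holomorphic $Hol(\mathbb C^2)$-valued functions on $D$, and for every $z\in D$ the extensions are inverses of $z+X$ and of $z-X$. 2. The limits $\varpi_{00}=\lim_{t\to-\infty}e^{-t/2}e_*^{tX}$ and $\overline\varpi_{00}=\lim_{t\to\infty}e^{t/2}e_*^{tX}$ exist in $Hol(\mathbb C^2)$, and for all $z\ne\frac12$ with $\mathrm{Re}\,z>-\frac12$ the sliding identities $$\big(v^{\circ}*(z+X)_{+*}^{-1}\big)*v+(z-\tfrac12)^{-1}\varpi_{00}=(z-1+X)_{+*}^{-1},$$ $$\big(u^{\bullet}*(z-X)_{-*}^{-1}\big)*u+(z-\tfrac12)^{-1}\overline\varpi_{00}=(z-1-X)_{-*}^{-1}$$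 hold, the right-hand sides being the extensions of (1). Here $v^\circ=u*(v*u)_{+*}^{-1}$ and $u^\bullet=v*(u*v)_{-*}^{-1}$, and the products are given by the absolutely convergent integrals $$v^{\circ}*(z+X)_{+*}^{-1}=u*\frac1{i\hbar}\int_{-\infty}^0\!\int_{-\infty}^0e^{\frac t2+sz}e_*^{(t+s)X}\,dt\,ds,$$ $$u^{\bullet}*(z-X)_{-*}^{-1}=-v*\frac1{i\hbar}\int_{-\infty}^0\!\int_{-\infty}^0e^{\frac t2+sz}e_*^{-(t+s)X}\,dt\,ds .$$ 3. With the extensions of (1), the function $$(z^2-X^2)_{\pm*}^{-1}=\frac1{2z}\Big((z+X)_{+*}^{-1}+(z-X)_{-*}^{-1}\Big)$$ is holomorphic on $D\setminus\{0\}$ with values in $Hol(\mathbb C^2)$, and it is an inverse of $z^2-X*X$ for every $z\in D\setminus\{0\}$. Likewise, writing $F(z)$ and $G(z)$ for the two extensions of (1), the functions $\frac1{2z}(F(z)-F(-z))$ and $\frac1{2z}(G(z)-G(-z))$ (both factors $z\pm X$ inverted with the same sign) extend over $z=0$ to holomorphic functions on $\mathbb C\setminus\{\pm(\mathbb N+\frac12)\}$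 that are inverses of $z^2-X*X$ there. -/

import Mathlib

open Complex Filter Topology MeasureTheory Set

noncomputable section

namespace WeylStar

/-- The Fréchet space `Hol(ℂ²)` of entire functions of `(u, v)`, with the topology of uniform
convergence on compact sets (the compact-open topology of `C(ℂ × ℂ, ℂ)`). -/
def Hol : Submodule ℂ C(ℂ × ℂ, ℂ) where
  carrier := {f | Differentiable ℂ f}
  add_mem' hf hg := Differentiable.add hf hg
  zero_mem' := differentiable_const 0
  smul_mem' c _ hf := Differentiable.const_smul hf c

/-- The partial derivatives `∂_u` (index `0`) and `∂_v` (index `1`). -/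
def pd (i : Fin 2) (f : ℂ × ℂ → ℂ) : ℂ × ℂ → ℂ := fun p =>
  if i = 0 then deriv (fun x => f (x, p.2)) p.1 else deriv (fun y => f (p.1, y)) p.2

/-- `biDiff Λ k f g = ∑ Λ^{i₁j₁} ⋯ Λ^{i_k j_k} (∂_{i₁} ⋯ ∂_{i_k} f) (∂_{j₁} ⋯ ∂_{j_k} g)`. -/
def biDiff (Λ : Matrix (Fin 2) (Fin 2) ℂ) : ℕ → (ℂ × ℂ → ℂ) → (ℂ × ℂ → ℂ) → ℂ × ℂ → ℂ
  | 0, f, g => f * g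
  | k + 1, f, g => ∑ i, ∑ j, Λ i j • biDiff Λ k (pd i f) (pd j g)

/-- The matrix `Λ = K + J` of the `(κ, τ)`-ordering. -/
def ordMatrix (κ τ : ℂ) : Matrix (Fin 2) (Fin 2) ℂ := !![0, κ; κ, τ] + !![0, -1; 1, 0]

/-- The `*`-product in the `(κ, τ)`-ordering expression. The series is a finite sum as soon as one
of the two factors is a polynomial. -/
def starMul (ħ κ τ : ℂ) (f g : ℂ × ℂ → ℂ) : ℂ × ℂ → ℂ := fun p =>
  ∑' k : ℕ, (I * ħ) ^ k / ((k.factorial : ℂ) * 2 ^ k) * biDiff (ordMatrix κ τ) k f g p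

/-- The generator `u`. -/
def genU : ℂ × ℂ → ℂ := fun p => p.1

/-- The generator `v`. -/
def genV : ℂ × ℂ → ℂ := fun p => p.2

/-- The `(κ, τ)`-ordering expression of the algebra element `uv / (iħ)`,
where `uv = (u * v + v * u) / 2`. -/
def elemX (ħ κ τ : ℂ) : ℂ × ℂ → ℂ :=
  (1 / (I * ħ)) • ((1 / 2 : ℂ) • (starMul ħ κ τ genU genV + starMul ħ κ τ genV genU))

/-- `Δ(t) = (e^{t/2} + e^{-t/2}) - κ (e^{t/2} - e^{-t/2})`. -/
def expDelta (κ : ℂ) (t : ℝ) : ℂ :=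
  (exp (t / 2) + exp (-t / 2)) - κ * (exp (t / 2) - exp (-t / 2))

/-- `(e^{t/2} - e^{-t/2}) / Δ(t)`. -/
def expPhase (κ : ℂ) (t : ℝ) : ℂ := (exp (t / 2) - exp (-t / 2)) / expDelta κ t

/-- The `(κ, τ)`-ordering expression of the star exponential `e_*^{t uv / (iħ)}`. That this is the
solution of the evolution equation `d/dt f_t = (uv / (iħ)) * f_t`, `f_0 = 1`, is proved below
(`starExp_zero`, `hasDerivAt_starExp`). -/
def starExp (ħ κ τ : ℂ) (t : ℝ) : Hol :=
  ⟨⟨fun p => 2 / expDelta κ t *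
      exp (1 / (I * ħ) * (expPhase κ t ^ 2 * τ * p.1 ^ 2 + 2 * expPhase κ t * (p.1 * p.2))),
    by fun_prop⟩, by
      change Differentiable ℂ (fun p : ℂ × ℂ => 2 / expDelta κ t *
        exp (1 / (I * ħ) * (expPhase κ t ^ 2 * τ * p.1 ^ 2 + 2 * expPhase κ t * (p.1 * p.2))))
      fun_prop⟩

/-- The star exponential `e_*^{t u*v / (iħ)}`, where `u * v = uv - iħ/2`. -/
def starExpUV (ħ κ τ : ℂ) (t : ℝ) : Hol := exp (-t / 2) • starExp ħ κ τ t

/-- The star exponential `e_*^{t v*u / (iħ)}`, where `v * u = uv + iħ/2`. -/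
def starExpVU (ħ κ τ : ℂ) (t : ℝ) : Hol := exp (t / 2) • starExp ħ κ τ t

/-- `ϖ` is the vacuum `ϖ₀₀ = lim_{t → -∞} e_*^{t u*v / (iħ)}` (limit in `Hol(ℂ²)`). -/
def IsVacuum (ħ κ τ : ℂ) (ϖ : Hol) : Prop := Tendsto (starExpUV ħ κ τ) atBot (𝓝 ϖ)

/-- `ϖ` is the opposite vacuum `lim_{t → ∞} e_*^{t v*u / (iħ)}` (limit in `Hol(ℂ²)`). -/
def IsVacuumBar (ħ κ τ : ℂ) (ϖ : Hol) : Prop := Tendsto (starExpVU ħ κ τ) atTop (𝓝 ϖ)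

/-- `a` and `b` are two-sided inverse to each other for the `*`-product. -/
def IsStarInverse (ħ κ τ : ℂ) (a b : ℂ × ℂ → ℂ) : Prop :=
  starMul ħ κ τ a b = 1 ∧ starMul ħ κ τ b a = 1

/-- The improper integral `∫_{-∞}^0 g(t) dt` converges in `Hol(ℂ²)` (absolutely at each point, and
uniformly on compact sets) and is equal to `A`. -/
def HasIntegralIic (g : ℝ → Hol) (A : Hol) : Prop :=
  (∀ p, IntegrableOn (fun t => (g t).1 p) (Iic 0)) ∧
  TendstoLocallyUniformly (fun (N : ℝ) (p : ℂ × ℂ) => ∫ t in (-N)..0, (g t).1 p) A.1 atTop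

/-- The double integral `∫_{-∞}^0 ∫_{-∞}^0 g(t, s) dt ds` converges absolutely at each point and is
equal to `A`. -/
def HasIntegralIic₂ (g : ℝ × ℝ → Hol) (A : Hol) : Prop :=
  ∀ p, IntegrableOn (fun ts => (g ts).1 p) (Iic 0 ×ˢ Iic 0) ∧
    ∫ ts in Iic (0 : ℝ) ×ˢ Iic (0 : ℝ), (g ts).1 p = A.1 p

/-- `A` is the `*`-product `v° * (z + uv/(iħ))_{+*}⁻¹`, where `v° = u * (v * u)_{+*}⁻¹` and
`(v * u)_{+*}⁻¹ = (iħ)⁻¹ ∫_{-∞}^0 e_*^{t v*u/(iħ)} dt`. The product of the two integrals is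
`∫_{-∞}^0 ∫_{-∞}^0 e_*^{t (uv/(iħ) + 1/2)} * e_*^{s (z + uv/(iħ))} dt ds`, where
`e_*^{t uv/(iħ)} * e_*^{s uv/(iħ)} = e_*^{(t + s) uv/(iħ)}`. -/
def IsVCircMul (ħ κ τ z : ℂ) (A : ℂ × ℂ → ℂ) : Prop :=
  ∃ B : Hol, HasIntegralIic₂ (fun ts => exp (ts.1 / 2 + ts.2 * z) • starExp ħ κ τ (ts.1 + ts.2)) B ∧
    A = starMul ħ κ τ genU ((1 / (I * ħ)) • B).1

/-- `A` is the `*`-product `u• * (z - uv/(iħ))_{-*}⁻¹`, where `u• = v * (u * v)_{-*}⁻¹` and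
`(u * v)_{-*}⁻¹ = -(iħ)⁻¹ ∫_0^∞ e_*^{t u*v/(iħ)} dt = -(iħ)⁻¹ ∫_{-∞}^0 e_*^{-t u*v/(iħ)} dt`. -/
def IsUBulletMul (ħ κ τ z : ℂ) (A : ℂ × ℂ → ℂ) : Prop :=
  ∃ B : Hol,
    HasIntegralIic₂ (fun ts => exp (ts.1 / 2 + ts.2 * z) • starExp ħ κ τ (-(ts.1 + ts.2))) B ∧
    A = starMul ħ κ τ genV ((-(1 / (I * ħ))) • B).1

/-- `A = (z + uv/(iħ))_{+*}⁻¹ = ∫_{-∞}^0 e_*^{t (z + uv/(iħ))} dt`. -/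
def IsPlusInverse (ħ κ τ z : ℂ) (A : Hol) : Prop :=
  HasIntegralIic (fun t => exp (t * z) • starExp ħ κ τ t) A

/-- `A = (z - uv/(iħ))_{-*}⁻¹ = ∫_{-∞}^0 e_*^{t (z - uv/(iħ))} dt`. This is
`-((-z) + uv/(iħ))_{-*}⁻¹`, where `(w + uv/(iħ))_{-*}⁻¹ = -∫_0^∞ e_*^{t (w + uv/(iħ))} dt`. -/
def IsMinusInverse (ħ κ τ z : ℂ) (A : Hol) : Prop :=
  HasIntegralIic (fun t => exp (t * z) • starExp ħ κ τ (-t)) A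

/-- The domain `ℂ ∖ {-(ℕ + 1/2)}`, where `ℕ` contains `0`. -/
def inverseDomain : Set ℂ := {z | ∀ n : ℕ, z ≠ -((n : ℂ) + 1 / 2)}

/-! ### The star exponential solves its evolution equation -/

/-- The condition `κ ∈ ℂ ∖ ({κ ≥ 1} ∪ {κ ≤ -1})`. -/
def Admissible (κ : ℂ) : Prop := ¬ (κ.im = 0 ∧ (κ.re ≤ -1 ∨ 1 ≤ κ.re))

theorem expDelta_ne_zero {κ : ℂ} (hκ : Admissible κ) (t : ℝ) : expDelta κ t ≠ 0 := by
  intro h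
  have h1 : expDelta κ t =
      ((Real.exp (t / 2) + Real.exp (-t / 2) : ℝ) : ℂ)
        - κ * ((Real.exp (t / 2) - Real.exp (-t / 2) : ℝ) : ℂ) := by
    simp [expDelta]
  rw [h1] at h
  have hre := congrArg Complex.re h
  have him := congrArg Complex.im h
  simp only [sub_re, sub_im, mul_re, mul_im, ofReal_re, ofReal_im, zero_re, zero_im] at hre him
  have ha := Real.exp_pos (t / 2)
  have hb := Real.exp_pos (-t / 2)
  set a := Real.exp (t / 2)
  set b := Real.exp (-t / 2)
  have hab : a - b ≠ 0 := by
    intro h0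
    rw [h0] at hre
    linarith
  have him0 : κ.im = 0 := by
    have h2 : κ.im * (a - b) = 0 := by linarith
    exact (mul_eq_zero.mp h2).resolve_right hab
  apply hκ
  refine ⟨him0, ?_⟩
  by_contra! hc
  obtain ⟨h3, h4⟩ := hc
  nlinarith [mul_pos ha (sub_pos.mpr h4), mul_pos hb (sub_pos.mpr h3)]

theorem biDiff_zero_left (Λ : Matrix (Fin 2) (Fin 2) ℂ) (k : ℕ) (g : ℂ × ℂ → ℂ) :
    biDiff Λ k 0 g = 0 := by
  induction k generalizing g with
  | zero => simp [biDiff]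
  | succ k ih =>
    have h : ∀ i, pd i (0 : ℂ × ℂ → ℂ) = 0 := by
      intro i; funext p; simp [pd]
    simp [biDiff, h, ih]

theorem starExp_zero (ħ κ τ : ℂ) : (starExp ħ κ τ 0).1 = (1 : C(ℂ × ℂ, ℂ)) := by
  ext p
  simp [starExp, expDelta, expPhase]
  norm_num

theorem starMul_of_pd_left {ħ κ τ : ℂ} {f : ℂ × ℂ → ℂ} (g : ℂ × ℂ → ℂ)
    (hf : ∀ i j k, pd k (pd j (pd i f)) = 0) (p : ℂ × ℂ) :
    starMul ħ κ τ f g p = f p * g p + I * ħ / 2 * biDiff (ordMatrix κ τ) 1 f g p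
      + (I * ħ) ^ 2 / 8 * biDiff (ordMatrix κ τ) 2 f g p := by
  have h : ∀ k, k ∉ Finset.range 3 → (I * ħ) ^ k / ((k.factorial : ℂ) * 2 ^ k) *
      biDiff (ordMatrix κ τ) k f g p = 0 := by
    intro k hk
    obtain ⟨m, rfl⟩ : ∃ m, k = m + 3 := ⟨k - 3, by simp at hk; omega⟩
    simp [biDiff, hf, biDiff_zero_left]
  rw [starMul, tsum_eq_sum h]
  simp only [Finset.sum_range_succ, Finset.sum_range_zero]
  norm_num [Nat.factorial]
  simp [biDiff]

theorem pd_genU (i : Fin 2) : pd i genU = fun _ => if i = 0 then 1 else 0 := by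
  fin_cases i <;> funext p <;> simp [pd, genU]

theorem pd_genV (i : Fin 2) : pd i genV = fun _ => if i = 0 then 0 else 1 := by
  fin_cases i <;> funext p <;> simp [pd, genV]

theorem pd_const (i : Fin 2) (c : ℂ) : pd i (fun _ => c) = 0 := by
  fin_cases i <;> funext p <;> simp [pd]

theorem pd_zero (i : Fin 2) : pd i 0 = 0 := pd_const i 0

theorem elemX_apply {ħ : ℂ} (hħ : ħ ≠ 0) (κ τ : ℂ) :
    elemX ħ κ τ = fun p => 1 / (I * ħ) * (p.1 * p.2) + κ / 2 := by
  funext p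
  have hU : ∀ i j k, pd k (pd j (pd i genU)) = 0 := by
    intro i j k; rw [pd_genU, pd_const, pd_zero]
  have hV : ∀ i j k, pd k (pd j (pd i genV)) = 0 := by
    intro i j k; rw [pd_genV, pd_const, pd_zero]
  simp only [elemX, Pi.smul_apply, Pi.add_apply, starMul_of_pd_left _ hU,
    starMul_of_pd_left _ hV, smul_eq_mul]
  simp [biDiff, Fin.sum_univ_two, pd_genU, pd_genV, pd_const, ordMatrix, genU, genV]
  field_simp
  linear_combination (-2 * ħ * κ) * I_sq

/-- The evolution equation `d/dt f_t = (uv / (iħ)) * f_t` of the star exponential. -/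
theorem hasDerivAt_starExp {ħ κ : ℂ} (hħ : ħ ≠ 0) (hκ : Admissible κ) (τ : ℂ) (t : ℝ)
    (p : ℂ × ℂ) :
    HasDerivAt (fun t => (starExp ħ κ τ t).1 p)
      (starMul ħ κ τ (elemX ħ κ τ) (starExp ħ κ τ t).1 p) t := by
  have hΔ := expDelta_ne_zero hκ t
  -- partial derivatives of `uv / (iħ)`
  have hX0 : pd 0 (elemX ħ κ τ) = fun p => 1 / (I * ħ) * p.2 := by
    rw [elemX_apply hħ]; funext q; simp [pd]
  have hX1 : pd 1 (elemX ħ κ τ) = fun p => 1 / (I * ħ) * p.1 := by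
    rw [elemX_apply hħ]; funext q; simp [pd]
  have hX00 : pd 0 (fun p : ℂ × ℂ => 1 / (I * ħ) * p.2) = 0 := by
    funext q; simp [pd]
  have hX01 : pd 1 (fun p : ℂ × ℂ => 1 / (I * ħ) * p.2) = fun _ => 1 / (I * ħ) := by
    funext q; simp [pd]
  have hX10 : pd 0 (fun p : ℂ × ℂ => 1 / (I * ħ) * p.1) = fun _ => 1 / (I * ħ) := by
    funext q; simp [pd]
  have hX11 : pd 1 (fun p : ℂ × ℂ => 1 / (I * ħ) * p.1) = 0 := by
    funext q; simp [pd]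
  have hX : ∀ i j k, pd k (pd j (pd i (elemX ħ κ τ))) = 0 := by
    intro i j k
    fin_cases i <;> fin_cases j
    · change pd k (pd 0 (pd 0 _)) = 0
      rw [hX0, hX00, pd_zero]
    · change pd k (pd 1 (pd 0 _)) = 0
      rw [hX0, hX01, pd_const]
    · change pd k (pd 0 (pd 1 _)) = 0
      rw [hX1, hX10, pd_const]
    · change pd k (pd 1 (pd 1 _)) = 0
      rw [hX1, hX11, pd_zero]
  -- partial derivatives of the exponential
  set s := expPhase κ t with hs
  set a : ℂ := 2 / expDelta κ t with ha
  set c : ℂ := 1 / (I * ħ) with hc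
  set E : ℂ × ℂ → ℂ := fun p => a * exp (c * (s ^ 2 * τ * p.1 ^ 2 + 2 * s * (p.1 * p.2))) with hE
  have hE' : ((starExp ħ κ τ t).1 : ℂ × ℂ → ℂ) = E := rfl
  have dE0 : ∀ q : ℂ × ℂ, HasDerivAt (fun x => E (x, q.2))
      (c * (2 * s ^ 2 * τ * q.1 + 2 * s * q.2) * E q) q.1 := by
    intro q
    have := (((((hasDerivAt_id q.1).pow 2).const_mul (s ^ 2 * τ)).add
      (((hasDerivAt_id q.1).mul_const q.2).const_mul (2 * s))).const_mul c).cexp.const_mul a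
    refine this.congr_deriv ?_
    simp [hE]; ring
  have dE1 : ∀ q : ℂ × ℂ, HasDerivAt (fun y => E (q.1, y)) (c * (2 * s * q.1) * E q) q.2 := by
    intro q
    have := ((((((hasDerivAt_id q.2).const_mul q.1).const_mul (2 * s)).const_add
      (s ^ 2 * τ * q.1 ^ 2))).const_mul c).cexp.const_mul a
    refine this.congr_deriv ?_
    simp [hE]; ring
  have pE0 : pd 0 E = fun q => c * (2 * s ^ 2 * τ * q.1 + 2 * s * q.2) * E q := by
    funext q; simp only [pd, if_true]; exact (dE0 q).deriv
  have pE1 : pd 1 E = fun q => c * (2 * s * q.1) * E q := by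
    funext q; simp only [pd, one_ne_zero, if_false]; exact (dE1 q).deriv
  have pE01 : pd 1 (pd 0 E) = fun q => (c * (2 * s) +
      c * (2 * s ^ 2 * τ * q.1 + 2 * s * q.2) * (c * (2 * s * q.1))) * E q := by
    rw [pE0]; funext q; simp only [pd, one_ne_zero, if_false]
    have := ((((hasDerivAt_id q.2).const_mul (2 * s)).const_add
      (2 * s ^ 2 * τ * q.1)).const_mul c).mul (dE1 q)
    refine (this.congr_deriv ?_).deriv
    simp; ring
  have pE10 : pd 0 (pd 1 E) = fun q => (c * (2 * s) +
      c * (2 * s ^ 2 * τ * q.1 + 2 * s * q.2) * (c * (2 * s * q.1))) * E q := by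
    rw [pE1]; funext q; simp only [pd, if_true]
    have := (((hasDerivAt_id q.1).const_mul (2 * s)).const_mul c).mul (dE0 q)
    refine (this.congr_deriv ?_).deriv
    simp; ring
  have pE11 : pd 1 (pd 1 E) = fun q => (c * (2 * s * q.1)) ^ 2 * E q := by
    rw [pE1]; funext q; simp only [pd, one_ne_zero, if_false]
    have := (dE1 q).const_mul (c * (2 * s * q.1))
    refine (this.congr_deriv ?_).deriv
    ring
  have hcħ : I * ħ * c = 1 := by
    rw [hc]; field_simp
  have hstar : starMul ħ κ τ (elemX ħ κ τ) E p =
      (κ / 2 + (κ ^ 2 - 1) * s / 2 + c * ((1 + κ * s) ^ 2 - s ^ 2) * (p.1 * p.2)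
        + c * τ * s * ((1 + κ * s) ^ 2 - s ^ 2) * p.1 ^ 2) * E p := by
    rw [starMul_of_pd_left _ hX]
    simp only [biDiff, Fin.sum_univ_two, Pi.add_apply, Pi.smul_apply, Pi.mul_apply, hX0, hX1,
      hX00, hX01, hX10, hX11, pE01, pE10, pE11, Pi.zero_apply, smul_eq_mul]
    rw [pE0, pE1, elemX_apply hħ, ← hc]
    simp only [ordMatrix, Matrix.add_apply, Matrix.of_apply, Matrix.cons_val', Matrix.cons_val_zero,
      Matrix.cons_val_one, Matrix.cons_val_fin_one]
    generalize E p = e at *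
    have hc0 : c ≠ 0 := right_ne_zero_of_mul_eq_one hcħ
    have hh : I * ħ = 1 / c := by field_simp; exact hcħ
    rw [hh]
    clear_value c
    field_simp
    ring
  have hN : HasDerivAt (fun t : ℝ => exp ((t : ℂ) / 2)) (exp ((t : ℂ) / 2) / 2) t := by
    have := ((hasDerivAt_id t).ofReal_comp.div_const 2).cexp
    refine this.congr_deriv ?_
    simp; ring
  have hM : HasDerivAt (fun t : ℝ => exp (-(t : ℂ) / 2)) (-exp (-(t : ℂ) / 2) / 2) t := by
    have := ((hasDerivAt_id t).ofReal_comp.neg.div_const 2).cexp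
    refine this.congr_deriv ?_
    simp; ring
  have hD : HasDerivAt (expDelta κ) ((exp ((t : ℂ) / 2) - exp (-(t : ℂ) / 2)
      - κ * (exp ((t : ℂ) / 2) + exp (-(t : ℂ) / 2))) / 2) t := by
    refine ((hN.add hM).sub ((hN.sub hM).const_mul κ)).congr_deriv ?_
    ring
  have hs' : HasDerivAt (expPhase κ) (((1 + κ * s) ^ 2 - s ^ 2) / 2) t := by
    refine ((hN.sub hM).div hD hΔ).congr_deriv ?_
    rw [hs, expPhase]
    simp only [Pi.sub_apply]
    field_simp
    rw [expDelta]
    ring_nf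
  have ha' : HasDerivAt (fun t => 2 / expDelta κ t) (a * (κ / 2 + (κ ^ 2 - 1) * s / 2)) t := by
    refine ((hasDerivAt_const t (2 : ℂ)).div hD hΔ).congr_deriv ?_
    rw [ha, hs, expPhase]
    field_simp
    rw [expDelta]
    ring_nf
  rw [hE', hstar]
  have h1 := (((hs'.pow 2).mul_const (τ * p.1 ^ 2)).add
    (hs'.mul_const (2 * (p.1 * p.2)))).const_mul c
  have h2 := ha'.mul h1.cexp
  have he : c * (s ^ 2 * (τ * p.1 ^ 2) + s * (2 * (p.1 * p.2))) =
      c * (s ^ 2 * τ * p.1 ^ 2 + 2 * s * (p.1 * p.2)) := by ring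
  refine (h2.congr_deriv ?_).congr_of_eventuallyEq (Eventually.of_forall fun r => ?_)
  · simp only [hE, Pi.add_apply, Pi.pow_apply, ← hs, ← ha, he]
    push_cast
    ring
  · have : c * (expPhase κ r ^ 2 * (τ * p.1 ^ 2) + expPhase κ r * (2 * (p.1 * p.2))) =
      c * (expPhase κ r ^ 2 * τ * p.1 ^ 2 + 2 * expPhase κ r * (p.1 * p.2)) := by ring
    simp only [starExp, Pi.mul_apply, Pi.add_apply, Pi.pow_apply, this]
    rfl

end WeylStar

end

open WeylStar

/-!
Write `X = uv / (iħ)` and `q = e^t`. Up to the factor `q^{1/2}`, the star exponential `e_*^{tX}` is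
a Gaussian exponential whose amplitude and phase are rational functions of `q` (`starGen`), regular
on `[0, ∞)` and hence on a disc around `q = 0`. The integral `∫_{-∞}^0 e^{tz} e_*^{tX} dt` is
therefore the Mellin transform on `[0, 1]`, with parameter `w = z + 1/2`, of a function holomorphic
at `q = 0`, and it continues meromorphically in `w` with poles at most at `w = 0, -1, -2, …`.

The continuation is written as one continuous linear functional `mellinFunctional`, on pairs of
continuous functions on a small circle around `0` and on a compact interval of the `t`-line, applied
to a density `mellinKernel R w` times the function (`mellin_eq_integral`). The interval carries the
part of the integral away from `q = 0`; near `q = 0` the Taylor series is integrated termwise, and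
its coefficients are integrals over the circle. Since these pairs form a commutative Banach algebra,
the continued inverse `plusInv` is the image of the holomorphic function `mellinKernel R (z + 1/2)`
under a continuous linear map `transform` into `Hol`; this gives holomorphy with values in `Hol`.

A product from the left or right with a polynomial is a differential operator, which acts on a
Gaussian exponential through its phase. Multiplication by `X` becomes `q ∂_q + 1/2`
(`starMul_elemX_mellinTransform`), and `f ↦ (iħ)⁻¹ u * f * v` becomes `∂_q`
(`genU_mellinTransform_genV`). Integration by parts in the form `mellin_euler` then says that
`plusInv z` is an inverse of `z + X` wherever it is defined (`isResolvent_plusInv`), and, together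
with the boundary value at `q = 0` (`mellin_euler_zero`), which is the vacuum, it gives the sliding
identity (`sliding_identity`).

The inverse of `z - X` is the same object for the parameters `(-ħ, -κ, -τ)`, because the sign change
reverses the product (`starMul_neg`) and the time of the star exponential (`starExp_neg`). The
inverses of `z² - X * X` are partial fractions, and the ones with equal signs are continued over
`z = 0` by taking the divided difference in the Banach algebra (`sameSignInv`).
-/

open scoped ContDiff

noncomputable section

namespace WeylStar

/-! ### Partial derivatives of smooth functions -/

section StarProduct

-- The library lemmas on sums, multiples and products of smooth functions are stated for
-- `fun x => f x + g x` and the like; the next three are their versions for operations on functions.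

theorem contDiff_add {f g : ℂ × ℂ → ℂ} (hf : ContDiff ℂ ∞ f) (hg : ContDiff ℂ ∞ g) :
    ContDiff ℂ ∞ (f + g) := hf.add hg

theorem contDiff_smul {f : ℂ × ℂ → ℂ} (c : ℂ) (hf : ContDiff ℂ ∞ f) : ContDiff ℂ ∞ (c • f) :=
  hf.const_smul c

theorem contDiff_mul {f g : ℂ × ℂ → ℂ} (hf : ContDiff ℂ ∞ f) (hg : ContDiff ℂ ∞ g) :
    ContDiff ℂ ∞ (f * g) := hf.mul hg

theorem hasDerivAt_pd_zero {f : ℂ × ℂ → ℂ} (hf : Differentiable ℂ f) (p : ℂ × ℂ) :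
    HasDerivAt (fun x => f (x, p.2)) (fderiv ℂ f p (1, 0)) p.1 :=
  HasFDerivAt.comp_hasDerivAt (f := fun x : ℂ => (x, p.2)) p.1 (hf p).hasFDerivAt
    ((hasDerivAt_id p.1).prodMk (hasDerivAt_const p.1 p.2))

theorem hasDerivAt_pd_one {f : ℂ × ℂ → ℂ} (hf : Differentiable ℂ f) (p : ℂ × ℂ) :
    HasDerivAt (fun y => f (p.1, y)) (fderiv ℂ f p (0, 1)) p.2 :=
  HasFDerivAt.comp_hasDerivAt (f := fun y : ℂ => (p.1, y)) p.2 (hf p).hasFDerivAt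
    ((hasDerivAt_const p.2 p.1).prodMk (hasDerivAt_id p.2))

/-- The basis vector of `ℂ × ℂ` along which `pd i` differentiates. -/
def pdDir (i : Fin 2) : ℂ × ℂ := if i = 0 then (1, 0) else (0, 1)

theorem pd_eq_fderiv {f : ℂ × ℂ → ℂ} (hf : Differentiable ℂ f) (i : Fin 2) :
    pd i f = fun p => fderiv ℂ f p (pdDir i) := by
  funext p
  fin_cases i
  · simpa [pd, pdDir] using (hasDerivAt_pd_zero hf p).deriv
  · simpa [pd, pdDir] using (hasDerivAt_pd_one hf p).deriv

theorem contDiff_pd {f : ℂ × ℂ → ℂ} (hf : ContDiff ℂ ∞ f) (i : Fin 2) : ContDiff ℂ ∞ (pd i f) := by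
  rw [pd_eq_fderiv (hf.differentiable (by simp))]
  exact (hf.fderiv_right (m := ∞) (by simp)).clm_apply contDiff_const

theorem pd_add {f g : ℂ × ℂ → ℂ} (hf : ContDiff ℂ ∞ f) (hg : ContDiff ℂ ∞ g) (i : Fin 2) :
    pd i (f + g) = pd i f + pd i g := by
  have hf' := hf.differentiable (by simp)
  have hg' := hg.differentiable (by simp)
  rw [pd_eq_fderiv hf', pd_eq_fderiv hg', pd_eq_fderiv (hf'.add hg')]
  funext p
  simp [fderiv_add (hf' p) (hg' p)]

theorem pd_smul {f : ℂ × ℂ → ℂ} (hf : ContDiff ℂ ∞ f) (c : ℂ) (i : Fin 2) :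
    pd i (c • f) = c • pd i f := by
  have hf' := hf.differentiable (by simp)
  rw [pd_eq_fderiv hf', pd_eq_fderiv (hf'.const_smul c)]
  funext p
  simp [fderiv_const_smul (hf' p)]

theorem pd_mul {f g : ℂ × ℂ → ℂ} (hf : ContDiff ℂ ∞ f) (hg : ContDiff ℂ ∞ g) (i : Fin 2) :
    pd i (f * g) = pd i f * g + f * pd i g := by
  have hf' := hf.differentiable (by simp)
  have hg' := hg.differentiable (by simp)
  rw [pd_eq_fderiv hf', pd_eq_fderiv hg', pd_eq_fderiv (hf'.mul hg')]
  funext p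
  simp [fderiv_mul (hf' p) (hg' p)]
  ring

theorem pd_comm {f : ℂ × ℂ → ℂ} (hf : ContDiff ℂ ∞ f) (i j : Fin 2) :
    pd i (pd j f) = pd j (pd i f) := by
  have hf' := hf.differentiable (by simp)
  rw [pd_eq_fderiv ((contDiff_pd hf j).differentiable (by simp)),
    pd_eq_fderiv ((contDiff_pd hf i).differentiable (by simp)), pd_eq_fderiv hf', pd_eq_fderiv hf']
  funext p
  have hs : IsSymmSndFDerivAt ℂ f p :=
    (contDiff_infty.1 hf 2).contDiffAt.isSymmSndFDerivAt (by simp)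
  have hd : DifferentiableAt ℂ (fderiv ℂ f) p :=
    ((hf.fderiv_right (m := ∞) (by simp)).differentiable (by simp)) p
  have h (a b : ℂ × ℂ) : fderiv ℂ (fun p => fderiv ℂ f p a) p b = fderiv ℂ (fderiv ℂ f) p b a := by
    rw [fderiv_clm_apply hd (differentiableAt_const _)]
    simp
  rw [h, h]
  exact hs _ _

theorem contDiff_genU : ContDiff ℂ ∞ genU := contDiff_fst
theorem contDiff_genV : ContDiff ℂ ∞ genV := contDiff_snd

/-! ### Bilinearity and the Leibniz rule for the bidifferential operators -/

variable (Λ : Matrix (Fin 2) (Fin 2) ℂ)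

theorem contDiff_biDiff (k : ℕ) {f g : ℂ × ℂ → ℂ} (hf : ContDiff ℂ ∞ f) (hg : ContDiff ℂ ∞ g) :
    ContDiff ℂ ∞ (biDiff Λ k f g) := by
  induction k generalizing f g with
  | zero => exact hf.mul hg
  | succ k ih =>
    have := fun i j => contDiff_smul (Λ i j) (ih (contDiff_pd hf i) (contDiff_pd hg j))
    simp only [biDiff, Fin.sum_univ_two]
    exact ((this _ _).add (this _ _)).add ((this _ _).add (this _ _))

/-- Transposing the matrix up to sign exchanges the two arguments of `biDiff`. -/
theorem biDiff_neg_transpose (k : ℕ) (f g : ℂ × ℂ → ℂ) :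
    biDiff (-Λ.transpose) k f g = (-1 : ℂ) ^ k • biDiff Λ k g f := by
  induction k generalizing f g with
  | zero => simp [biDiff, mul_comm]
  | succ k ih =>
    simp only [biDiff, ih, Matrix.neg_apply, Matrix.transpose_apply, Fin.sum_univ_two]
    module

theorem biDiff_add_left (k : ℕ) {f g : ℂ × ℂ → ℂ} (hf : ContDiff ℂ ∞ f) (hg : ContDiff ℂ ∞ g)
    (e : ℂ × ℂ → ℂ) : biDiff Λ k (f + g) e = biDiff Λ k f e + biDiff Λ k g e := by
  induction k generalizing f g e with
  | zero => simp [biDiff, add_mul]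
  | succ k ih =>
    simp only [biDiff, pd_add hf hg, ih (contDiff_pd hf _) (contDiff_pd hg _), Fin.sum_univ_two]
    module

theorem biDiff_smul_left (k : ℕ) {f : ℂ × ℂ → ℂ} (hf : ContDiff ℂ ∞ f) (c : ℂ)
    (e : ℂ × ℂ → ℂ) : biDiff Λ k (c • f) e = c • biDiff Λ k f e := by
  induction k generalizing f e with
  | zero => simp [biDiff]
  | succ k ih =>
    simp only [biDiff, pd_smul hf, ih (contDiff_pd hf _), Fin.sum_univ_two]
    module

theorem biDiff_add_right (k : ℕ) (e : ℂ × ℂ → ℂ) {f g : ℂ × ℂ → ℂ} (hf : ContDiff ℂ ∞ f)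
    (hg : ContDiff ℂ ∞ g) : biDiff Λ k e (f + g) = biDiff Λ k e f + biDiff Λ k e g := by
  induction k generalizing f g e with
  | zero => simp [biDiff, mul_add]
  | succ k ih =>
    simp only [biDiff, pd_add hf hg, ih _ (contDiff_pd hf _) (contDiff_pd hg _), Fin.sum_univ_two]
    module

theorem biDiff_smul_right (k : ℕ) (e : ℂ × ℂ → ℂ) {f : ℂ × ℂ → ℂ} (hf : ContDiff ℂ ∞ f) (c : ℂ) :
    biDiff Λ k e (c • f) = c • biDiff Λ k e f := by
  induction k generalizing f e with
  | zero => simp [biDiff]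
  | succ k ih =>
    simp only [biDiff, pd_smul hf, ih _ (contDiff_pd hf _), Fin.sum_univ_two]
    module

theorem pd_biDiff (k : ℕ) {f g : ℂ × ℂ → ℂ} (hf : ContDiff ℂ ∞ f) (hg : ContDiff ℂ ∞ g)
    (j : Fin 2) : pd j (biDiff Λ k f g) = biDiff Λ k (pd j f) g + biDiff Λ k f (pd j g) := by
  induction k generalizing f g with
  | zero => exact pd_mul hf hg j
  | succ k ih =>
    have hc := fun i l => contDiff_biDiff Λ k (contDiff_pd hf i) (contDiff_pd hg l)
    have hs := fun i l => contDiff_smul (Λ i l) (hc i l)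
    simp only [biDiff, Fin.sum_univ_two]
    rw [pd_add (contDiff_add (hs 0 0) (hs 0 1)) (contDiff_add (hs 1 0) (hs 1 1)),
      pd_add (hs 0 0) (hs 0 1), pd_add (hs 1 0) (hs 1 1)]
    simp only [pd_smul (hc _ _), ih (contDiff_pd hf _) (contDiff_pd hg _), pd_comm hf j,
      pd_comm hg j]
    module

/-- The vector field `∑ Λ^{ij} l_i ∂_j`; if `l` is the differential of a linear function `ℓ`, it is
the operator `biDiff Λ 1 ℓ`. -/
def hamField (l : Fin 2 → ℂ) (f : ℂ × ℂ → ℂ) : ℂ × ℂ → ℂ := ∑ i, ∑ j, (Λ i j * l i) • pd j f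

theorem pd_hamField (l : Fin 2 → ℂ) {f : ℂ × ℂ → ℂ} (hf : ContDiff ℂ ∞ f) (j : Fin 2) :
    pd j (hamField Λ l f) = hamField Λ l (pd j f) := by
  have hc := fun j => contDiff_pd hf j
  have hs := fun i j => contDiff_smul (Λ i j * l i) (hc j)
  simp only [hamField, Fin.sum_univ_two]
  rw [pd_add (contDiff_add (hs 0 0) (hs 0 1)) (contDiff_add (hs 1 0) (hs 1 1)),
    pd_add (hs 0 0) (hs 0 1), pd_add (hs 1 0) (hs 1 1)]
  simp only [pd_smul (hc _), pd_comm hf j]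

theorem biDiff_hamField_right (k : ℕ) (l : Fin 2 → ℂ) (e : ℂ × ℂ → ℂ) {f : ℂ × ℂ → ℂ}
    (hf : ContDiff ℂ ∞ f) :
    biDiff Λ k e (hamField Λ l f) = ∑ i, ∑ j, (Λ i j * l i) • biDiff Λ k e (pd j f) := by
  have hc := fun j => contDiff_pd hf j
  have hs := fun i j => contDiff_smul (Λ i j * l i) (hc j)
  simp only [hamField, Fin.sum_univ_two]
  rw [biDiff_add_right Λ k e (contDiff_add (hs 0 0) (hs 0 1)) (contDiff_add (hs 1 0) (hs 1 1)),
    biDiff_add_right Λ k e (hs 0 0) (hs 0 1), biDiff_add_right Λ k e (hs 1 0) (hs 1 1)]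
  simp only [biDiff_smul_right Λ k e (hc _)]

theorem biDiff_hamField_left (k : ℕ) (l : Fin 2 → ℂ) (e : ℂ × ℂ → ℂ) {f : ℂ × ℂ → ℂ}
    (hf : ContDiff ℂ ∞ f) :
    biDiff Λ k (hamField Λ l f) e = ∑ i, ∑ j, (Λ i j * l i) • biDiff Λ k (pd j f) e := by
  have hc := fun j => contDiff_pd hf j
  have hs := fun i j => contDiff_smul (Λ i j * l i) (hc j)
  simp only [hamField, Fin.sum_univ_two]
  rw [biDiff_add_left Λ k (contDiff_add (hs 0 0) (hs 0 1)) (contDiff_add (hs 1 0) (hs 1 1)),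
    biDiff_add_left Λ k (hs 0 0) (hs 0 1), biDiff_add_left Λ k (hs 1 0) (hs 1 1)]
  simp only [biDiff_smul_left Λ k (hc _)]

theorem hamField_biDiff (k : ℕ) (l : Fin 2 → ℂ) {f g : ℂ × ℂ → ℂ}
    (hf : ContDiff ℂ ∞ f) (hg : ContDiff ℂ ∞ g) :
    hamField Λ l (biDiff Λ k f g) =
      biDiff Λ k (hamField Λ l f) g + biDiff Λ k f (hamField Λ l g) := by
  rw [biDiff_hamField_right Λ k l f hg, biDiff_hamField_left Λ k l g hf, hamField]
  simp only [pd_biDiff Λ k hf hg, Fin.sum_univ_two]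
  module

/-- The Leibniz rule for multiplication by a linear function. -/
theorem biDiff_linear_mul {ℓ : ℂ × ℂ → ℂ} {l : Fin 2 → ℂ} (hℓ : ContDiff ℂ ∞ ℓ)
    (hl : ∀ i, pd i ℓ = fun _ => l i) (k : ℕ) {f g : ℂ × ℂ → ℂ}
    (hf : ContDiff ℂ ∞ f) (hg : ContDiff ℂ ∞ g) :
    biDiff Λ (k + 1) (ℓ * f) g =
      ℓ * biDiff Λ (k + 1) f g + ((k : ℂ) + 1) • biDiff Λ k f (hamField Λ l g) := by
  have hpd : ∀ {f : ℂ × ℂ → ℂ}, ContDiff ℂ ∞ f → ∀ i, pd i (ℓ * f) = l i • f + ℓ * pd i f := by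
    intro f hf i
    rw [pd_mul hℓ hf, hl]
    rfl
  induction k generalizing f g with
  | zero =>
    simp only [biDiff, hpd hf, hamField, Fin.sum_univ_two]
    funext p
    simp
    ring
  | succ k ih =>
    have e1 : ∀ i j, biDiff Λ (k + 1) (pd i (ℓ * f)) (pd j g) =
        l i • biDiff Λ (k + 1) f (pd j g) + (ℓ * biDiff Λ (k + 1) (pd i f) (pd j g)
          + ((k : ℂ) + 1) • biDiff Λ k (pd i f) (pd j (hamField Λ l g))) := by
      intro i j
      rw [hpd hf, biDiff_add_left Λ _ (contDiff_smul _ hf) (contDiff_mul hℓ (contDiff_pd hf i)),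
        biDiff_smul_left Λ _ hf, ih (contDiff_pd hf i) (contDiff_pd hg j), pd_hamField Λ l hg]
    have e2 : biDiff Λ (k + 1) f (hamField Λ l g) =
      ∑ i, ∑ j, Λ i j • biDiff Λ k (pd i f) (pd j (hamField Λ l g)) := rfl
    have e3 : biDiff Λ (k + 1 + 1) f g =
      ∑ i, ∑ j, Λ i j • biDiff Λ (k + 1) (pd i f) (pd j g) := rfl
    have e4 : biDiff Λ (k + 1 + 1) (ℓ * f) g =
      ∑ i, ∑ j, Λ i j • biDiff Λ (k + 1) (pd i (ℓ * f)) (pd j g) := rfl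
    have e5 := biDiff_hamField_right Λ (k + 1) l f hg
    have e6 : ((k + 1 : ℕ) : ℂ) + 1 = 1 + ((k : ℂ) + 1) := by push_cast; ring
    rw [e4, e6, add_smul, one_smul]
    nth_rewrite 1 [e5]
    rw [e2, e3]
    simp only [e1, Fin.sum_univ_two]
    funext p
    simp
    ring

/-! ### Polynomial symbols -/

/-- All partial derivatives of `f` of order `n` vanish. -/
def PdNil : ℕ → (ℂ × ℂ → ℂ) → Prop
  | 0, f => f = 0
  | n + 1, f => ∀ i, PdNil n (pd i f)

theorem pdNil_zero (n : ℕ) : PdNil n 0 := by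
  induction n with
  | zero => rfl
  | succ n ih => intro i; rw [pd_zero]; exact ih

theorem PdNil.succ {n : ℕ} {f : ℂ × ℂ → ℂ} (h : PdNil n f) : PdNil (n + 1) f := by
  induction n generalizing f with
  | zero => intro i; rw [show f = 0 from h, pd_zero]; exact pdNil_zero 0
  | succ n ih => exact fun i => ih (h i)

theorem PdNil.mono {n m : ℕ} (hnm : n ≤ m) {f : ℂ × ℂ → ℂ} (h : PdNil n f) : PdNil m f := by
  induction hnm with
  | refl => exact h
  | step _ ih => exact ih.succ

theorem PdNil.add {n : ℕ} {f g : ℂ × ℂ → ℂ} (hf' : ContDiff ℂ ∞ f) (hg' : ContDiff ℂ ∞ g)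
    (hf : PdNil n f) (hg : PdNil n g) : PdNil n (f + g) := by
  induction n generalizing f g with
  | zero => rw [show f = 0 from hf, show g = 0 from hg]; exact add_zero 0
  | succ n ih =>
    intro i
    rw [pd_add hf' hg']
    exact ih (contDiff_pd hf' i) (contDiff_pd hg' i) (hf i) (hg i)

theorem PdNil.smul {n : ℕ} {f : ℂ × ℂ → ℂ} (hf' : ContDiff ℂ ∞ f)
    (hf : PdNil n f) (c : ℂ) : PdNil n (c • f) := by
  induction n generalizing f with
  | zero => rw [show f = 0 from hf]; exact smul_zero c
  | succ n ih =>
    intro i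
    rw [pd_smul hf']
    exact ih (contDiff_pd hf' i) (hf i)

theorem PdNil.linear_mul {ℓ : ℂ × ℂ → ℂ} {l : Fin 2 → ℂ} (hℓ : ContDiff ℂ ∞ ℓ)
    (hl : ∀ i, pd i ℓ = fun _ => l i) {n : ℕ} {f : ℂ × ℂ → ℂ} (hf' : ContDiff ℂ ∞ f)
    (hf : PdNil n f) : PdNil (n + 1) (ℓ * f) := by
  induction n generalizing f with
  | zero => rw [show f = 0 from hf, mul_zero]; exact pdNil_zero 1
  | succ n ih =>
    intro i
    rw [pd_mul hℓ hf', hl]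
    exact (hf.smul hf' (l i)).add (hf'.const_smul (l i)) (hℓ.mul (contDiff_pd hf' i))
      (ih (contDiff_pd hf' i) (hf i))

theorem PdNil.biDiff_eq_zero {n k : ℕ} (hk : n ≤ k) {f : ℂ × ℂ → ℂ} (hf : PdNil n f)
    (g : ℂ × ℂ → ℂ) : biDiff Λ k f g = 0 := by
  induction n generalizing f g k with
  | zero => rw [show f = 0 from hf]; exact biDiff_zero_left Λ k g
  | succ n ih =>
    obtain ⟨k, rfl⟩ : ∃ m, k = m + 1 := ⟨k - 1, by omega⟩
    simp [biDiff, ih (by omega : n ≤ k) (hf _)]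

/-- A polynomial in `(u, v)`, in the form in which it is used: a smooth function whose partial
derivatives of some order vanish. -/
structure IsPoly (f : ℂ × ℂ → ℂ) : Prop where
  contDiff : ContDiff ℂ ∞ f
  pdNil : ∃ n, PdNil n f

theorem IsPoly.add {f g : ℂ × ℂ → ℂ} (hf : IsPoly f) (hg : IsPoly g) : IsPoly (f + g) := by
  obtain ⟨n, hn⟩ := hf.pdNil
  obtain ⟨m, hm⟩ := hg.pdNil
  exact ⟨hf.1.add hg.1, max n m, (hn.mono (le_max_left _ _)).add hf.1 hg.1
    (hm.mono (le_max_right _ _))⟩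

theorem IsPoly.smul {f : ℂ × ℂ → ℂ} (hf : IsPoly f) (c : ℂ) : IsPoly (c • f) := by
  obtain ⟨n, hn⟩ := hf.pdNil
  exact ⟨hf.1.const_smul c, n, hn.smul hf.1 c⟩

theorem isPoly_const (c : ℂ) : IsPoly fun _ => c :=
  ⟨contDiff_const, 1, fun i => pd_const i c⟩

theorem isPoly_genU : IsPoly genU :=
  ⟨contDiff_genU, 2, fun i j => by rw [pd_genU, pd_const]; rfl⟩

theorem isPoly_genV : IsPoly genV :=
  ⟨contDiff_genV, 2, fun i j => by rw [pd_genV, pd_const]; rfl⟩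

theorem IsPoly.linear_mul {ℓ : ℂ × ℂ → ℂ} {l : Fin 2 → ℂ} (hℓ : ContDiff ℂ ∞ ℓ)
    (hl : ∀ i, pd i ℓ = fun _ => l i) {f : ℂ × ℂ → ℂ} (hf : IsPoly f) : IsPoly (ℓ * f) := by
  obtain ⟨n, hn⟩ := hf.pdNil
  exact ⟨hℓ.mul hf.1, n + 1, hn.linear_mul hℓ hl hf.1⟩

theorem IsPoly.hamField (l : Fin 2 → ℂ) {f : ℂ × ℂ → ℂ} (hf : IsPoly f) :
    IsPoly (hamField Λ l f) := by
  obtain ⟨n, hn⟩ := hf.pdNil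
  have hp : ∀ j, IsPoly (pd j f) := fun j => ⟨contDiff_pd hf.1 j, n, hn.succ j⟩
  simp only [WeylStar.hamField, Fin.sum_univ_two]
  exact (((hp _).smul _).add ((hp _).smul _)).add (((hp _).smul _).add ((hp _).smul _))

/-! ### The product with a polynomial -/

variable {ħ κ τ : ℂ}

theorem starMul_eq_sum {n : ℕ} {f : ℂ × ℂ → ℂ} (hf : PdNil n f) (g : ℂ × ℂ → ℂ) :
    starMul ħ κ τ f g = ∑ k ∈ Finset.range n,
      ((I * ħ / 2) ^ k / (k.factorial : ℂ)) • biDiff (ordMatrix κ τ) k f g := by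
  funext p
  rw [starMul, tsum_eq_sum (s := Finset.range n)]
  · simp only [Finset.sum_apply, Pi.smul_apply, smul_eq_mul, div_pow]
    exact Finset.sum_congr rfl fun k _ => by rw [div_div, mul_comm (2 ^ k : ℂ)]
  · intro k hk
    rw [hf.biDiff_eq_zero _ (by simpa using hk) g]
    simp

theorem starMul_add_left {f g : ℂ × ℂ → ℂ} (hf : IsPoly f) (hg : IsPoly g) (e : ℂ × ℂ → ℂ) :
    starMul ħ κ τ (f + g) e = starMul ħ κ τ f e + starMul ħ κ τ g e := by
  obtain ⟨n, hn⟩ := hf.pdNil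
  obtain ⟨m, hm⟩ := hg.pdNil
  have hn := hn.mono (le_max_left n m)
  have hm := hm.mono (le_max_right n m)
  simp only [starMul_eq_sum hn, starMul_eq_sum hm, starMul_eq_sum (hn.add hf.1 hg.1 hm),
    biDiff_add_left _ _ hf.1 hg.1, smul_add, Finset.sum_add_distrib]

theorem starMul_smul_left {f : ℂ × ℂ → ℂ} (hf : IsPoly f) (c : ℂ) (e : ℂ × ℂ → ℂ) :
    starMul ħ κ τ (c • f) e = c • starMul ħ κ τ f e := by
  obtain ⟨n, hn⟩ := hf.pdNil
  simp only [starMul_eq_sum hn, starMul_eq_sum (hn.smul hf.1 c), biDiff_smul_left _ _ hf.1,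
    Finset.smul_sum, smul_comm c]

theorem starMul_add_right {e f g : ℂ × ℂ → ℂ} (he : IsPoly e) (hf : ContDiff ℂ ∞ f)
    (hg : ContDiff ℂ ∞ g) :
    starMul ħ κ τ e (f + g) = starMul ħ κ τ e f + starMul ħ κ τ e g := by
  obtain ⟨n, hn⟩ := he.pdNil
  simp only [starMul_eq_sum hn, biDiff_add_right _ _ _ hf hg, smul_add, Finset.sum_add_distrib]

theorem starMul_smul_right {e f : ℂ × ℂ → ℂ} (he : IsPoly e) (hf : ContDiff ℂ ∞ f) (c : ℂ) :
    starMul ħ κ τ e (c • f) = c • starMul ħ κ τ e f := by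
  obtain ⟨n, hn⟩ := he.pdNil
  simp only [starMul_eq_sum hn, biDiff_smul_right _ _ _ hf, Finset.smul_sum, smul_comm c]

theorem starMul_const_left (c : ℂ) (f : ℂ × ℂ → ℂ) :
    starMul ħ κ τ (fun _ => c) f = c • f := by
  rw [starMul_eq_sum (n := 1) fun i => pd_const i c]
  simp [biDiff]
  rfl

theorem contDiff_starMul {f g : ℂ × ℂ → ℂ} (hf : IsPoly f) (hg : ContDiff ℂ ∞ g) :
    ContDiff ℂ ∞ (starMul ħ κ τ f g) := by
  obtain ⟨n, hn⟩ := hf.pdNil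
  rw [starMul_eq_sum hn]
  have : ContDiff ℂ ∞ fun p => ∑ k ∈ Finset.range n,
      ((I * ħ / 2) ^ k / (k.factorial : ℂ)) • biDiff (ordMatrix κ τ) k f g p :=
    ContDiff.sum fun k _ => (contDiff_biDiff _ k hf.1 hg).const_smul _
  convert this using 2
  simp

theorem hamField_starMul {f g : ℂ × ℂ → ℂ} (hf : IsPoly f) (hg : ContDiff ℂ ∞ g)
    (l : Fin 2 → ℂ) :
    hamField (ordMatrix κ τ) l (starMul ħ κ τ f g) =
      starMul ħ κ τ (hamField (ordMatrix κ τ) l f) g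
        + starMul ħ κ τ f (hamField (ordMatrix κ τ) l g) := by
  obtain ⟨n, hn⟩ := hf.pdNil
  obtain ⟨m, hm⟩ := (hf.hamField (ordMatrix κ τ) l).pdNil
  have hn := hn.mono (le_max_left n m)
  have hm := hm.mono (le_max_right n m)
  rw [starMul_eq_sum hn, starMul_eq_sum hn, starMul_eq_sum hm, ← Finset.sum_add_distrib]
  simp only [← smul_add, ← hamField_biDiff _ _ l hf.1 hg]
  generalize max n m = N
  induction N with
  | zero => simp [hamField, pd_zero]
  | succ N ih =>
    have hc := fun k => contDiff_biDiff (ordMatrix κ τ) k hf.1 hg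
    have hs : ContDiff ℂ ∞ (∑ k ∈ Finset.range N,
        ((I * ħ / 2) ^ k / (k.factorial : ℂ)) • biDiff (ordMatrix κ τ) k f g) := by
      have : ContDiff ℂ ∞ fun p => ∑ k ∈ Finset.range N,
          ((I * ħ / 2) ^ k / (k.factorial : ℂ)) • biDiff (ordMatrix κ τ) k f g p :=
        ContDiff.sum fun k _ => (hc k).const_smul _
      convert this using 2
      simp
    have hN := contDiff_smul ((I * ħ / 2) ^ N / (N.factorial : ℂ)) (hc N)
    rw [Finset.sum_range_succ, Finset.sum_range_succ, ← ih]
    simp only [hamField, pd_add hs hN, pd_smul (hc N), Fin.sum_univ_two]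
    module

theorem starMul_linear {ℓ : ℂ × ℂ → ℂ} {l : Fin 2 → ℂ} (hl : ∀ i, pd i ℓ = fun _ => l i)
    (g : ℂ × ℂ → ℂ) :
    starMul ħ κ τ ℓ g = ℓ * g + (I * ħ / 2) • hamField (ordMatrix κ τ) l g := by
  rw [starMul_eq_sum (n := 2) fun i j => by rw [hl, pd_const]; rfl]
  simp only [Finset.sum_range_succ, Finset.sum_range_zero, biDiff, hamField, hl]
  funext p
  simp
  ring

theorem IsPoly.starMul_linear {ℓ : ℂ × ℂ → ℂ} {l : Fin 2 → ℂ} (hℓ : ContDiff ℂ ∞ ℓ)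
    (hl : ∀ i, pd i ℓ = fun _ => l i) {f : ℂ × ℂ → ℂ} (hf : IsPoly f) :
    IsPoly (starMul ħ κ τ ℓ f) := by
  rw [WeylStar.starMul_linear hl]
  exact (hf.linear_mul hℓ hl).add ((hf.hamField _ l).smul _)

/-- Associativity of the `*`-product for a linear function, a polynomial and a smooth function. -/
theorem starMul_assoc_linear {ℓ : ℂ × ℂ → ℂ} {l : Fin 2 → ℂ} (hℓ : ContDiff ℂ ∞ ℓ)
    (hl : ∀ i, pd i ℓ = fun _ => l i) {f g : ℂ × ℂ → ℂ} (hf : IsPoly f) (hg : ContDiff ℂ ∞ g) :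
    starMul ħ κ τ (starMul ħ κ τ ℓ f) g = starMul ħ κ τ ℓ (starMul ħ κ τ f g) := by
  obtain ⟨n, hn⟩ := hf.pdNil
  have h1 : starMul ħ κ τ (ℓ * f) g =
      ℓ * starMul ħ κ τ f g
        + (I * ħ / 2) • starMul ħ κ τ f (hamField (ordMatrix κ τ) l g) := by
    rw [starMul_eq_sum (hn.linear_mul hℓ hl hf.1), starMul_eq_sum hn.succ, starMul_eq_sum hn,
      Finset.sum_range_succ', Finset.sum_range_succ', mul_add, Finset.mul_sum, Finset.smul_sum,
      add_right_comm, ← Finset.sum_add_distrib]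
    congr 1
    · refine Finset.sum_congr rfl fun k _ => ?_
      rw [biDiff_linear_mul _ hℓ hl k hf.1 hg]
      have hk : (k.factorial : ℂ) ≠ 0 := by exact_mod_cast k.factorial_ne_zero
      have hk' : (k : ℂ) + 1 ≠ 0 := by exact_mod_cast k.succ_ne_zero
      funext p
      simp only [Pi.smul_apply, Pi.add_apply, Pi.mul_apply, smul_eq_mul, Nat.factorial_succ]
      push_cast
      field_simp
      ring
    · funext p
      simp [biDiff]
      ring
  rw [starMul_linear hl f, starMul_linear hl (starMul ħ κ τ f g), hamField_starMul hf hg,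
    starMul_add_left (hf.linear_mul hℓ hl) ((hf.hamField _ l).smul _),
    starMul_smul_left (hf.hamField _ l), h1]
  module

/-! ### The opposite product -/

/-- The opposite of the `*`-product is the `*`-product for the opposite parameters, because
`-Λ` for the parameters `(-κ, -τ)` is the transpose of `Λ`. Statements on products from the right
are obtained in this way from those on products from the left. -/
theorem starMul_neg (f g : ℂ × ℂ → ℂ) :
    starMul (-ħ) (-κ) (-τ) f g = starMul ħ κ τ g f := by
  have h : ordMatrix (-κ) (-τ) = -(ordMatrix κ τ).transpose := by
    ext i j
    fin_cases i <;> fin_cases j <;> simp [ordMatrix] <;> ring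
  funext p
  simp only [starMul, h, biDiff_neg_transpose, Pi.smul_apply, smul_eq_mul]
  refine tsum_congr fun k => ?_
  rw [mul_neg, neg_pow (I * ħ), ← mul_assoc]
  congr 1
  have : ((-1 : ℂ) ^ k) * (-1) ^ k = 1 := by rw [← mul_pow]; simp
  linear_combination ((I * ħ) ^ k / (k.factorial * 2 ^ k)) * this

theorem elemX_neg : elemX (-ħ) (-κ) (-τ) = -elemX ħ κ τ := by
  simp only [elemX, starMul_neg]
  funext p
  simp
  ring

theorem starExp_neg (t : ℝ) : starExp ħ κ τ (-t) = starExp (-ħ) (-κ) (-τ) t := by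
  have h1 : expDelta (-κ) t = expDelta κ (-t) := by
    simp only [expDelta]; push_cast; ring_nf
  have h2 : expPhase (-κ) t = -expPhase κ (-t) := by
    simp only [expPhase, h1]; push_cast; ring_nf
  ext p
  change 2 / expDelta κ (-t) * exp (1 / (I * ħ) * (expPhase κ (-t) ^ 2 * τ * p.1 ^ 2
      + 2 * expPhase κ (-t) * (p.1 * p.2))) =
    2 / expDelta (-κ) t * exp (1 / (I * -ħ) * (expPhase (-κ) t ^ 2 * -τ * p.1 ^ 2
      + 2 * expPhase (-κ) t * (p.1 * p.2)))
  rw [h1, h2, mul_neg, div_neg]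
  ring_nf

theorem Admissible.neg {κ : ℂ} (h : Admissible κ) : Admissible (-κ) := by
  rintro ⟨h1, h2⟩
  simp only [neg_im, neg_eq_zero, neg_re] at h1 h2
  exact h ⟨h1, by rcases h2 with h2 | h2 <;> [right; left] <;> linarith⟩

/-! ### The quadratic element -/

theorem isPoly_starMul_genU {f : ℂ × ℂ → ℂ} (hf : IsPoly f) : IsPoly (starMul ħ κ τ genU f) :=
  hf.starMul_linear contDiff_genU pd_genU

theorem isPoly_starMul_genV {f : ℂ × ℂ → ℂ} (hf : IsPoly f) : IsPoly (starMul ħ κ τ genV f) :=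
  hf.starMul_linear contDiff_genV pd_genV

theorem isPoly_elemX (ħ κ τ : ℂ) : IsPoly (elemX ħ κ τ) :=
  (((isPoly_starMul_genU isPoly_genV).add (isPoly_starMul_genV isPoly_genU)).smul _).smul _

theorem starMul_elemX {f : ℂ × ℂ → ℂ} (hf : ContDiff ℂ ∞ f) :
    starMul ħ κ τ (elemX ħ κ τ) f = (1 / (I * ħ)) • ((1 / 2 : ℂ) •
      (starMul ħ κ τ genU (starMul ħ κ τ genV f) + starMul ħ κ τ genV (starMul ħ κ τ genU f))) := by
  have h1 : IsPoly (starMul ħ κ τ genU genV) := isPoly_starMul_genU isPoly_genV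
  have h2 : IsPoly (starMul ħ κ τ genV genU) := isPoly_starMul_genV isPoly_genU
  rw [elemX, starMul_smul_left ((h1.add h2).smul _), starMul_smul_left (h1.add h2),
    starMul_add_left h1 h2, starMul_assoc_linear contDiff_genU pd_genU isPoly_genV hf,
    starMul_assoc_linear contDiff_genV pd_genV isPoly_genU hf]

theorem isPoly_starMul_elemX {f : ℂ × ℂ → ℂ} (hf : IsPoly f) :
    IsPoly (starMul ħ κ τ (elemX ħ κ τ) f) := by
  rw [starMul_elemX hf.1]
  exact (((isPoly_starMul_genU (isPoly_starMul_genV hf)).add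
    (isPoly_starMul_genV (isPoly_starMul_genU hf))).smul _).smul _

theorem starMul_elemX_assoc {f g : ℂ × ℂ → ℂ} (hf : IsPoly f) (hg : ContDiff ℂ ∞ g) :
    starMul ħ κ τ (starMul ħ κ τ (elemX ħ κ τ) f) g =
      starMul ħ κ τ (elemX ħ κ τ) (starMul ħ κ τ f g) := by
  have hu : IsPoly (starMul ħ κ τ genU f) := isPoly_starMul_genU hf
  have hv : IsPoly (starMul ħ κ τ genV f) := isPoly_starMul_genV hf
  have huv : IsPoly (starMul ħ κ τ genU (starMul ħ κ τ genV f)) := isPoly_starMul_genU hv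
  have hvu : IsPoly (starMul ħ κ τ genV (starMul ħ κ τ genU f)) := isPoly_starMul_genV hu
  rw [starMul_elemX hf.1, starMul_elemX (contDiff_starMul hf hg),
    starMul_smul_left ((huv.add hvu).smul _), starMul_smul_left (huv.add hvu),
    starMul_add_left huv hvu, starMul_assoc_linear contDiff_genU pd_genU hv hg,
    starMul_assoc_linear contDiff_genV pd_genV hf hg,
    starMul_assoc_linear contDiff_genV pd_genV hu hg,
    starMul_assoc_linear contDiff_genU pd_genU hf hg]

/-! ### From inverses of `z ± X` to inverses of `z² - X * X` -/

theorem starMul_const_add_smul_elemX (z a : ℂ) (f : ℂ × ℂ → ℂ) :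
    starMul ħ κ τ (fun p => z + a * elemX ħ κ τ p) f =
      z • f + a • starMul ħ κ τ (elemX ħ κ τ) f := by
  have h := starMul_add_left (ħ := ħ) (κ := κ) (τ := τ) (isPoly_const z)
    ((isPoly_elemX ħ κ τ).smul a) f
  rw [starMul_const_left, starMul_smul_left (isPoly_elemX ħ κ τ)] at h
  exact h

theorem starMul_elemX_const (c : ℂ) :
    starMul ħ κ τ (elemX ħ κ τ) (fun _ => c) = c • elemX ħ κ τ := by
  rw [← starMul_neg, starMul_const_left]

/-- If `a X * f = b - z f` with `a = ±1`, then `(z² - X * X) * f = b (z - a X)`. -/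
theorem starMul_sq_sub {z a b : ℂ} (ha : a ^ 2 = 1) {f : ℂ × ℂ → ℂ} (hf : ContDiff ℂ ∞ f)
    (h : starMul ħ κ τ (elemX ħ κ τ) f = a • ((fun _ => b) - z • f)) :
    starMul ħ κ τ (fun p => z ^ 2 - starMul ħ κ τ (elemX ħ κ τ) (elemX ħ κ τ) p) f =
      fun p => b * (z - a * elemX ħ κ τ p) := by
  have hX := isPoly_elemX ħ κ τ
  have hXX : IsPoly (starMul ħ κ τ (elemX ħ κ τ) (elemX ħ κ τ)) := isPoly_starMul_elemX hX
  have h1 : (fun p => z ^ 2 - starMul ħ κ τ (elemX ħ κ τ) (elemX ħ κ τ) p) =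
      (fun _ => z ^ 2) + (-1 : ℂ) • starMul ħ κ τ (elemX ħ κ τ) (elemX ħ κ τ) := by
    funext p; simp [sub_eq_add_neg]
  have hb : ContDiff ℂ ∞ (fun _ : ℂ × ℂ => b) := contDiff_const
  rw [h1, starMul_add_left (isPoly_const _) (hXX.smul _), starMul_const_left,
    starMul_smul_left hXX, starMul_elemX_assoc hX hf, h,
    show a • ((fun _ : ℂ × ℂ => b) - z • f) = a • ((fun _ => b) + (-z) • f) by
      rw [neg_smul, sub_eq_add_neg],
    starMul_smul_right hX (contDiff_add hb (contDiff_smul _ hf)),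
    starMul_add_right hX hb (contDiff_smul _ hf), starMul_smul_right hX hf, starMul_elemX_const, h]
  funext p
  simp
  linear_combination (z * b - z ^ 2 * f p) * ha

end StarProduct

/-! ### Gaussian transforms -/

section GaussTransform

variable {A : Type*} [NormedCommRing A] [NormedAlgebra ℂ A]

/-- The exponential `exp (1/(iħ) (s²τu² + 2suv))`, for `s` in a commutative Banach algebra `A`. -/
def gauss (ħ τ : ℂ) (s : A) (p : ℂ × ℂ) : A :=
  NormedSpace.exp ((1 / (I * ħ) * τ * p.1 ^ 2) • s ^ 2 + (1 / (I * ħ) * 2 * (p.1 * p.2)) • s)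

theorem gauss_neg (ħ τ : ℂ) (s : A) : gauss (-ħ) (-τ) (-s) = gauss ħ τ s := by
  funext p
  have h : 1 / (I * -ħ) = -(1 / (I * ħ)) := by rw [mul_neg, div_neg]
  simp only [gauss, h, neg_sq, smul_neg, ← neg_smul]
  congr 3 <;> ring

variable [CompleteSpace A]

theorem contDiff_gauss (ħ τ : ℂ) (s : A) : ContDiff ℂ ∞ (gauss ħ τ s) := by
  have h1 : ContDiff ℂ ∞ (NormedSpace.exp : A → A) :=
    contDiff_iff_contDiffAt.2 fun x => (NormedSpace.exp_analytic (𝕂 := ℂ) x).contDiffAt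
  have h2 : ContDiff ℂ ∞ fun p : ℂ × ℂ => 1 / (I * ħ) * τ * p.1 ^ 2 := by fun_prop
  have h3 : ContDiff ℂ ∞ fun p : ℂ × ℂ => 1 / (I * ħ) * 2 * (p.1 * p.2) := by fun_prop
  exact h1.comp ((h2.smul contDiff_const).add (h3.smul contDiff_const))

theorem hasDerivAt_gauss_fst (ħ τ : ℂ) (s : A) (p : ℂ × ℂ) :
    HasDerivAt (fun x => gauss ħ τ s (x, p.2)) (gauss ħ τ s p *
      ((1 / (I * ħ) * τ * (2 * p.1)) • s ^ 2 + (1 / (I * ħ) * 2 * p.2) • s)) p.1 := by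
  have h1 : HasDerivAt (fun x : ℂ => (1 / (I * ħ) * τ * x ^ 2) • s ^ 2
      + (1 / (I * ħ) * 2 * (x * p.2)) • s)
      ((1 / (I * ħ) * τ * (2 * p.1)) • s ^ 2 + (1 / (I * ħ) * 2 * p.2) • s) p.1 := by
    have a1 := (((hasDerivAt_id p.1).pow 2).const_mul (1 / (I * ħ) * τ)).smul_const (s ^ 2)
    have a2 := (((hasDerivAt_id p.1).mul_const p.2).const_mul (1 / (I * ħ) * 2)).smul_const s
    exact (a1.add a2).congr_deriv (by simp)
  have h2 := (hasStrictFDerivAt_exp (𝕂 := ℂ) (x := (1 / (I * ħ) * τ * p.1 ^ 2) • s ^ 2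
      + (1 / (I * ħ) * 2 * (p.1 * p.2)) • s)).hasFDerivAt.comp_hasDerivAt p.1 h1
  exact h2

theorem hasDerivAt_gauss_snd (ħ τ : ℂ) (s : A) (p : ℂ × ℂ) :
    HasDerivAt (fun y => gauss ħ τ s (p.1, y)) (gauss ħ τ s p *
      ((1 / (I * ħ) * 2 * p.1) • s)) p.2 := by
  have h1 : HasDerivAt (fun y : ℂ => (1 / (I * ħ) * τ * p.1 ^ 2) • s ^ 2
      + (1 / (I * ħ) * 2 * (p.1 * y)) • s) ((1 / (I * ħ) * 2 * p.1) • s) p.2 := by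
    have a2 := (((hasDerivAt_id p.2).const_mul p.1).const_mul (1 / (I * ħ) * 2)).smul_const s
    exact (a2.const_add ((1 / (I * ħ) * τ * p.1 ^ 2) • s ^ 2)).congr_deriv (by simp)
  have h2 := (hasStrictFDerivAt_exp (𝕂 := ℂ) (x := (1 / (I * ħ) * τ * p.1 ^ 2) • s ^ 2
      + (1 / (I * ħ) * 2 * (p.1 * p.2)) • s)).hasFDerivAt.comp_hasDerivAt p.2 h1
  exact h2

variable (J : A →L[ℂ] ℂ) (ħ τ : ℂ) (s : A)

theorem contDiff_apply_gauss (m : A) : ContDiff ℂ ∞ fun p => J (m * gauss ħ τ s p) :=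
  J.contDiff.comp (contDiff_const.mul (contDiff_gauss ħ τ s))

/-- The superposition `p ↦ J (m · exp (1/(iħ) (s²τu² + 2suv)))` of Gaussian exponentials, as a
continuous linear function of the density `m ∈ A`. -/
def transform : A →L[ℂ] Hol where
  toFun m := ⟨⟨fun p => J (m * gauss ħ τ s p), (contDiff_apply_gauss J ħ τ s m).continuous⟩,
    (contDiff_apply_gauss J ħ τ s m).differentiable (by simp)⟩
  map_add' m n := by
    ext p
    simp [add_mul]
  map_smul' c m := by
    ext p
    simp
  cont := by
    refine Continuous.subtype_mk (ContinuousMap.continuous_of_continuous_uncurry _ ?_) _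
    exact J.continuous.comp
      (continuous_fst.mul ((contDiff_gauss ħ τ s).continuous.comp continuous_snd))

theorem transform_apply (m : A) (p : ℂ × ℂ) :
    (transform J ħ τ s m).1 p = J (m * gauss ħ τ s p) := rfl

theorem transform_neg : transform J (-ħ) (-τ) (-s) = transform J ħ τ s := by
  ext m p
  simp only [transform_apply, gauss_neg]

theorem contDiff_transform (m : A) : ContDiff ℂ ∞ (transform J ħ τ s m).1 :=
  contDiff_apply_gauss J ħ τ s m

theorem hasDerivAt_transform_fst (m : A) (p : ℂ × ℂ) :
    HasDerivAt (fun x => (transform J ħ τ s m).1 (x, p.2))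
      (1 / (I * ħ) * (2 * τ * p.1 * (transform J ħ τ s (m * s ^ 2)).1 p
        + 2 * p.2 * (transform J ħ τ s (m * s)).1 p)) p.1 := by
  have h := J.hasFDerivAt.comp_hasDerivAt p.1 ((hasDerivAt_gauss_fst ħ τ s p).const_mul m)
  refine h.congr_deriv ?_
  simp only [transform_apply, mul_add, mul_smul_comm, map_add, map_smul, smul_eq_mul]
  rw [show m * (gauss ħ τ s p * s ^ 2) = m * s ^ 2 * gauss ħ τ s p by ring,
    show m * (gauss ħ τ s p * s) = m * s * gauss ħ τ s p by ring]
  ring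

theorem hasDerivAt_transform_snd (m : A) (p : ℂ × ℂ) :
    HasDerivAt (fun y => (transform J ħ τ s m).1 (p.1, y))
      (1 / (I * ħ) * (2 * p.1 * (transform J ħ τ s (m * s)).1 p)) p.2 := by
  have h := J.hasFDerivAt.comp_hasDerivAt p.2 ((hasDerivAt_gauss_snd ħ τ s p).const_mul m)
  refine h.congr_deriv ?_
  simp only [transform_apply, mul_smul_comm, map_smul, smul_eq_mul]
  rw [show m * (gauss ħ τ s p * s) = m * s * gauss ħ τ s p by ring]
  ring

/-! ### Left and right multiplication by the generators -/

variable (κ : ℂ)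

theorem starMul_genU_apply (g : ℂ × ℂ → ℂ) (p : ℂ × ℂ) :
    starMul ħ κ τ genU g p = p.1 * g p + I * ħ / 2 * ((κ - 1) * pd 1 g p) := by
  have h : hamField (ordMatrix κ τ) (fun i => if i = 0 then 1 else 0) g p =
      (κ - 1) * pd 1 g p := by
    simp [hamField, Fin.sum_univ_two, ordMatrix, sub_eq_add_neg]
  rw [starMul_linear pd_genU, ← h]
  rfl

theorem starMul_genV_apply (g : ℂ × ℂ → ℂ) (p : ℂ × ℂ) :
    starMul ħ κ τ genV g p =
      p.2 * g p + I * ħ / 2 * ((κ + 1) * pd 0 g p + τ * pd 1 g p) := by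
  have h : hamField (ordMatrix κ τ) (fun i => if i = 0 then 0 else 1) g p =
      (κ + 1) * pd 0 g p + τ * pd 1 g p := by
    simp [hamField, Fin.sum_univ_two, ordMatrix]
  rw [starMul_linear pd_genV, ← h]
  rfl

theorem starMul_apply_genV (g : ℂ × ℂ → ℂ) (p : ℂ × ℂ) :
    starMul ħ κ τ g genV p =
      p.2 * g p + I * ħ / 2 * ((κ - 1) * pd 0 g p + τ * pd 1 g p) := by
  rw [← starMul_neg, starMul_genV_apply]
  ring

theorem elemX_eq_genU_genV {ħ : ℂ} (hħ : ħ ≠ 0) :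
    elemX ħ κ τ = (1 / (I * ħ)) • starMul ħ κ τ genU genV + fun _ => (1 / 2 : ℂ) := by
  rw [elemX_apply hħ]
  funext p
  have hc : I * ħ * (1 / (I * ħ)) = 1 := by field_simp
  simp only [Pi.add_apply, Pi.smul_apply, smul_eq_mul, starMul_genU_apply, pd_genV, genV,
    one_ne_zero, if_false]
  linear_combination (-(κ - 1) / 2) * hc

theorem starMul_elemX_eq {ħ : ℂ} (hħ : ħ ≠ 0) {g : ℂ × ℂ → ℂ} (hg : ContDiff ℂ ∞ g) (p : ℂ × ℂ) :
    starMul ħ κ τ (elemX ħ κ τ) g p =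
      1 / (I * ħ) * starMul ħ κ τ genU (starMul ħ κ τ genV g) p + 1 / 2 * g p := by
  have h : IsPoly (starMul ħ κ τ genU genV) := isPoly_starMul_genU isPoly_genV
  rw [elemX_eq_genU_genV τ κ hħ, starMul_add_left (h.smul _) (isPoly_const _),
    starMul_smul_left h, starMul_const_left,
    starMul_assoc_linear contDiff_genU pd_genU isPoly_genV hg]
  rfl

variable {ħ}

theorem starMul_elemX_transform (hħ : ħ ≠ 0) (m : A) (p : ℂ × ℂ) :
    starMul ħ κ τ (elemX ħ κ τ) (transform J ħ τ s m).1 p =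
      κ / 2 * (transform J ħ τ s m).1 p + (κ ^ 2 - 1) / 2 * (transform J ħ τ s (m * s)).1 p
      + 1 / (I * ħ) * (p.1 * p.2) * ((transform J ħ τ s m).1 p
        + 2 * κ * (transform J ħ τ s (m * s)).1 p
        + (κ ^ 2 - 1) * (transform J ħ τ s (m * s * s)).1 p)
      + 1 / (I * ħ) * τ * p.1 ^ 2 * ((transform J ħ τ s (m * s)).1 p
        + 2 * κ * (transform J ħ τ s (m * s * s)).1 p
        + (κ ^ 2 - 1) * (transform J ħ τ s (m * s * s * s)).1 p) := by
  have hv : starMul ħ κ τ genV (transform J ħ τ s m).1 = fun p =>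
      p.2 * ((transform J ħ τ s m).1 p + (κ + 1) * (transform J ħ τ s (m * s)).1 p)
      + τ * p.1 * ((transform J ħ τ s (m * s)).1 p
        + (κ + 1) * (transform J ħ τ s (m * s * s)).1 p) := by
    funext q
    rw [starMul_genV_apply]
    have h0 : pd 0 (transform J ħ τ s m).1 q = _ := (hasDerivAt_transform_fst J ħ τ s m q).deriv
    have h1 : pd 1 (transform J ħ τ s m).1 q = _ := (hasDerivAt_transform_snd J ħ τ s m q).deriv
    rw [h0, h1, show m * s ^ 2 = m * s * s by ring]
    field_simp
    ring
  have hd := hasDerivAt_transform_snd J ħ τ s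
  have hD := ((hasDerivAt_id p.2).mul ((hd m p).add ((hd (m * s) p).const_mul (κ + 1)))).add
    (((hd (m * s) p).add ((hd (m * s * s) p).const_mul (κ + 1))).const_mul (τ * p.1))
  have hp : pd 1 (starMul ħ κ τ genV (transform J ħ τ s m).1) p = _ :=
    (congrArg (fun f => pd 1 f p) hv).trans hD.deriv
  rw [starMul_elemX_eq τ κ hħ (contDiff_transform J ħ τ s m), starMul_genU_apply, hp, hv]
  simp only [id, Pi.add_apply]
  field_simp
  ring

/-- Gaussian transforms commute with `X`: the formula for the product with `X` from the left is
invariant under the change of sign of `ħ`, `κ`, `τ` and `s`, up to the sign of `X`. -/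
theorem transform_starMul_elemX (hħ : ħ ≠ 0) (m : A) :
    starMul ħ κ τ (transform J ħ τ s m).1 (elemX ħ κ τ) =
      starMul ħ κ τ (elemX ħ κ τ) (transform J ħ τ s m).1 := by
  funext p
  have h := starMul_elemX_transform (A := A) J (-τ) (-s) (-κ) (neg_ne_zero.2 hħ) m p
  have hX : elemX (-ħ) (-κ) (-τ) = (-1 : ℂ) • elemX ħ κ τ := by rw [elemX_neg]; simp
  rw [transform_neg, hX, starMul_smul_left (isPoly_elemX ħ κ τ), starMul_neg] at h
  rw [starMul_elemX_transform J τ s κ hħ]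
  simp only [mul_neg, neg_mul, neg_neg, map_neg, Submodule.coe_neg, ContinuousMap.neg_apply,
    Pi.smul_apply, smul_eq_mul, one_mul, div_neg] at h
  linear_combination -h

theorem genU_transform_genV (hħ : ħ ≠ 0) (m : A) (p : ℂ × ℂ) :
    starMul ħ κ τ (starMul ħ κ τ genU (transform J ħ τ s m).1) genV p =
      p.1 * p.2 * ((transform J ħ τ s m).1 p
        + 2 * (κ - 1) * (transform J ħ τ s (m * s)).1 p
        + (κ - 1) ^ 2 * (transform J ħ τ s (m * s * s)).1 p)
      + τ * p.1 ^ 2 * ((transform J ħ τ s (m * s)).1 p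
        + 2 * (κ - 1) * (transform J ħ τ s (m * s * s)).1 p
        + (κ - 1) ^ 2 * (transform J ħ τ s (m * s * s * s)).1 p)
      + I * ħ * (κ - 1) / 2 * ((transform J ħ τ s m).1 p
        + (κ - 1) * (transform J ħ τ s (m * s)).1 p) := by
  have hu : starMul ħ κ τ genU (transform J ħ τ s m).1 = fun p =>
      p.1 * ((transform J ħ τ s m).1 p + (κ - 1) * (transform J ħ τ s (m * s)).1 p) := by
    funext q
    rw [starMul_genU_apply]
    have h1 : pd 1 (transform J ħ τ s m).1 q = _ := (hasDerivAt_transform_snd J ħ τ s m q).deriv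
    rw [h1]
    field_simp
  have hd := hasDerivAt_transform_snd J ħ τ s
  have hd' := hasDerivAt_transform_fst J ħ τ s
  have hD := ((hd m p).add ((hd (m * s) p).const_mul (κ - 1))).const_mul p.1
  have hD' := (hasDerivAt_id p.1).mul ((hd' m p).add ((hd' (m * s) p).const_mul (κ - 1)))
  have hp : pd 1 (starMul ħ κ τ genU (transform J ħ τ s m).1) p = _ :=
    (congrArg (fun f => pd 1 f p) hu).trans hD.deriv
  have hp' : pd 0 (starMul ħ κ τ genU (transform J ħ τ s m).1) p = _ :=
    (congrArg (fun f => pd 0 f p) hu).trans hD'.deriv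
  rw [starMul_apply_genV, hp, hp', hu]
  simp only [id, Pi.add_apply]
  rw [show m * s ^ 2 = m * s * s by ring, show m * s * s ^ 2 = m * s * s * s by ring]
  field_simp
  ring

/-- The two ways of multiplying a Gaussian transform by `u` from the left and `v` from the right
agree. -/
theorem genU_transform_genV' (hħ : ħ ≠ 0) (m : A) :
    starMul ħ κ τ genU (starMul ħ κ τ (transform J ħ τ s m).1 genV) =
      starMul ħ κ τ (starMul ħ κ τ genU (transform J ħ τ s m).1) genV := by
  have hv : starMul ħ κ τ (transform J ħ τ s m).1 genV = fun p =>
      p.2 * ((transform J ħ τ s m).1 p + (κ - 1) * (transform J ħ τ s (m * s)).1 p)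
      + τ * p.1 * ((transform J ħ τ s (m * s)).1 p
        + (κ - 1) * (transform J ħ τ s (m * s * s)).1 p) := by
    funext q
    rw [starMul_apply_genV]
    have h0 : pd 0 (transform J ħ τ s m).1 q = _ := (hasDerivAt_transform_fst J ħ τ s m q).deriv
    have h1 : pd 1 (transform J ħ τ s m).1 q = _ := (hasDerivAt_transform_snd J ħ τ s m q).deriv
    rw [h0, h1, show m * s ^ 2 = m * s * s by ring]
    field_simp
    ring
  funext p
  have hd := hasDerivAt_transform_snd J ħ τ s
  have hD := ((hasDerivAt_id p.2).mul ((hd m p).add ((hd (m * s) p).const_mul (κ - 1)))).add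
    (((hd (m * s) p).add ((hd (m * s * s) p).const_mul (κ - 1))).const_mul (τ * p.1))
  have hp : pd 1 (starMul ħ κ τ (transform J ħ τ s m).1 genV) p = _ :=
    (congrArg (fun f => pd 1 f p) hv).trans hD.deriv
  rw [genU_transform_genV J τ s κ hħ, starMul_genU_apply, hp, hv]
  simp only [id, Pi.add_apply]
  field_simp
  ring

end GaussTransform

/-! ### Derivatives of functions with values in a topological vector space -/

/-- Composition with a continuous linear map into a topological vector space which need not be
normed, such as `Hol`. -/
theorem _root_.DifferentiableWithinAt.continuousLinearMap_comp {E F H : Type*}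
    [NormedAddCommGroup E] [NormedSpace ℂ E] [NormedAddCommGroup F] [NormedSpace ℂ F]
    [AddCommGroup H] [Module ℂ H] [TopologicalSpace H]
    (T : F →L[ℂ] H) {k : E → F} {S : Set E} {x : E} (hk : DifferentiableWithinAt ℂ k S x) :
    DifferentiableWithinAt ℂ (fun z => T (k z)) S x := by
  obtain ⟨k', hk'⟩ := hk
  refine ⟨T.comp k', .of_isLittleOTVS ?_⟩
  refine ((T.isBigOTVS_comp).trans_isLittleOTVS hk'.isLittleOTVS).congr_left fun p => ?_
  simp

/-! ### The continued Mellin functional -/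

section MellinFunctional

theorem continuousMap_exp_apply {Y : Type*} [TopologicalSpace Y] [CompactSpace Y] (f : C(Y, ℂ))
    (y : Y) : NormedSpace.exp f y = exp (f y) := by
  rw [Complex.exp_eq_exp_ℂ]
  exact NormedSpace.map_exp (ContinuousMap.evalAlgHom ℂ ℂ y)
    (ContinuousEvalConst.continuous_eval_const y) f

/-- Pairs of continuous functions, one on the circle of radius `R` in the `q`-plane and one on the
interval `[log (R/2), 0]` of the `t`-line, where `q = e^t`. -/
abbrev MellinAlg (R : ℝ) : Type :=
  C(Metric.sphere (0 : ℂ) |R|, ℂ) × C(Icc (Real.log (R / 2)) 0, ℂ)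

/-- The mean value over the circle of radius `R`. -/
def circMean (R : ℝ) : C(Metric.sphere (0 : ℂ) |R|, ℂ) →L[ℂ] ℂ :=
  LinearMap.mkContinuous
    { toFun := fun f => (2 * Real.pi : ℂ)⁻¹ *
        ∫ θ in (0 : ℝ)..2 * Real.pi, f ⟨circleMap 0 R θ, circleMap_mem_sphere' 0 R θ⟩
      map_add' := fun f g => by
        simp only [ContinuousMap.add_apply]
        rw [intervalIntegral.integral_add, mul_add] <;>
          exact Continuous.intervalIntegrable (by fun_prop) _ _
      map_smul' := fun c f => by
        simp only [ContinuousMap.smul_apply, smul_eq_mul, RingHom.id_apply]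
        rw [intervalIntegral.integral_const_mul]
        ring } 1 fun f => by
    have h := intervalIntegral.norm_integral_le_of_norm_le_const (a := 0) (b := 2 * Real.pi)
      (C := ‖f‖) (f := fun θ => f ⟨circleMap 0 R θ, circleMap_mem_sphere' 0 R θ⟩)
      fun θ _ => f.norm_coe_le_norm _
    rw [sub_zero, abs_of_pos Real.two_pi_pos] at h
    change ‖(2 * Real.pi : ℂ)⁻¹ * _‖ ≤ _
    rw [norm_mul, norm_inv, norm_mul, Complex.norm_ofNat, Complex.norm_real,
      Real.norm_of_nonneg Real.pi_pos.le, one_mul, inv_mul_le_iff₀ Real.two_pi_pos, mul_comm _ ‖f‖]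
    exact h

theorem circMean_eq {R : ℝ} (hR : 0 < R) {f : C(Metric.sphere (0 : ℂ) |R|, ℂ)} {g : ℂ → ℂ}
    (h : ∀ ζ, f ζ = g ζ) :
    circMean R f = (2 * Real.pi * I)⁻¹ * ∮ ζ in C(0, R), ζ⁻¹ * g ζ := by
  have h1 : circMean R f = (2 * Real.pi : ℂ)⁻¹ *
    ∫ θ in (0 : ℝ)..2 * Real.pi, f ⟨circleMap 0 R θ, circleMap_mem_sphere' 0 R θ⟩ := rfl
  have h2 : ∀ θ : ℝ, circleMap 0 R θ ≠ 0 := fun θ => circleMap_ne_center hR.ne'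
  simp only [h1, h, circleIntegral, deriv_circleMap, smul_eq_mul]
  have h3 : ∀ θ : ℝ, circleMap 0 R θ * I * ((circleMap 0 R θ)⁻¹ * g (circleMap 0 R θ)) =
      I * g (circleMap 0 R θ) := fun θ => by field_simp [h2 θ]
  simp only [h3, intervalIntegral.integral_const_mul]
  field_simp

/-- Lebesgue measure on the interval `[log (R/2), 0]`. -/
def segMeasure (R : ℝ) : Measure (Icc (Real.log (R / 2)) 0) :=
  volume.comap Subtype.val

instance (R : ℝ) : IsFiniteMeasure (segMeasure R) :=
  ⟨by
    rw [segMeasure, comap_subtype_coe_apply measurableSet_Icc]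
    exact (measure_mono (Subtype.coe_image_subset _ _)).trans_lt isCompact_Icc.measure_lt_top⟩

theorem integrable_segMeasure {R : ℝ} (f : C(Icc (Real.log (R / 2)) 0, ℂ)) :
    Integrable f (segMeasure R) :=
  f.continuous.integrable_of_hasCompactSupport (HasCompactSupport.of_compactSpace _)

/-- The integral over the interval `[log (R/2), 0]`. -/
def segIntegral (R : ℝ) : C(Icc (Real.log (R / 2)) 0, ℂ) →L[ℂ] ℂ :=
  LinearMap.mkContinuous
    { toFun := fun f => ∫ t, f t ∂segMeasure R
      map_add' := fun f g => integral_add (integrable_segMeasure f) (integrable_segMeasure g)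
      map_smul' := fun c f => integral_const_mul c _ }
    ((segMeasure R).real univ) fun f => by
    have h := norm_integral_le_of_norm_le_const (μ := segMeasure R) (C := ‖f‖) (f := f)
      (.of_forall f.norm_coe_le_norm)
    rw [mul_comm]
    exact h

theorem segIntegral_eq {R : ℝ} (hR : R ≤ 2) (hR0 : 0 < R) {f : C(Icc (Real.log (R / 2)) 0, ℂ)}
    {g : ℝ → ℂ} (h : ∀ t, f t = g t) :
    segIntegral R f = ∫ t in Real.log (R / 2)..0, g t := by
  have hl : Real.log (R / 2) ≤ 0 := Real.log_nonpos (by linarith) (by linarith)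
  rw [intervalIntegral.integral_of_le hl, ← integral_Icc_eq_integral_Ioc,
    ← integral_subtype_comap measurableSet_Icc]
  exact integral_congr_ae (.of_forall h)

/-- The sum of the mean value over the circle and the integral over the interval. -/
def mellinFunctional (R : ℝ) : MellinAlg R →L[ℂ] ℂ :=
  (circMean R).comp (ContinuousLinearMap.fst ℂ _ _) +
    (segIntegral R).comp (ContinuousLinearMap.snd ℂ _ _)

theorem mellinFunctional_apply {R : ℝ} (m : MellinAlg R) :
    mellinFunctional R m = circMean R m.1 + segIntegral R m.2 := rfl

/-- The function `ζ ↦ (R/2)/ζ` on the circle of radius `R`, written without division by `ζ`. -/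
def circRatio (R : ℝ) : C(Metric.sphere (0 : ℂ) |R|, ℂ) where
  toFun ζ := (R / 2 : ℂ) * (starRingEnd ℂ ζ / (R : ℂ) ^ 2)
  continuous_toFun := by fun_prop

variable {R : ℝ}

theorem circRatio_apply (hR : 0 < R) (ζ : Metric.sphere (0 : ℂ) |R|) :
    circRatio R ζ = (R / 2 : ℂ) * (ζ : ℂ)⁻¹ := by
  have h : ‖(ζ : ℂ)‖ = R := (mem_sphere_zero_iff_norm.1 ζ.2).trans (abs_of_pos hR)
  have h0 : (R : ℂ) ≠ 0 := by exact_mod_cast hR.ne'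
  change (R / 2 : ℂ) * (starRingEnd ℂ ζ / (R : ℂ) ^ 2) = _
  rw [Complex.inv_def, Complex.normSq_eq_norm_sq, h]
  push_cast
  field_simp

theorem norm_circRatio_pow_le (hR : 0 < R) (n : ℕ) : ‖circRatio R ^ n‖ ≤ (1 / 2) ^ n := by
  refine (ContinuousMap.norm_le _ (by positivity)).2 fun ζ => ?_
  have h : ‖(ζ : ℂ)‖ = R := (mem_sphere_zero_iff_norm.1 ζ.2).trans (abs_of_pos hR)
  rw [ContinuousMap.pow_apply, circRatio_apply hR, norm_pow]
  refine pow_le_pow_left₀ (norm_nonneg _) (le_of_eq ?_) n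
  rw [norm_mul, norm_inv, h, norm_div, Complex.norm_real, Real.norm_of_nonneg hR.le]
  simp
  field_simp

theorem exists_norm_inv_add_natCast_le (w : ℂ) : ∃ M : ℝ, 0 < M ∧ ∀ n : ℕ, ‖(w + n)⁻¹‖ ≤ M := by
  have h1 : Tendsto (fun n : ℕ => ‖w + n‖) atTop atTop := by
    refine tendsto_atTop_mono (fun n => ?_)
      (tendsto_atTop_add_const_right _ (-‖w‖) tendsto_natCast_atTop_atTop)
    have := norm_sub_norm_le (n : ℂ) (-w)
    rw [Complex.norm_natCast, norm_neg, sub_neg_eq_add, add_comm (n : ℂ)] at this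
    linarith
  have h2 : Tendsto (fun n : ℕ => ‖(w + n)⁻¹‖) atTop (𝓝 0) := by
    simp only [norm_inv]
    exact tendsto_inv_atTop_zero.comp h1
  obtain ⟨M, hM⟩ := h2.bddAbove_range
  exact ⟨max M 1, by positivity, fun n => (hM (mem_range_self n)).trans (le_max_left _ _)⟩

/-- The function `∑ₙ xⁿ / (w + n)` of `x = (R/2)/ζ` on the circle of radius `R`. If `w = -n`, the
term with index `n` is absent, as `0⁻¹ = 0`. -/
def circKernel (R : ℝ) (w : ℂ) : C(Metric.sphere (0 : ℂ) |R|, ℂ) :=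
  ∑' n : ℕ, (w + n)⁻¹ • circRatio R ^ n

theorem hasSum_circKernel (hR : 0 < R) (w : ℂ) :
    HasSum (fun n : ℕ => (w + n)⁻¹ • circRatio R ^ n) (circKernel R w) := by
  obtain ⟨M, hM, hw⟩ := exists_norm_inv_add_natCast_le w
  refine (Summable.of_norm_bounded (g := fun n => M * (1 / 2) ^ n)
    ((summable_geometric_of_lt_one (by norm_num) (by norm_num)).mul_left M) fun n => ?_).hasSum
  rw [norm_smul]
  exact mul_le_mul (hw n) (norm_circRatio_pow_le hR n) (norm_nonneg _) hM.le

theorem exists_ball_le_norm_add_natCast {w : ℂ} (hw : ∀ n : ℕ, w + n ≠ 0) :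
    ∃ δ : ℝ, 0 < δ ∧ ∀ y ∈ Metric.ball w δ, ∀ n : ℕ, δ ≤ ‖y + n‖ := by
  obtain ⟨M, hM, hM'⟩ := exists_norm_inv_add_natCast_le w
  refine ⟨1 / (2 * M), by positivity, fun y hy n => ?_⟩
  rw [mem_ball_iff_norm] at hy
  have h1 : 1 / M ≤ ‖w + n‖ := by
    have := hM' n
    rw [norm_inv] at this
    rw [one_div]
    exact inv_le_of_inv_le₀ (norm_pos_iff.2 (hw n)) this
  have h2 : ‖w + n‖ ≤ ‖y + n‖ + ‖y - w‖ := by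
    have := norm_sub_le (y + n) (y - w)
    rwa [show y + n - (y - w) = w + n by ring] at this
  have h3 : 1 / M = 1 / (2 * M) + 1 / (2 * M) := by field_simp; norm_num
  linarith

theorem differentiableAt_circKernel (hR : 0 < R) {w : ℂ} (hw : ∀ n : ℕ, w + n ≠ 0) :
    DifferentiableAt ℂ (circKernel R) w := by
  obtain ⟨δ, hδ, key⟩ := exists_ball_le_norm_add_natCast hw
  have h := differentiableOn_tsum_of_summable_norm (U := Metric.ball w δ)
    (F := fun (n : ℕ) (y : ℂ) => (y + n)⁻¹ • circRatio R ^ n)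
    (u := fun n => δ⁻¹ * (1 / 2) ^ n)
    ((summable_geometric_of_lt_one (by norm_num) (by norm_num)).mul_left δ⁻¹)
    (fun n y hy => by
      have h0 : y + n ≠ 0 := norm_pos_iff.1 (hδ.trans_le (key y hy n))
      exact (((differentiableAt_id.add_const (n : ℂ)).inv h0).smul_const
        (circRatio R ^ n)).differentiableWithinAt)
    Metric.isOpen_ball
    (fun n y hy => by
      rw [norm_smul]
      refine mul_le_mul ?_ (norm_circRatio_pow_le hR n) (norm_nonneg _) (by positivity)
      rw [norm_inv]
      exact inv_anti₀ hδ (key y hy n))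
  exact h.differentiableAt (Metric.ball_mem_nhds w hδ)

/-- The coordinate `t` on the interval `[log (R/2), 0]`. -/
def segCoord (R : ℝ) : C(Icc (Real.log (R / 2)) 0, ℂ) where
  toFun t := ((t : ℝ) : ℂ)
  continuous_toFun := by fun_prop

/-- The density by which `mellinFunctional` represents the continuation in `w` of
`g ↦ ∫_{-∞}^0 e^{wt} g(e^t) dt`: on the circle it is `∑ₙ r^w xⁿ / (w + n)` with `r = R/2` and
`x = r/ζ`, which accounts for `t < log r` by means of the Taylor coefficients of `g`, and on the
interval `[log r, 0]` it is `e^{wt}`. -/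
def mellinKernel (R : ℝ) (w : ℂ) : MellinAlg R :=
  (exp (w * Real.log (R / 2)) • circKernel R w, NormedSpace.exp (w • segCoord R))

theorem differentiableAt_mellinKernel (hR : 0 < R) {w : ℂ} (hw : ∀ n : ℕ, w + n ≠ 0) :
    DifferentiableAt ℂ (mellinKernel R) w := by
  have h1 : DifferentiableAt ℂ (fun w : ℂ => exp (w * Real.log (R / 2))) w := by fun_prop
  exact (h1.smul (differentiableAt_circKernel hR hw)).prodMk
    (hasDerivAt_exp_smul_const (segCoord R) w).differentiableAt

/-- `m` is the restriction of `g`, a function of `q`, to the circle and the interval. -/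
structure Represents (m : MellinAlg R) (g : ℂ → ℂ) : Prop where
  circ : ∀ ζ, m.1 ζ = g ζ
  seg : ∀ t, m.2 t = g (exp (t : ℝ))

/-- The Taylor coefficient of `g` at `0`, by Cauchy's formula. -/
def taylorCoeff (R : ℝ) (g : ℂ → ℂ) (n : ℕ) : ℂ :=
  (2 * Real.pi * I)⁻¹ * ∮ ζ in C(0, R), ζ⁻¹ ^ (n + 1) * g ζ

theorem circMean_pow_mul (hR : 0 < R) {m : MellinAlg R} {g : ℂ → ℂ} (hm : Represents m g)
    (n : ℕ) : circMean R (circRatio R ^ n * m.1) = (R / 2 : ℂ) ^ n * taylorCoeff R g n := by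
  rw [circMean_eq hR (g := fun ζ => (R / 2 : ℂ) ^ n * (ζ⁻¹ ^ n * g ζ)), taylorCoeff]
  · have : ∀ ζ : ℂ, ζ⁻¹ * ((R / 2 : ℂ) ^ n * (ζ⁻¹ ^ n * g ζ)) =
        (R / 2 : ℂ) ^ n * (ζ⁻¹ ^ (n + 1) * g ζ) := fun ζ => by ring
    simp only [this, circleIntegral.integral_const_mul]
    ring
  · intro ζ
    rw [ContinuousMap.mul_apply, ContinuousMap.pow_apply, circRatio_apply hR, hm.circ, mul_pow,
      mul_assoc]

theorem hasSum_circ (hR : 0 < R) {m : MellinAlg R} {g : ℂ → ℂ} (hm : Represents m g) (w : ℂ) :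
    HasSum (fun n : ℕ => (w + n)⁻¹ * ((R / 2 : ℂ) ^ n * taylorCoeff R g n))
      (circMean R (circKernel R w * m.1)) := by
  have h := ((hasSum_circKernel hR w).mul_right m.1).mapL (circMean R)
  refine h.congr_fun fun n => ?_
  rw [smul_mul_assoc, map_smul, circMean_pow_mul hR hm, smul_eq_mul]

theorem mellin_eq (hR : 0 < R) (hR2 : R ≤ 2) {m : MellinAlg R} {g : ℂ → ℂ}
    (hm : Represents m g) (w : ℂ) :
    mellinFunctional R (mellinKernel R w * m) =
      exp (w * Real.log (R / 2)) * circMean R (circKernel R w * m.1) +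
        ∫ t in Real.log (R / 2)..0, exp (w * t) * g (exp (t : ℝ)) := by
  rw [mellinFunctional_apply, Prod.fst_mul, Prod.snd_mul, mellinKernel, smul_mul_assoc, map_smul,
    smul_eq_mul]
  congr 1
  refine segIntegral_eq hR2 hR (g := fun t => exp (w * t) * g (exp (t : ℝ))) fun t => ?_
  rw [ContinuousMap.mul_apply, continuousMap_exp_apply, hm.seg]
  rfl

theorem taylorCoeff_zero {g : ℂ → ℂ} (hR : 0 < R)
    (hg : DifferentiableOn ℂ g (Metric.closedBall 0 R)) : taylorCoeff R g 0 = g 0 := by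
  have h := two_pi_I_inv_smul_circleIntegral_sub_inv_smul_of_differentiable_on_off_countable
    (s := ∅) (f := g) (c := 0) (w := 0) (R := R) countable_empty (Metric.mem_ball_self hR)
    hg.continuousOn fun x hx => (hg.mono Metric.ball_subset_closedBall).differentiableAt
      (Metric.isOpen_ball.mem_nhds hx.1)
  simpa [taylorCoeff] using h

theorem hasSum_taylorCoeff {g : ℂ → ℂ} (hR : 0 < R)
    (hg : DifferentiableOn ℂ g (Metric.closedBall 0 R)) {q : ℂ} (hq : ‖q‖ < R) :
    HasSum (fun n : ℕ => q ^ n * taylorCoeff R g n) (g q) := by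
  have h := two_pi_I_inv_smul_circleIntegral_sub_inv_smul_of_differentiable_on_off_countable
    (s := ∅) (f := g) (c := 0) (w := q) (R := R) countable_empty (by simpa using hq)
    hg.continuousOn fun x hx => (hg.mono Metric.ball_subset_closedBall).differentiableAt
      (Metric.isOpen_ball.mem_nhds hx.1)
  have hi : CircleIntegrable g 0 R :=
    (hg.continuousOn.mono Metric.sphere_subset_closedBall).circleIntegrable hR.le
  have h2 := (hasSum_two_pi_I_cauchyPowerSeries_integral hi hq).mul_left (2 * Real.pi * I : ℂ)⁻¹
  rw [smul_eq_mul] at h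
  rw [zero_add, h] at h2
  refine h2.congr_fun fun n => ?_
  have : ∀ ζ : ℂ, (q / (ζ - 0)) ^ n • (ζ - 0)⁻¹ • g ζ = q ^ n * (ζ⁻¹ ^ (n + 1) * g ζ) := by
    intro ζ
    simp only [sub_zero, smul_eq_mul, div_eq_mul_inv]
    ring
  simp only [this, circleIntegral.integral_const_mul, taylorCoeff]
  ring

/-- Integration by parts on the circle. -/
theorem circleIntegral_deriv {g g' : ℂ → ℂ} (hR : 0 < R)
    (hg : ∀ ζ ∈ Metric.sphere (0 : ℂ) R, HasDerivAt g (g' ζ) ζ)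
    (hg' : ContinuousOn g' (Metric.sphere 0 R)) (n : ℕ) :
    ∮ ζ in C(0, R), ζ⁻¹ ^ n * g' ζ = n * ∮ ζ in C(0, R), ζ⁻¹ ^ (n + 1) * g ζ := by
  have h0 : ∀ ζ ∈ Metric.sphere (0 : ℂ) R, ζ ≠ 0 := fun ζ hζ => ne_zero_of_mem_sphere hR.ne' ⟨ζ, hζ⟩
  have hi : ContinuousOn (fun ζ : ℂ => ζ⁻¹) (Metric.sphere 0 R) := continuousOn_id.inv₀ h0
  have hgc : ContinuousOn g (Metric.sphere 0 R) :=
    fun ζ hζ => (hg ζ hζ).continuousAt.continuousWithinAt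
  have h := circleIntegral.integral_eq_zero_of_hasDerivWithinAt (c := 0) (R := R)
    (f := fun ζ => ζ⁻¹ ^ n * g ζ)
    (f' := fun ζ => ζ⁻¹ ^ n * g' ζ - (n : ℂ) • (ζ⁻¹ ^ (n + 1) * g ζ)) hR.le fun ζ hζ => by
      have := (((hasDerivAt_inv (h0 ζ hζ)).pow n).mul (hg ζ hζ)).hasDerivWithinAt
        (s := Metric.sphere 0 R)
      refine this.congr_deriv ?_
      rcases n with _ | n
      · simp
      · simp only [Nat.add_sub_cancel, smul_eq_mul, Pi.pow_apply, ← inv_pow]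
        ring
  have h1 : CircleIntegrable (fun ζ => ζ⁻¹ ^ n * g' ζ) 0 R :=
    ((hi.pow n).mul hg').circleIntegrable hR.le
  have h2 : CircleIntegrable (fun ζ => (n : ℂ) • (ζ⁻¹ ^ (n + 1) * g ζ)) 0 R :=
    (((hi.pow (n + 1)).mul hgc).const_smul (n : ℂ)).circleIntegrable hR.le
  rw [circleIntegral.integral_sub h1 h2, circleIntegral.integral_smul, sub_eq_zero] at h
  exact h

/-- An open set on which `q`-functions have to be holomorphic for the continued Mellin functional
to make sense: it contains the closed disc of radius `R` and the interval `(0, 1]`. -/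
structure MellinDomain (R : ℝ) (U : Set ℂ) : Prop where
  pos : 0 < R
  le_one : R ≤ 1
  isOpen : IsOpen U
  closedBall_subset : Metric.closedBall 0 R ⊆ U
  exp_mem : ∀ t : ℝ, t ≤ 0 → exp t ∈ U

variable {U : Set ℂ} {g : ℂ → ℂ}

theorem taylorCoeff_id_mul_deriv (hU : MellinDomain R U) (hg : DifferentiableOn ℂ g U) (n : ℕ) :
    taylorCoeff R (fun q => q * deriv g q) n = n * taylorCoeff R g n := by
  have hs : Metric.sphere (0 : ℂ) R ⊆ U :=
    Metric.sphere_subset_closedBall.trans hU.closedBall_subset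
  have h := circleIntegral_deriv hU.pos
    (fun ζ hζ => (hg.differentiableAt (hU.isOpen.mem_nhds (hs hζ))).hasDerivAt)
    ((hg.deriv hU.isOpen).continuousOn.mono hs) n
  rw [taylorCoeff, taylorCoeff, mul_left_comm, ← h]
  congr 1
  refine circleIntegral.integral_congr hU.pos.le fun ζ hζ => ?_
  have : ζ ≠ 0 := ne_zero_of_mem_sphere hU.pos.ne' ⟨ζ, hζ⟩
  simp only [pow_succ]
  field_simp

theorem taylorCoeff_add {f : ℂ → ℂ} (hU : MellinDomain R U) (hf : DifferentiableOn ℂ f U)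
    (hg : DifferentiableOn ℂ g U) (n : ℕ) :
    taylorCoeff R (fun q => f q + g q) n = taylorCoeff R f n + taylorCoeff R g n := by
  have hs : Metric.sphere (0 : ℂ) R ⊆ U :=
    Metric.sphere_subset_closedBall.trans hU.closedBall_subset
  have hi : ContinuousOn (fun ζ : ℂ => ζ⁻¹ ^ (n + 1)) (Metric.sphere 0 R) :=
    (continuousOn_id.inv₀ fun ζ hζ => ne_zero_of_mem_sphere hU.pos.ne' ⟨ζ, hζ⟩).pow _
  have h1 : CircleIntegrable (fun ζ => ζ⁻¹ ^ (n + 1) * f ζ) 0 R :=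
    (hi.mul (hf.continuousOn.mono hs)).circleIntegrable hU.pos.le
  have h2 : CircleIntegrable (fun ζ => ζ⁻¹ ^ (n + 1) * g ζ) 0 R :=
    (hi.mul (hg.continuousOn.mono hs)).circleIntegrable hU.pos.le
  simp only [taylorCoeff, mul_add]
  rw [circleIntegral.integral_add h1 h2, mul_add]

theorem taylorCoeff_const_mul (c : ℂ) (n : ℕ) :
    taylorCoeff R (fun q => c * g q) n = c * taylorCoeff R g n := by
  simp only [taylorCoeff, mul_left_comm _ c, circleIntegral.integral_const_mul]

theorem taylorCoeff_id_mul_succ (hR : 0 < R) (n : ℕ) :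
    taylorCoeff R (fun q => q * g q) (n + 1) = taylorCoeff R g n := by
  rw [taylorCoeff, taylorCoeff]
  congr 1
  refine circleIntegral.integral_congr hR.le fun ζ hζ => ?_
  have : ζ ≠ 0 := ne_zero_of_mem_sphere hR.ne' ⟨ζ, hζ⟩
  simp only [pow_succ]
  field_simp

theorem exp_log_half (hR : 0 < R) : exp (Real.log (R / 2) : ℝ) = (R / 2 : ℂ) := by
  rw [← Complex.ofReal_exp, Real.exp_log (by positivity)]
  push_cast
  rfl

theorem norm_half_lt (hR : 0 < R) : ‖(R / 2 : ℂ)‖ < R := by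
  rw [norm_div, Complex.norm_real, Real.norm_of_nonneg hR.le, Complex.norm_ofNat]
  linarith

theorem log_half_nonpos (hR : 0 < R) (hR1 : R ≤ 1) : Real.log (R / 2) ≤ 0 :=
  Real.log_nonpos (by linarith) (by linarith)

/-- Multiplication of `g` by `q` shifts the parameter of the continued Mellin functional. -/
theorem mellin_id_mul (hU : MellinDomain R U) (hg : DifferentiableOn ℂ g U) {m n : MellinAlg R}
    (hm : Represents m g) (hn : Represents n fun q => q * g q) (w : ℂ) :
    mellinFunctional R (mellinKernel R w * n) =
      mellinFunctional R (mellinKernel R (w + 1) * m) := by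
  have hR2 : R ≤ 2 := hU.le_one.trans one_le_two
  rw [mellin_eq hU.pos hR2 hn, mellin_eq hU.pos hR2 hm]
  congr 1
  · have h1 := hasSum_circ hU.pos hn w
    have h2 := (hasSum_circ hU.pos hm (w + 1)).mul_left (R / 2 : ℂ)
    -- the constant coefficient of `q * g` vanishes, so a pole of the kernel at `n = 0` is harmless
    have h0 : taylorCoeff R (fun q => q * g q) 0 = 0 := by
      rw [taylorCoeff_zero hU.pos, zero_mul]
      exact differentiableOn_id.mul (hg.mono hU.closedBall_subset)
    rw [← hasSum_nat_add_iff' 1] at h1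
    simp only [Finset.range_one, Finset.sum_singleton, h0, mul_zero, sub_zero] at h1
    have h3 := h1.unique (h2.congr_fun ?_)
    · rw [h3, add_mul, Complex.exp_add, one_mul, exp_log_half hU.pos]
      ring
    · intro k
      rw [taylorCoeff_id_mul_succ hU.pos]
      push_cast
      ring
  · refine intervalIntegral.integral_congr fun t _ => ?_
    simp only [add_mul, Complex.exp_add, one_mul]
    ring

/-- The fundamental theorem of calculus on the interval `[log (R/2), 0]`. -/
theorem seg_integral_deriv (hU : MellinDomain R U) (hg : DifferentiableOn ℂ g U) (w : ℂ) :
    ∫ t in Real.log (R / 2)..0,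
      exp (w * t) * (exp (t : ℝ) * deriv g (exp (t : ℝ)) + w * g (exp (t : ℝ))) =
      g 1 - exp (w * Real.log (R / 2)) * g (R / 2) := by
  have hl := log_half_nonpos hU.pos hU.le_one
  have hmem : ∀ t ∈ uIcc (Real.log (R / 2)) 0, exp (t : ℝ) ∈ U := fun t ht =>
    hU.exp_mem t (by rw [uIcc_of_le hl] at ht; exact ht.2)
  have he : ∀ t : ℝ, HasDerivAt (fun t : ℝ => exp (t : ℂ)) (exp t) t := fun t => by
    simpa using (hasDerivAt_id t).ofReal_comp.cexp
  have hw : ∀ t : ℝ, HasDerivAt (fun t : ℝ => exp (w * t)) (exp (w * t) * w) t := fun t => by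
    simpa using ((hasDerivAt_id t).ofReal_comp.const_mul w).cexp
  have h := intervalIntegral.integral_eq_sub_of_hasDerivAt
    (f := fun t : ℝ => exp (w * t) * g (exp (t : ℝ)))
    (f' := fun t : ℝ =>
      exp (w * t) * (exp (t : ℝ) * deriv g (exp (t : ℝ)) + w * g (exp (t : ℝ))))
    (a := Real.log (R / 2)) (b := 0) (fun t ht => by
      have hgt := (hg.differentiableAt (hU.isOpen.mem_nhds (hmem t ht))).hasDerivAt
      refine ((hw t).mul (hgt.comp t (he t))).congr_deriv ?_
      simp only [Function.comp]
      ring)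
    (ContinuousOn.intervalIntegrable (by
      have h1 : ContinuousOn (fun t : ℝ => g (exp (t : ℝ))) (uIcc (Real.log (R / 2)) 0) :=
        hg.continuousOn.comp (by fun_prop) hmem
      have h2 : ContinuousOn (fun t : ℝ => deriv g (exp (t : ℝ))) (uIcc (Real.log (R / 2)) 0) :=
        (hg.deriv hU.isOpen).continuousOn.comp (by fun_prop) hmem
      have h3 : Continuous fun t : ℝ => exp (w * t) := by fun_prop
      have h4 : Continuous fun t : ℝ => exp (t : ℂ) := by fun_prop
      exact h3.continuousOn.mul ((h4.continuousOn.mul h2).add (h1.const_mul w))))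
  rw [h, exp_log_half hU.pos]
  simp

theorem differentiableOn_euler (hU : MellinDomain R U) (hg : DifferentiableOn ℂ g U) :
    DifferentiableOn ℂ (fun q => q * deriv g q) U :=
  differentiableOn_id.mul (hg.deriv hU.isOpen)

theorem taylorCoeff_euler (hU : MellinDomain R U) (hg : DifferentiableOn ℂ g U) (w : ℂ) (n : ℕ) :
    taylorCoeff R (fun q => q * deriv g q + w * g q) n = (w + n) * taylorCoeff R g n := by
  rw [taylorCoeff_add hU (differentiableOn_euler hU hg) (hg.const_mul w),
    taylorCoeff_id_mul_deriv hU hg, taylorCoeff_const_mul]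
  ring

/-- The continued Mellin functional integrates the Euler operator `q ∂_q + w`. -/
theorem mellin_euler (hU : MellinDomain R U) (hg : DifferentiableOn ℂ g U) {w : ℂ}
    (hw : ∀ n : ℕ, w + n ≠ 0) {m : MellinAlg R}
    (hm : Represents m fun q => q * deriv g q + w * g q) :
    mellinFunctional R (mellinKernel R w * m) = g 1 := by
  have h1 := hasSum_circ hU.pos hm w
  have h2 := hasSum_taylorCoeff hU.pos (hg.mono hU.closedBall_subset) (norm_half_lt hU.pos)
  have h3 := h1.unique (h2.congr_fun fun n => by
    rw [taylorCoeff_euler hU hg]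
    field_simp [hw n])
  rw [mellin_eq hU.pos (hU.le_one.trans one_le_two) hm, h3, seg_integral_deriv hU hg]
  ring

/-- The boundary term at `q = 0` which appears at the pole `w = 0`. -/
theorem mellin_euler_zero (hU : MellinDomain R U) (hg : DifferentiableOn ℂ g U)
    {m : MellinAlg R} (hm : Represents m fun q => q * deriv g q) :
    mellinFunctional R (mellinKernel R 0 * m) = g 1 - g 0 := by
  have hg' := hg.mono hU.closedBall_subset
  have h1 := hasSum_circ hU.pos hm 0
  have h2 := hasSum_taylorCoeff hU.pos hg' (norm_half_lt hU.pos)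
  -- the kernel has no term with index `0` at `w = 0`, and hence misses the Taylor coefficient `g 0`
  rw [← hasSum_nat_add_iff' 1] at h1 h2
  have h3 := h1.unique (h2.congr_fun fun n => by
    rw [taylorCoeff_id_mul_deriv hU hg]
    have : ((n + 1 : ℕ) : ℂ) ≠ 0 := by exact_mod_cast n.succ_ne_zero
    field_simp
    ring)
  simp only [Finset.range_one, Finset.sum_singleton, Nat.cast_zero, add_zero, inv_zero, zero_mul,
    sub_zero, pow_zero, one_mul, taylorCoeff_zero hU.pos hg'] at h3
  have h4 := seg_integral_deriv hU hg 0
  simp only [zero_mul, add_zero] at h4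
  rw [mellin_eq hU.pos (hU.le_one.trans one_le_two) hm, h3]
  simp only [zero_mul]
  rw [h4, Complex.exp_zero]
  ring

/-- For `Re w > 0` the continued Mellin functional is the integral which it continues. -/
theorem mellin_eq_integral (hU : MellinDomain R U) (hg : DifferentiableOn ℂ g U) {w : ℂ}
    (hw : 0 < w.re) {m : MellinAlg R} (hm : Represents m g)
    (hi : IntegrableOn (fun t : ℝ => exp (w * t) * g (exp (t : ℝ))) (Iic 0)) :
    mellinFunctional R (mellinKernel R w * m) =
      ∫ t in Iic (0 : ℝ), exp (w * t) * g (exp (t : ℝ)) := by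
  have hl := log_half_nonpos hU.pos hU.le_one
  have hg' := hg.mono hU.closedBall_subset
  have hr0 : (0 : ℝ) < R / 2 := by have := hU.pos; positivity
  have hsplit := intervalIntegral.integral_Iic_sub_Iic (hi.mono_set (Iic_subset_Iic.2 hl)) hi
  have hwn : ∀ n : ℕ, 0 < (w + n).re := fun n => by
    simp only [add_re, natCast_re]; positivity
  rw [mellin_eq hU.pos (hU.le_one.trans one_le_two) hm, ← hsplit]
  suffices h : exp (w * Real.log (R / 2)) * circMean R (circKernel R w * m.1) =
      ∫ t in Iic (Real.log (R / 2)), exp (w * t) * g (exp (t : ℝ)) by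
    rw [h]; ring
  -- integrate the Taylor series of `g` at `0` term by term
  have hnorm : ∀ n : ℕ, ∫ t in Iic (Real.log (R / 2)), ‖exp ((w + n) * t) * taylorCoeff R g n‖ =
      (R / 2) ^ w.re / (w + n).re * ((R / 2) ^ n * ‖taylorCoeff R g n‖) := fun n => by
    have h1 : ∀ t : ℝ, ‖exp ((w + n) * t) * taylorCoeff R g n‖ =
        Real.exp ((w + n).re * t) * ‖taylorCoeff R g n‖ := fun t => by
      rw [norm_mul, Complex.norm_exp, re_mul_ofReal]
    simp only [h1]
    rw [integral_mul_const, integral_exp_mul_Iic (hwn n), add_re, natCast_re, add_mul, Real.exp_add,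
      mul_comm w.re, mul_comm (n : ℝ), ← Real.rpow_def_of_pos hr0, ← Real.rpow_def_of_pos hr0,
      Real.rpow_natCast]
    ring
  have htaylor := hasSum_taylorCoeff hU.pos hg' (norm_half_lt hU.pos)
  have hsum := hasSum_integral_of_summable_integral_norm
    (μ := volume.restrict (Iic (Real.log (R / 2))))
    (F := fun (n : ℕ) (t : ℝ) => exp ((w + n) * t) * taylorCoeff R g n)
    (fun n => (integrableOn_exp_mul_complex_Iic (hwn n) _).mul_const _) (by
      simp only [hnorm]
      refine Summable.of_nonneg_of_le (fun n => ?_) (fun n => ?_)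
        (htaylor.summable.norm.mul_left ((R / 2) ^ w.re / w.re))
      · have := hwn n
        positivity
      · rw [norm_mul, norm_pow, norm_div, Complex.norm_real, Real.norm_of_nonneg hU.pos.le,
          Complex.norm_ofNat]
        refine mul_le_mul_of_nonneg_right ?_ (by positivity)
        refine div_le_div_of_nonneg_left (by positivity) hw ?_
        simp)
  have hval : ∫ t in Iic (Real.log (R / 2)), ∑' n : ℕ, exp ((w + n) * t) * taylorCoeff R g n =
      ∫ t in Iic (Real.log (R / 2)), exp (w * t) * g (exp (t : ℝ)) := by
    refine setIntegral_congr_fun measurableSet_Iic fun t ht => ?_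
    have hq : ‖exp (t : ℂ)‖ < R := by
      rw [Complex.norm_exp, ofReal_re]
      have := Real.exp_le_exp.2 (mem_Iic.1 ht)
      rw [Real.exp_log hr0] at this
      linarith
    refine (((hasSum_taylorCoeff hU.pos hg' hq).mul_left (exp (w * t))).congr_fun
      fun n => ?_).tsum_eq
    rw [add_mul, Complex.exp_add, Complex.exp_nat_mul]
    ring
  rw [hval] at hsum
  refine ((hasSum_circ hU.pos hm w).mul_left (exp (w * Real.log (R / 2)))).unique
    (hsum.congr_fun fun n => ?_)
  rw [integral_mul_const, integral_exp_mul_complex_Iic (hwn n), add_mul, Complex.exp_add,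
    Complex.exp_nat_mul, exp_log_half hU.pos]
  ring

end MellinFunctional

/-! ### Laplace integrals over the negative half-line -/

section StarExponential

section Laplace

variable {f : ℝ → ℂ} {C : ℝ} {w : ℂ}

theorem norm_exp_mul_le (hC : ∀ t ≤ 0, ‖f t‖ ≤ C) (w : ℂ) {t : ℝ} (ht : t ≤ 0) :
    ‖exp (w * t) * f t‖ ≤ Real.exp (w.re * t) * C := by
  rw [norm_mul, Complex.norm_exp, re_mul_ofReal]
  exact mul_le_mul_of_nonneg_left (hC t ht) (Real.exp_pos _).le

theorem integrableOn_exp_mul (hf : Continuous f) (hC : ∀ t ≤ 0, ‖f t‖ ≤ C) (hw : 0 < w.re)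
    {a : ℝ} (ha : a ≤ 0) : IntegrableOn (fun t : ℝ => exp (w * t) * f t) (Iic a) := by
  refine Integrable.mono' ((integrableOn_exp_mul_Iic hw a).mul_const C) ?_
    (ae_restrict_of_forall_mem measurableSet_Iic fun t ht =>
      norm_exp_mul_le hC w ((mem_Iic.1 ht).trans ha))
  exact Continuous.aestronglyMeasurable (by fun_prop)

theorem norm_integral_exp_mul_le (hC : ∀ t ≤ 0, ‖f t‖ ≤ C) (hw : 0 < w.re)
    {a : ℝ} (ha : a ≤ 0) :
    ‖∫ t in Iic a, exp (w * t) * f t‖ ≤ Real.exp (w.re * a) / w.re * C := by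
  rw [← integral_exp_mul_Iic hw, ← integral_mul_const]
  exact norm_integral_le_of_norm_le ((integrableOn_exp_mul_Iic hw a).mul_const C)
    (ae_restrict_of_forall_mem measurableSet_Iic fun t ht =>
      norm_exp_mul_le hC w ((mem_Iic.1 ht).trans ha))

theorem hasDerivAt_laplace_tail (hf : Continuous f) (w : ℂ) (t : ℝ) :
    HasDerivAt (fun t : ℝ => (∫ x in Iic (0 : ℝ), exp (w * x) * f x) +
      ∫ x in (0 : ℝ)..t, exp (w * x) * f x) (exp (w * t) * f t) t := by
  have hc : Continuous fun x : ℝ => exp (w * x) * f x := by fun_prop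
  exact (intervalIntegral.integral_hasDerivAt_right (hc.intervalIntegrable _ _)
    (hc.stronglyMeasurableAtFilter _ _) hc.continuousAt).const_add _

theorem laplace_tail_eq (hf : Continuous f) (hC : ∀ t ≤ 0, ‖f t‖ ≤ C) (hw : 0 < w.re)
    {t : ℝ} (ht : t ≤ 0) :
    (∫ x in Iic (0 : ℝ), exp (w * x) * f x) + ∫ x in (0 : ℝ)..t, exp (w * x) * f x =
      ∫ x in Iic t, exp (w * x) * f x := by
  rw [← intervalIntegral.integral_Iic_sub_Iic (integrableOn_exp_mul hf hC hw le_rfl)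
    (integrableOn_exp_mul hf hC hw ht)]
  ring

theorem setIntegral_Iic_zero_comp_add (g : ℝ → ℂ) (t : ℝ) :
    ∫ s in Iic (0 : ℝ), g (t + s) = ∫ x in Iic t, g x := by
  have h := (measurePreserving_add_left volume t).setIntegral_preimage_emb
    (measurableEmbedding_addLeft t) g (Iic t)
  rw [← h]
  congr 2
  ext s
  simp

theorem integrableOn_exp_mul_exp_mul (hf : Continuous f) (hC : ∀ t ≤ 0, ‖f t‖ ≤ C)
    (hw : 0 < w.re) :
    IntegrableOn (fun ts : ℝ × ℝ => exp ts.1 * (exp (w * ts.2) * f (ts.1 + ts.2)))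
      (Iic 0 ×ˢ Iic 0) := by
  have h1 : IntegrableOn (fun t : ℝ => Real.exp (1 * t)) (Iic 0) :=
    integrableOn_exp_mul_Iic one_pos 0
  have h2 : IntegrableOn (fun t : ℝ => Real.exp (w.re * t)) (Iic 0) :=
    integrableOn_exp_mul_Iic hw 0
  have h := (Integrable.mul_prod h1 h2).mul_const C
  rw [Measure.prod_restrict] at h
  refine Integrable.mono' h (Continuous.aestronglyMeasurable (by fun_prop)) ?_
  refine ae_restrict_of_forall_mem (measurableSet_Iic.prod measurableSet_Iic) fun ts hts => ?_
  rw [norm_mul, norm_mul, Complex.norm_exp, Complex.norm_exp, re_mul_ofReal, ofReal_re, one_mul,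
    mul_assoc]
  have := hC (ts.1 + ts.2) (add_nonpos hts.1 hts.2)
  gcongr

/-- The double integral is reduced to single integrals by integrating by parts in the variable
which does not carry `w`. -/
theorem integral_exp_mul_exp_mul (hf : Continuous f) (hC : ∀ t ≤ 0, ‖f t‖ ≤ C)
    (hw : 0 < w.re) (hw1 : w ≠ 1) :
    ∫ ts in Iic (0 : ℝ) ×ˢ Iic (0 : ℝ), exp ts.1 * (exp (w * ts.2) * f (ts.1 + ts.2)) =
      (w - 1)⁻¹ * ((∫ t in Iic (0 : ℝ), exp (1 * t) * f t) -
        ∫ t in Iic (0 : ℝ), exp (w * t) * f t) := by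
  have h1w : 1 - w ≠ 0 := sub_ne_zero.2 hw1.symm
  have hone : 0 < (1 : ℂ).re := by simp
  have hC0 : 0 ≤ C := (norm_nonneg _).trans (hC 0 le_rfl)
  -- for `t ≤ 0` this is the integral over `(-∞, t]`; in this form it is differentiable everywhere
  set Ψ : ℂ → ℝ → ℂ := fun w t => (∫ x in Iic (0 : ℝ), exp (w * x) * f x) +
      ∫ x in (0 : ℝ)..t, exp (w * x) * f x with hΨ
  have hΨd : ∀ (w : ℂ) (t : ℝ), HasDerivAt (Ψ w) (exp (w * t) * f t) t := hasDerivAt_laplace_tail hf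
  have hΨc : ∀ w, Continuous (Ψ w) := fun w =>
    continuous_iff_continuousAt.2 fun t => (hΨd w t).continuousAt
  have hΨb : ∀ {w : ℂ}, 0 < w.re → ∀ t : ℝ, t ≤ 0 →
      ‖exp ((1 - w) * t) * Ψ w t‖ ≤ Real.exp (1 * t) * (C / w.re) := fun {w} hw t ht => by
    have := norm_integral_exp_mul_le hC hw ht
    rw [← laplace_tail_eq hf hC hw ht] at this
    rw [norm_mul, Complex.norm_exp, re_mul_ofReal]
    refine (mul_le_mul_of_nonneg_left this (Real.exp_pos _).le).trans (le_of_eq ?_)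
    rw [show Real.exp (1 * t) = Real.exp ((1 - w).re * t) * Real.exp (w.re * t) by
      rw [← Real.exp_add]; simp; ring]
    ring
  have hexp0 : ∀ c : ℝ, Tendsto (fun t : ℝ => Real.exp (1 * t) * c) atBot (𝓝 0) := fun c => by
    simpa using Real.tendsto_exp_atBot.mul_const c
  have hlim : ∀ {w : ℂ}, 0 < w.re →
      Tendsto (fun t : ℝ => exp ((1 - w) * t) * Ψ w t) atBot (𝓝 0) := fun {w} hw =>
    squeeze_zero_norm' ((eventually_le_atBot 0).mono fun t ht => hΨb hw t ht) (hexp0 _)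
  have hlim1 : Tendsto (Ψ 1) atBot (𝓝 0) := by simpa using hlim hone
  have hint : IntegrableOn (fun t : ℝ => exp ((1 - w) * t) * Ψ w t) (Iic 0) := by
    have hc := hΨc w
    refine Integrable.mono' ((integrableOn_exp_mul_Iic one_pos 0).mul_const (C / w.re))
      (Continuous.aestronglyMeasurable (by fun_prop))
      (ae_restrict_of_forall_mem measurableSet_Iic fun t ht => hΨb hw t ht)
  have hderiv : ∀ t : ℝ, HasDerivAt
      (fun t : ℝ => (1 - w)⁻¹ * (exp ((1 - w) * t) * Ψ w t - Ψ 1 t))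
      (exp ((1 - w) * t) * Ψ w t) t := fun t => by
    have he : HasDerivAt (fun t : ℝ => exp ((1 - w) * t)) (exp ((1 - w) * t) * (1 - w)) t := by
      simpa using ((hasDerivAt_id t).ofReal_comp.const_mul (1 - w)).cexp
    refine (((he.mul (hΨd w t)).sub (hΨd 1 t)).const_mul (1 - w)⁻¹).congr_deriv ?_
    rw [show exp (1 * (t : ℂ)) = exp ((1 - w) * t) * exp (w * t) by
      rw [← Complex.exp_add]; ring_nf]
    field_simp
    ring
  have hfinal := integral_Iic_of_hasDerivAt_of_tendsto' (a := 0) (m := 0) (fun t _ => hderiv t)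
    hint (by simpa using ((hlim hw).sub hlim1).const_mul (1 - w)⁻¹)
  have hprod := integrableOn_exp_mul_exp_mul hf hC hw
  rw [Measure.volume_eq_prod] at hprod ⊢
  rw [setIntegral_prod _ hprod]
  have hinner : ∀ t ∈ Iic (0 : ℝ),
      ∫ s in Iic (0 : ℝ), exp (t : ℂ) * (exp (w * s) * f (t + s)) =
        exp ((1 - w) * t) * Ψ w t := fun t ht => by
    rw [hΨ]
    dsimp only
    rw [laplace_tail_eq hf hC hw ht,
      ← setIntegral_Iic_zero_comp_add (fun x : ℝ => exp (w * x) * f x) t, ← integral_const_mul]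
    refine setIntegral_congr_fun measurableSet_Iic fun s _ => ?_
    have : exp (t : ℂ) * exp (w * s) = exp ((1 - w) * t) * exp (w * ((t + s : ℝ) : ℂ)) := by
      rw [← Complex.exp_add, ← Complex.exp_add]
      push_cast
      ring_nf
    simp only [← mul_assoc, this]
  rw [setIntegral_congr_fun measurableSet_Iic hinner, hfinal]
  have h1w' : w - 1 ≠ 0 := sub_ne_zero.2 hw1
  simp only [hΨ, ofReal_zero, mul_zero, Complex.exp_zero, one_mul, intervalIntegral.integral_same,
    add_zero, sub_zero]
  rw [← neg_sub w 1, inv_neg]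
  ring

end Laplace

/-! ### The star exponential as a function of `q = e^t` -/

/-- The denominator `(1 + κ) + (1 - κ) q`. -/
def mobDen (κ q : ℂ) : ℂ := 1 + κ + (1 - κ) * q

/-- The phase `(q - 1) / ((1 + κ) + (1 - κ) q)`, equal to `expPhase κ t` for `q = e^t`. -/
def mobPhase (κ q : ℂ) : ℂ := (q - 1) / mobDen κ q

/-- The function of `q` which is `e^{-t/2}` times the star exponential for `q = e^t`. -/
def starGen (ħ κ τ : ℂ) (p : ℂ × ℂ) (q : ℂ) : ℂ :=
  2 / mobDen κ q * exp (1 / (I * ħ) * τ * p.1 ^ 2 * mobPhase κ q ^ 2 +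
    1 / (I * ħ) * 2 * (p.1 * p.2) * mobPhase κ q)

/-- The set on which `starGen` is holomorphic. -/
def mobDomain (κ : ℂ) : Set ℂ := {q | mobDen κ q ≠ 0}

theorem expDelta_eq_mobDen (κ : ℂ) (t : ℝ) :
    expDelta κ t = exp (-(t / 2 : ℂ)) * mobDen κ (exp t) := by
  have h : exp ((t : ℂ) / 2) = exp (-(t / 2 : ℂ)) * exp t := by
    rw [← Complex.exp_add]; ring_nf
  rw [expDelta, mobDen, h, neg_div]
  ring

theorem expPhase_eq_mobPhase (κ : ℂ) (t : ℝ) : expPhase κ t = mobPhase κ (exp t) := by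
  have h : exp ((t : ℂ) / 2) = exp (-(t / 2 : ℂ)) * exp t := by
    rw [← Complex.exp_add]; ring_nf
  rw [expPhase, expDelta_eq_mobDen, mobPhase, h, neg_div,
    show exp (-(t / 2 : ℂ)) * exp t - exp (-(t / 2 : ℂ)) = exp (-(t / 2 : ℂ)) * (exp t - 1) by ring,
    mul_div_mul_left _ _ (Complex.exp_ne_zero _)]

theorem starExp_apply_eq_starGen (ħ κ τ : ℂ) (t : ℝ) (p : ℂ × ℂ) :
    (starExp ħ κ τ t).1 p = exp (t / 2) * starGen ħ κ τ p (exp t) := by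
  change 2 / expDelta κ t * exp (1 / (I * ħ) * (expPhase κ t ^ 2 * τ * p.1 ^ 2
    + 2 * expPhase κ t * (p.1 * p.2))) = _
  rw [expDelta_eq_mobDen, expPhase_eq_mobPhase, starGen, Complex.exp_neg]
  rw [show 2 / ((exp ((t : ℂ) / 2))⁻¹ * mobDen κ (exp t)) =
    exp (t / 2) * (2 / mobDen κ (exp t)) by field_simp]
  ring_nf

/-- The half-line `[0, ∞)` lies in the domain of holomorphy: the point `0`, which is the limit
`t → -∞`, is regular because `κ ≠ -1`. -/
theorem mobDen_ofReal_ne_zero {κ : ℂ} (hκ : Admissible κ) {x : ℝ} (hx : 0 ≤ x) :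
    mobDen κ x ≠ 0 := by
  rcases hx.eq_or_lt with rfl | hx
  · intro h
    apply hκ
    have h2 : κ = ((-1 : ℝ) : ℂ) := by
      simp only [mobDen, ofReal_zero, mul_zero, add_zero] at h
      push_cast
      linear_combination h
    rw [h2]
    exact ⟨ofReal_im _, Or.inl le_rfl⟩
  · intro h
    have h2 := expDelta_eq_mobDen κ (Real.log x)
    rw [← Complex.ofReal_exp, Real.exp_log hx, h, mul_zero] at h2
    exact expDelta_ne_zero hκ _ h2

theorem isOpen_mobDomain (κ : ℂ) : IsOpen (mobDomain κ) := by
  refine isOpen_ne_fun ?_ continuous_const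
  unfold mobDen
  fun_prop

theorem exists_mellinDomain {κ : ℂ} (hκ : Admissible κ) : ∃ R, MellinDomain R (mobDomain κ) := by
  have h0 : (0 : ℂ) ∈ mobDomain κ := by
    have := mobDen_ofReal_ne_zero hκ le_rfl
    rwa [ofReal_zero] at this
  obtain ⟨ε, hε, hsub⟩ := Metric.nhds_basis_closedBall.mem_iff.1
    ((isOpen_mobDomain κ).mem_nhds h0)
  exact ⟨min ε 1, lt_min hε one_pos, min_le_right _ _, isOpen_mobDomain κ,
    (Metric.closedBall_subset_closedBall (min_le_left _ _)).trans hsub, fun t _ => by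
      have := mobDen_ofReal_ne_zero hκ (Real.exp_pos t).le
      rwa [Complex.ofReal_exp] at this⟩

theorem hasDerivAt_mobDen (κ q : ℂ) : HasDerivAt (mobDen κ) (1 - κ) q := by
  exact (((hasDerivAt_id q).const_mul (1 - κ)).const_add (1 + κ)).congr_deriv (mul_one _)

theorem hasDerivAt_mobPhase {κ q : ℂ} (hq : q ∈ mobDomain κ) :
    HasDerivAt (mobPhase κ) (2 / mobDen κ q ^ 2) q := by
  refine (((hasDerivAt_id q).sub_const 1).div (hasDerivAt_mobDen κ q) hq).congr_deriv ?_
  simp only [mobDen, id]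
  congr 1
  ring

theorem hasDerivAt_starGen {ħ κ τ q : ℂ} (hq : q ∈ mobDomain κ) (p : ℂ × ℂ) :
    HasDerivAt (starGen ħ κ τ p) (((κ - 1) / mobDen κ q + 4 / mobDen κ q ^ 2 *
      (1 / (I * ħ) * τ * p.1 ^ 2 * mobPhase κ q + 1 / (I * ħ) * (p.1 * p.2))) *
      starGen ħ κ τ p q) q := by
  have hs := hasDerivAt_mobPhase hq
  have hD : mobDen κ q ≠ 0 := hq
  have h1 := (hasDerivAt_const q (2 : ℂ)).div (hasDerivAt_mobDen κ q) hq
  have h2 := ((hs.pow 2).const_mul (1 / (I * ħ) * τ * p.1 ^ 2)).add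
    (hs.const_mul (1 / (I * ħ) * 2 * (p.1 * p.2)))
  refine (h1.mul h2.cexp).congr_deriv ?_
  simp only [starGen, Pi.add_apply, Pi.pow_apply, Pi.div_apply]
  generalize exp (1 / (I * ħ) * τ * p.1 ^ 2 * mobPhase κ q ^ 2 +
    1 / (I * ħ) * 2 * (p.1 * p.2) * mobPhase κ q) = e
  field_simp
  ring

theorem differentiableOn_starGen (ħ κ τ : ℂ) (p : ℂ × ℂ) :
    DifferentiableOn ℂ (starGen ħ κ τ p) (mobDomain κ) := fun _ hq =>
  (hasDerivAt_starGen hq p).differentiableAt.differentiableWithinAt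

theorem starGen_one (ħ κ τ : ℂ) (p : ℂ × ℂ) : starGen ħ κ τ p 1 = 1 := by
  simp [starGen, mobPhase, mobDen]
  norm_num

theorem continuousOn_starGen (ħ κ τ : ℂ) :
    ContinuousOn (fun x : ℂ × (ℂ × ℂ) => starGen ħ κ τ x.2 x.1) (mobDomain κ ×ˢ univ) := by
  have h1 : ContinuousOn (fun x : ℂ × (ℂ × ℂ) => mobDen κ x.1) (mobDomain κ ×ˢ univ) := by
    unfold mobDen; fun_prop
  have h0 : ∀ x ∈ mobDomain κ ×ˢ (univ : Set (ℂ × ℂ)), mobDen κ x.1 ≠ 0 := fun x hx => hx.1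
  have h2 : ContinuousOn (fun x : ℂ × (ℂ × ℂ) => mobPhase κ x.1) (mobDomain κ ×ˢ univ) :=
    ContinuousOn.div (by fun_prop) h1 h0
  unfold starGen
  refine (continuousOn_const.div h1 h0).mul (ContinuousOn.cexp ?_)
  fun_prop

end StarExponential

/-! ### The continued inverse of `z + X` -/

section ContinuedInverse

section Represent

variable {R : ℝ} {U : Set ℂ}

/-- The restriction of `g` to the circle and the interval. -/
def represent (hU : MellinDomain R U) (g : ℂ → ℂ) (hg : ContinuousOn g U) : MellinAlg R :=
  (⟨fun ζ => g ζ, hg.comp_continuous continuous_subtype_val fun ζ => hU.closedBall_subset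
    (Metric.sphere_subset_closedBall (by simp [abs_of_pos hU.pos]))⟩,
   ⟨fun t => g (exp (t : ℝ)), hg.comp_continuous (by fun_prop) fun t => hU.exp_mem t t.2.2⟩)

theorem represents_represent (hU : MellinDomain R U) (g : ℂ → ℂ) (hg : ContinuousOn g U) :
    Represents (represent hU g hg) g := ⟨fun _ => rfl, fun _ => rfl⟩

variable {m n : MellinAlg R} {f g : ℂ → ℂ}

theorem Represents.add (hm : Represents m f) (hn : Represents n g) :
    Represents (m + n) fun q => f q + g q :=
  ⟨fun ζ => congrArg₂ (· + ·) (hm.1 ζ) (hn.1 ζ), fun t => congrArg₂ (· + ·) (hm.2 t) (hn.2 t)⟩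

theorem Represents.mul (hm : Represents m f) (hn : Represents n g) :
    Represents (m * n) fun q => f q * g q :=
  ⟨fun ζ => congrArg₂ (· * ·) (hm.1 ζ) (hn.1 ζ), fun t => congrArg₂ (· * ·) (hm.2 t) (hn.2 t)⟩

theorem Represents.smul (c : ℂ) (hm : Represents m f) : Represents (c • m) fun q => c * f q :=
  ⟨fun ζ => congrArg (c * ·) (hm.1 ζ), fun t => congrArg (c * ·) (hm.2 t)⟩

theorem Represents.congr (hU : MellinDomain R U) (hm : Represents m f)
    (h : ∀ q ∈ U, f q = g q) : Represents m g :=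
  ⟨fun ζ => (hm.1 ζ).trans (h _ (hU.closedBall_subset
    (Metric.sphere_subset_closedBall (by simp [abs_of_pos hU.pos])))),
   fun t => (hm.2 t).trans (h _ (hU.exp_mem t t.2.2))⟩

theorem Represents.gauss {s : MellinAlg R} {σ : ℂ → ℂ} (hs : Represents s σ) (ħ τ : ℂ)
    (p : ℂ × ℂ) : Represents (gauss ħ τ s p) fun q =>
      exp (1 / (I * ħ) * τ * p.1 ^ 2 * σ q ^ 2 + 1 / (I * ħ) * 2 * (p.1 * p.2) * σ q) := by
  constructor
  · intro ζ
    rw [WeylStar.gauss, Prod.fst_exp, continuousMap_exp_apply]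
    simp [hs.1]
  · intro t
    rw [WeylStar.gauss, Prod.snd_exp, continuousMap_exp_apply]
    simp [hs.2]

end Represent

variable {R : ℝ} {κ : ℂ} (hU : MellinDomain R (mobDomain κ)) (ħ τ : ℂ)

theorem continuousOn_mobPhase (κ : ℂ) : ContinuousOn (mobPhase κ) (mobDomain κ) := fun _ hq =>
  (hasDerivAt_mobPhase hq).continuousAt.continuousWithinAt

theorem continuousOn_two_div_mobDen (κ : ℂ) :
    ContinuousOn (fun q => 2 / mobDen κ q) (mobDomain κ) :=
  continuousOn_const.div (fun q _ => (hasDerivAt_mobDen κ q).continuousAt.continuousWithinAt)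
    fun _ hq => hq

/-- The phase of the star exponential on the circle and the interval. -/
def phaseElt : MellinAlg R := represent hU (mobPhase κ) (continuousOn_mobPhase κ)

/-- The amplitude of the star exponential on the circle and the interval. -/
def ampElt : MellinAlg R := represent hU (fun q => 2 / mobDen κ q) (continuousOn_two_div_mobDen κ)

theorem represents_phaseElt : Represents (phaseElt hU) (mobPhase κ) :=
  represents_represent hU _ _

theorem represents_ampElt : Represents (ampElt hU) fun q => 2 / mobDen κ q :=
  represents_represent hU _ _

/-- The superposition of Gaussian exponentials given by the continued Mellin functional with
density `k * ampElt`. -/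
def mellinTransform (k : MellinAlg R) : Hol :=
  transform (mellinFunctional R) ħ τ (phaseElt hU) (k * ampElt hU)

/-- The inverse `(z + X)_{+*}⁻¹`, for all `z` in `ℂ ∖ {-(ℕ + 1/2)}`. -/
def plusInv (z : ℂ) : Hol := mellinTransform hU ħ τ (mellinKernel R (z + 1 / 2))

theorem represents_amp_mul_gauss (p : ℂ × ℂ) :
    Represents (ampElt hU * gauss ħ τ (phaseElt hU) p) (starGen ħ κ τ p) :=
  (represents_ampElt hU).mul ((represents_phaseElt hU).gauss ħ τ p)

theorem mellinTransform_apply (k : MellinAlg R) (p : ℂ × ℂ) :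
    (mellinTransform hU ħ τ k).1 p =
      mellinFunctional R (k * (ampElt hU * gauss ħ τ (phaseElt hU) p)) := by
  rw [mellinTransform, transform_apply, mul_assoc]

theorem contDiff_mellinTransform (k : MellinAlg R) : ContDiff ℂ ∞ (mellinTransform hU ħ τ k).1 :=
  contDiff_transform _ _ _ _ _

variable {ħ}

/-- Multiplication by `X` acts under the Mellin functional as the Euler operator `q ∂_q + 1/2`. -/
theorem starMul_elemX_mellinTransform (hħ : ħ ≠ 0) (w : ℂ) (p : ℂ × ℂ) :
    ∃ m, Represents m (fun q => q * deriv (starGen ħ κ τ p) q + w * starGen ħ κ τ p q) ∧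
      ∀ k, starMul ħ κ τ (elemX ħ κ τ) (mellinTransform hU ħ τ k).1 p +
        (w - 1 / 2) * (mellinTransform hU ħ τ k).1 p = mellinFunctional R (k * m) := by
  set s := phaseElt hU with hs
  set E := ampElt hU * gauss ħ τ s p with hE
  have hrs : Represents s (mobPhase κ) := represents_phaseElt hU
  have hrE : Represents E (starGen ħ κ τ p) := represents_amp_mul_gauss hU ħ τ p
  set c := 1 / (I * ħ) with hc
  have hT : ∀ k j : MellinAlg R, (transform (mellinFunctional R) ħ τ s
      (k * ampElt hU * j)).1 p = mellinFunctional R (k * (j * E)) := fun k j => by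
    rw [transform_apply, hE]; congr 1; ring
  have h0 := fun k => hT k 1
  simp only [mul_one, one_mul] at h0
  refine ⟨(κ / 2 + (w - 1 / 2) + c * (p.1 * p.2)) • E +
    ((κ ^ 2 - 1) / 2 + c * (p.1 * p.2) * (2 * κ) + c * τ * p.1 ^ 2) • (s * E) +
    (c * (p.1 * p.2) * (κ ^ 2 - 1) + c * τ * p.1 ^ 2 * (2 * κ)) • (s * s * E) +
    (c * τ * p.1 ^ 2 * (κ ^ 2 - 1)) • (s * s * s * E), ?_, fun k => ?_⟩
  · refine Represents.congr hU ((((hrE.smul _).add ((hrs.mul hrE).smul _)).add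
      (((hrs.mul hrs).mul hrE).smul _)).add ((((hrs.mul hrs).mul hrs).mul hrE).smul _))
      fun q hq => ?_
    have hD : mobDen κ q ≠ 0 := hq
    rw [(hasDerivAt_starGen hq p).deriv, ← hc]
    generalize starGen ħ κ τ p q = e
    generalize c = c
    -- with `s = mobPhase κ q`, the factors `1 / mobDen κ q` are eliminated by `e1`, and `q` by the
    -- relation `1 + (κ + 1) s = q (1 + (κ - 1) s)`
    have e1 : 1 + (κ - 1) * mobPhase κ q = 2 / mobDen κ q := by
      rw [mobPhase]; field_simp; rw [mobDen]; ring
    have e2 : 1 + (κ + 1) * mobPhase κ q = q * (2 / mobDen κ q) := by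
      rw [mobPhase]; field_simp; rw [mobDen]; ring
    have e3 : (κ - 1) / mobDen κ q = (κ - 1) / 2 * (1 + (κ - 1) * mobPhase κ q) := by
      rw [e1]; ring
    have e4 : 4 / mobDen κ q ^ 2 = (1 + (κ - 1) * mobPhase κ q) ^ 2 := by
      rw [e1]; ring
    rw [e3, e4]
    rw [← e1] at e2
    linear_combination (((κ - 1) / 2 + (c * (p.1 * p.2) + c * τ * p.1 ^ 2 * mobPhase κ q) *
      (1 + (κ - 1) * mobPhase κ q)) * e) * e2
  · rw [mellinTransform, starMul_elemX_transform _ τ _ κ hħ, mul_assoc _ s s, mul_assoc _ (s * s) s,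
      h0, hT, hT, hT]
    simp only [mul_add, mul_smul_comm, map_add, map_smul, smul_eq_mul]
    ring

/-- Multiplication by `u` and `v` from the two sides acts under the Mellin functional as `∂_q`. -/
theorem genU_mellinTransform_genV (hħ : ħ ≠ 0) (k : MellinAlg R) (p : ℂ × ℂ) :
    ∃ m, Represents m (fun q => deriv (starGen ħ κ τ p) q) ∧
      1 / (I * ħ) * starMul ħ κ τ (starMul ħ κ τ genU (mellinTransform hU ħ τ k).1) genV p =
        mellinFunctional R (k * m) := by
  set s := phaseElt hU with hs
  set E := ampElt hU * gauss ħ τ s p with hE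
  have hrs : Represents s (mobPhase κ) := represents_phaseElt hU
  have hrE : Represents E (starGen ħ κ τ p) := represents_amp_mul_gauss hU ħ τ p
  set c := 1 / (I * ħ) with hc
  have hcħ : c * (I * ħ) = 1 := by rw [hc]; field_simp
  have hT : ∀ j : MellinAlg R, (transform (mellinFunctional R) ħ τ s
      (k * ampElt hU * j)).1 p = mellinFunctional R (k * (j * E)) := fun j => by
    rw [transform_apply, hE]; congr 1; ring
  have h0 := hT 1
  rw [mul_one, one_mul] at h0
  refine ⟨(c * (p.1 * p.2) + (κ - 1) / 2) • E +
    (c * (p.1 * p.2) * (2 * (κ - 1)) + c * τ * p.1 ^ 2 + (κ - 1) ^ 2 / 2) • (s * E) +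
    (c * (p.1 * p.2) * (κ - 1) ^ 2 + c * τ * p.1 ^ 2 * (2 * (κ - 1))) • (s * s * E) +
    (c * τ * p.1 ^ 2 * (κ - 1) ^ 2) • (s * s * s * E), ?_, ?_⟩
  · refine Represents.congr hU ((((hrE.smul _).add ((hrs.mul hrE).smul _)).add
      (((hrs.mul hrs).mul hrE).smul _)).add ((((hrs.mul hrs).mul hrs).mul hrE).smul _))
      fun q hq => ?_
    have hD : mobDen κ q ≠ 0 := hq
    rw [(hasDerivAt_starGen hq p).deriv, ← hc]
    have e1 : 1 + (κ - 1) * mobPhase κ q = 2 / mobDen κ q := by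
      rw [mobPhase]; field_simp; rw [mobDen]; ring
    have e3 : (κ - 1) / mobDen κ q = (κ - 1) / 2 * (1 + (κ - 1) * mobPhase κ q) := by
      rw [e1]; ring
    have e4 : 4 / mobDen κ q ^ 2 = (1 + (κ - 1) * mobPhase κ q) ^ 2 := by
      rw [e1]; ring
    rw [e3, e4]
    ring
  · rw [mellinTransform, genU_transform_genV _ τ _ κ hħ, mul_assoc _ s s, mul_assoc _ (s * s) s,
      h0, hT, hT, hT]
    simp only [mul_add, mul_smul_comm, map_add, map_smul, smul_eq_mul]
    linear_combination ((κ - 1) / 2 * (mellinFunctional R (k * E) +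
      (κ - 1) * mellinFunctional R (k * (s * E)))) * hcħ

theorem mem_inverseDomain_iff {z : ℂ} :
    z ∈ inverseDomain ↔ ∀ n : ℕ, z + 1 / 2 + n ≠ 0 := by
  refine forall_congr' fun n => not_congr ⟨fun h => ?_, fun h => ?_⟩
  · rw [h]; ring
  · linear_combination h

theorem starMul_elemX_plusInv (hħ : ħ ≠ 0) {z : ℂ} (hz : z ∈ inverseDomain) :
    starMul ħ κ τ (elemX ħ κ τ) (plusInv hU ħ τ z).1 =
      (fun _ : ℂ × ℂ => (1 : ℂ)) - z • ⇑(plusInv hU ħ τ z).1 := by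
  funext p
  obtain ⟨m, hm, h⟩ := starMul_elemX_mellinTransform hU τ hħ (z + 1 / 2) p
  have h := h (mellinKernel R (z + 1 / 2))
  rw [mellin_euler hU (differentiableOn_starGen ħ κ τ p) (mem_inverseDomain_iff.1 hz) hm,
    starGen_one] at h
  simp only [Pi.sub_apply, Pi.smul_apply, smul_eq_mul, plusInv]
  linear_combination h

theorem mellinTransform_starMul_elemX (hħ : ħ ≠ 0) (k : MellinAlg R) :
    starMul ħ κ τ (mellinTransform hU ħ τ k).1 (elemX ħ κ τ) =
      starMul ħ κ τ (elemX ħ κ τ) (mellinTransform hU ħ τ k).1 :=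
  transform_starMul_elemX _ τ _ κ hħ _

theorem genU_plusInv_genV_apply (hħ : ħ ≠ 0) (z : ℂ) (p : ℂ × ℂ)
    {m : MellinAlg R} (hm : Represents m fun q => q * deriv (starGen ħ κ τ p) q) :
    1 / (I * ħ) * starMul ħ κ τ (starMul ħ κ τ genU (plusInv hU ħ τ z).1) genV p =
      mellinFunctional R (mellinKernel R (z - 1 / 2) * m) := by
  obtain ⟨n, hn, h⟩ := genU_mellinTransform_genV hU τ hħ (mellinKernel R (z + 1 / 2)) p
  rw [plusInv, h, mellin_id_mul hU ((differentiableOn_starGen ħ κ τ p).deriv hU.isOpen) hn hm]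
  congr 3
  ring

/-- The sliding relation between the inverses at `z` and at `z - 1`. -/
theorem genU_plusInv_genV (hħ : ħ ≠ 0) {z : ℂ} (hz : z - 1 ∈ inverseDomain) (p : ℂ × ℂ) :
    1 / (I * ħ) * starMul ħ κ τ (starMul ħ κ τ genU (plusInv hU ħ τ z).1) genV p =
      1 - (z - 1 / 2) * (plusInv hU ħ τ (z - 1)).1 p := by
  have hg := differentiableOn_starGen ħ κ τ p
  have hr := represents_represent hU _ (differentiableOn_euler hU hg).continuousOn
  have he := represents_amp_mul_gauss hU ħ τ p
  rw [genU_plusInv_genV_apply hU τ hħ z p hr]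
  have hz' : z - 1 + 1 / 2 = z - 1 / 2 := by ring
  have h := mellin_euler hU hg (w := z - 1 / 2)
    (by simpa only [hz'] using mem_inverseDomain_iff.1 hz) (hr.add (he.smul (z - 1 / 2)))
  rw [mul_add, mul_smul_comm, map_add, map_smul, starGen_one, smul_eq_mul] at h
  rw [plusInv, mellinTransform_apply, hz']
  linear_combination h

/-- At `z = 1/2` the sliding relation has the boundary term at `q = 0`. -/
theorem genU_plusInv_half_genV (hħ : ħ ≠ 0) (p : ℂ × ℂ) :
    1 / (I * ħ) * starMul ħ κ τ (starMul ħ κ τ genU (plusInv hU ħ τ (1 / 2)).1) genV p =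
      1 - starGen ħ κ τ p 0 := by
  have hg := differentiableOn_starGen ħ κ τ p
  have hr := represents_represent hU _ (differentiableOn_euler hU hg).continuousOn
  rw [genU_plusInv_genV_apply hU τ hħ _ p hr, sub_self, mellin_euler_zero hU hg hr, starGen_one]

end ContinuedInverse

/-! ### Inverses of `z ± X` and of `z² - X * X` -/

section Resolvent

variable {ħ κ τ : ℂ}

theorem starMul_elemX_neg (f : ℂ × ℂ → ℂ) :
    starMul (-ħ) (-κ) (-τ) (elemX (-ħ) (-κ) (-τ)) f = -starMul ħ κ τ f (elemX ħ κ τ) := by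
  rw [elemX_neg, show -elemX ħ κ τ = (-1 : ℂ) • elemX ħ κ τ by simp,
    starMul_smul_left (isPoly_elemX ħ κ τ), starMul_neg]
  simp

/-- `f` is a smooth two-sided `*`-inverse of `z + a X`, where `a = ±1`, in the form
`X * f = f * X = a (1 - z f)`. -/
structure IsResolvent (ħ κ τ a z : ℂ) (f : ℂ × ℂ → ℂ) : Prop where
  contDiff : ContDiff ℂ ∞ f
  left : starMul ħ κ τ (elemX ħ κ τ) f = a • ((fun _ => 1) - z • f)
  right : starMul ħ κ τ f (elemX ħ κ τ) = a • ((fun _ => 1) - z • f)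

theorem IsResolvent.symm {a z : ℂ} {f : ℂ × ℂ → ℂ} (h : IsResolvent ħ κ τ a z f) :
    IsResolvent (-ħ) (-κ) (-τ) (-a) z f := by
  refine ⟨h.contDiff, ?_, ?_⟩
  · rw [starMul_elemX_neg, h.right, neg_smul]
  · rw [starMul_neg, elemX_neg, show -elemX ħ κ τ = (-1 : ℂ) • elemX ħ κ τ by simp,
      starMul_smul_left (isPoly_elemX ħ κ τ), h.left]
    simp

theorem IsResolvent.isStarInverse {a z : ℂ} (ha : a ^ 2 = 1) {f : ℂ × ℂ → ℂ}
    (h : IsResolvent ħ κ τ a z f) :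
    IsStarInverse ħ κ τ (fun p => z + a * elemX ħ κ τ p) f := by
  have key : ∀ {ħ κ τ a : ℂ}, a ^ 2 = 1 → IsResolvent ħ κ τ a z f →
      starMul ħ κ τ (fun p => z + a * elemX ħ κ τ p) f = 1 := fun {ħ κ τ a} ha h => by
    rw [starMul_const_add_smul_elemX, h.left]
    funext p
    simp
    linear_combination (1 - z * f p) * ha
  refine ⟨key ha h, ?_⟩
  have h' := key (by rwa [neg_sq]) h.symm
  rw [starMul_neg, elemX_neg] at h'
  simpa using h'

theorem starMul_elemX_elemX_neg :
    starMul (-ħ) (-κ) (-τ) (elemX (-ħ) (-κ) (-τ)) (elemX (-ħ) (-κ) (-τ)) =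
      starMul ħ κ τ (elemX ħ κ τ) (elemX ħ κ τ) := by
  have hX := isPoly_elemX ħ κ τ
  rw [starMul_neg, elemX_neg, show -elemX ħ κ τ = (-1 : ℂ) • elemX ħ κ τ by simp,
    starMul_smul_left hX, starMul_smul_right hX hX.contDiff]
  simp

theorem isPoly_sq_sub_elemX (ħ κ τ z : ℂ) :
    IsPoly fun p => z ^ 2 - starMul ħ κ τ (elemX ħ κ τ) (elemX ħ κ τ) p := by
  have h := (isPoly_const (z ^ 2)).add
    ((isPoly_starMul_elemX (ħ := ħ) (κ := κ) (τ := τ) (isPoly_elemX ħ κ τ)).smul (-1))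
  convert h using 1
  funext p
  simp [sub_eq_add_neg]

/-- The partial fraction decomposition: half the sum of inverses of `z + X` and `z - X` is `z` times
an inverse of `z² - X * X`. -/
theorem IsResolvent.isStarInverse_sq {a z : ℂ} (hz : z ≠ 0) (ha : a ^ 2 = 1)
    {f g : ℂ × ℂ → ℂ} (hf : IsResolvent ħ κ τ a z f) (hg : IsResolvent ħ κ τ (-a) z g) :
    IsStarInverse ħ κ τ (fun p => z ^ 2 - starMul ħ κ τ (elemX ħ κ τ) (elemX ħ κ τ) p)
      ((1 / (2 * z)) • (f + g)) := by
  have key : ∀ {ħ κ τ a : ℂ}, a ^ 2 = 1 → IsResolvent ħ κ τ a z f → IsResolvent ħ κ τ (-a) z g →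
      starMul ħ κ τ (fun p => z ^ 2 - starMul ħ κ τ (elemX ħ κ τ) (elemX ħ κ τ) p)
        ((1 / (2 * z)) • (f + g)) = 1 := fun {ħ κ τ a} ha hf hg => by
    have hP := isPoly_sq_sub_elemX ħ κ τ z
    rw [starMul_smul_right hP (contDiff_add hf.contDiff hg.contDiff),
      starMul_add_right hP hf.contDiff hg.contDiff, starMul_sq_sub ha hf.contDiff hf.left,
      starMul_sq_sub (by rwa [neg_sq]) hg.contDiff hg.left]
    funext p
    simp
    field_simp
    ring
  refine ⟨key ha hf hg, ?_⟩
  have h' := key (by rwa [neg_sq]) hf.symm hg.symm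
  rwa [starMul_elemX_elemX_neg, starMul_neg] at h'

/-- At `z = 0` the inverse of `-X * X` is the derivative `f` of a family of inverses of `z + a X`
with value `f₀`. -/
theorem IsResolvent.isStarInverse_sq_zero {a : ℂ} (ha : a ^ 2 = 1) {f f₀ : ℂ × ℂ → ℂ}
    (h₀ : IsResolvent ħ κ τ a 0 f₀) (hf : ContDiff ℂ ∞ f)
    (hl : starMul ħ κ τ (elemX ħ κ τ) f = -(a • f₀))
    (hr : starMul ħ κ τ f (elemX ħ κ τ) = -(a • f₀)) :
    IsStarInverse ħ κ τ (fun p => 0 ^ 2 - starMul ħ κ τ (elemX ħ κ τ) (elemX ħ κ τ) p) f := by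
  have key : ∀ {ħ κ τ a : ℂ}, a ^ 2 = 1 → IsResolvent ħ κ τ a 0 f₀ →
      starMul ħ κ τ (elemX ħ κ τ) f = -(a • f₀) →
      starMul ħ κ τ (fun p => 0 ^ 2 - starMul ħ κ τ (elemX ħ κ τ) (elemX ħ κ τ) p) f = 1 :=
    fun {ħ κ τ a} ha h₀ hl => by
      have hX := isPoly_elemX ħ κ τ
      have hXX : IsPoly (starMul ħ κ τ (elemX ħ κ τ) (elemX ħ κ τ)) := isPoly_starMul_elemX hX
      have h1 : (fun p => 0 ^ 2 - starMul ħ κ τ (elemX ħ κ τ) (elemX ħ κ τ) p) =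
          (-1 : ℂ) • starMul ħ κ τ (elemX ħ κ τ) (elemX ħ κ τ) := by
        funext p; simp
      rw [h1, starMul_smul_left hXX, starMul_elemX_assoc hX hf, hl, ← neg_smul,
        starMul_smul_right hX h₀.contDiff, h₀.left]
      funext p
      simp
      linear_combination ha
  refine ⟨key ha h₀ hl, ?_⟩
  have h' := key (by rwa [neg_sq]) h₀.symm
    (by rw [starMul_elemX_neg, hr]; simp)
  rwa [starMul_elemX_elemX_neg, starMul_neg] at h'

theorem starMul_add_left_of_isPoly_right {e f g : ℂ × ℂ → ℂ} (he : IsPoly e)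
    (hf : ContDiff ℂ ∞ f) (hg : ContDiff ℂ ∞ g) :
    starMul ħ κ τ (f + g) e = starMul ħ κ τ f e + starMul ħ κ τ g e := by
  simpa only [starMul_neg] using starMul_add_right (ħ := -ħ) (κ := -κ) (τ := -τ) he hf hg

theorem starMul_smul_left_of_isPoly_right {e f : ℂ × ℂ → ℂ} (he : IsPoly e)
    (hf : ContDiff ℂ ∞ f) (c : ℂ) :
    starMul ħ κ τ (c • f) e = c • starMul ħ κ τ f e := by
  simpa only [starMul_neg] using starMul_smul_right (ħ := -ħ) (κ := -κ) (τ := -τ) he hf c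

theorem genU_smul_sub_genV (a : ℂ) {f g : ℂ × ℂ → ℂ} (hf : ContDiff ℂ ∞ f)
    (hg : ContDiff ℂ ∞ g) :
    starMul ħ κ τ (starMul ħ κ τ genU (a • (f + (-1 : ℂ) • g))) genV =
      a • (starMul ħ κ τ (starMul ħ κ τ genU f) genV
        + (-1 : ℂ) • starMul ħ κ τ (starMul ħ κ τ genU g) genV) := by
  have hf' : ContDiff ℂ ∞ (starMul ħ κ τ genU f) := contDiff_starMul isPoly_genU hf
  have hg' : ContDiff ℂ ∞ (starMul ħ κ τ genU g) := contDiff_starMul isPoly_genU hg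
  rw [starMul_smul_right isPoly_genU (contDiff_add hf (contDiff_smul _ hg)),
    starMul_add_right isPoly_genU hf (contDiff_smul _ hg), starMul_smul_right isPoly_genU hg,
    starMul_smul_left_of_isPoly_right isPoly_genV (contDiff_add hf' (contDiff_smul _ hg')),
    starMul_add_left_of_isPoly_right isPoly_genV hf' (contDiff_smul _ hg'),
    starMul_smul_left_of_isPoly_right isPoly_genV hg']

end Resolvent

section PlusInv

variable {R : ℝ} {κ : ℂ} (hU : MellinDomain R (mobDomain κ)) {ħ : ℂ} (τ : ℂ)

/-- Multiplication by a fixed density. -/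
def mulConstCLM (a : MellinAlg R) : MellinAlg R →L[ℂ] MellinAlg R where
  toFun m := m * a
  map_add' _ _ := add_mul _ _ _
  map_smul' _ _ := smul_mul_assoc _ _ _
  cont := continuous_id.mul continuous_const

theorem hasDerivAt_mellinFunctional_mul {k : ℂ → MellinAlg R} {k' : MellinAlg R} {z : ℂ}
    (hk : HasDerivAt k k' z) (m : MellinAlg R) :
    HasDerivAt (fun z => mellinFunctional R (k z * m)) (mellinFunctional R (k' * m)) z :=
  ((mellinFunctional R).comp (mulConstCLM m)).hasFDerivAt.comp_hasDerivAt z hk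

variable (ħ) in
theorem contDiff_plusInv (z : ℂ) : ContDiff ℂ ∞ (plusInv hU ħ τ z).1 :=
  contDiff_mellinTransform hU ħ τ _

/-- The inverse property on all of `ℂ ∖ {-(ℕ + 1/2)}`. -/
theorem isResolvent_plusInv (hħ : ħ ≠ 0) {z : ℂ} (hz : z ∈ inverseDomain) :
    IsResolvent ħ κ τ 1 z (plusInv hU ħ τ z).1 := by
  have h := starMul_elemX_plusInv hU τ hħ hz
  refine ⟨contDiff_mellinTransform hU ħ τ _, by rw [h, one_smul], ?_⟩
  rw [one_smul, ← h]
  exact mellinTransform_starMul_elemX hU τ hħ _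

theorem isOpen_inverseDomain : IsOpen inverseDomain := by
  refine Metric.isOpen_iff.2 fun z hz => ?_
  obtain ⟨δ, hδ, h⟩ := exists_ball_le_norm_add_natCast (mem_inverseDomain_iff.1 hz)
  refine ⟨δ, hδ, fun y hy => mem_inverseDomain_iff.2 fun n => ?_⟩
  refine norm_pos_iff.1 (hδ.trans_le (h (y + 1 / 2) ?_ n))
  rw [mem_ball_iff_norm] at hy ⊢
  simpa using hy

theorem zero_mem_inverseDomain : (0 : ℂ) ∈ inverseDomain := by
  refine mem_inverseDomain_iff.2 fun n h => ?_
  have := congrArg re h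
  simp at this
  have hn : (0 : ℝ) ≤ n := n.cast_nonneg
  linarith

theorem differentiableAt_mellinKernel_add_half (hR : 0 < R) {z : ℂ} (hz : z ∈ inverseDomain) :
    DifferentiableAt ℂ (fun z => mellinKernel R (z + 1 / 2)) z :=
  (differentiableAt_mellinKernel hR (mem_inverseDomain_iff.1 hz)).comp z
    (differentiableAt_id.add_const (1 / 2 : ℂ))

variable (ħ) in
theorem differentiableOn_mellinTransform {k : ℂ → MellinAlg R} {S : Set ℂ}
    (hk : DifferentiableOn ℂ k S) : DifferentiableOn ℂ (fun z => mellinTransform hU ħ τ (k z)) S :=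
  fun z hz => by
    have h := DifferentiableWithinAt.continuousLinearMap_comp (H := Hol)
      ((transform (mellinFunctional R) ħ τ (phaseElt hU)).comp (mulConstCLM (ampElt hU))) (hk z hz)
    exact h

variable (ħ) in
theorem differentiableOn_plusInv : DifferentiableOn ℂ (plusInv hU ħ τ) inverseDomain :=
  differentiableOn_mellinTransform hU ħ τ fun _ hz =>
    (differentiableAt_mellinKernel_add_half hU.pos hz).differentiableWithinAt

/-- The derivative of `(z + X) * F(z) = 1` with respect to `z`. -/
theorem starMul_elemX_deriv (hħ : ħ ≠ 0) {z : ℂ} (hz : z ∈ inverseDomain) (p : ℂ × ℂ) :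
    starMul ħ κ τ (elemX ħ κ τ)
        (mellinTransform hU ħ τ (deriv (fun z => mellinKernel R (z + 1 / 2)) z)).1 p =
      -(plusInv hU ħ τ z).1 p
        - z * (mellinTransform hU ħ τ (deriv (fun z => mellinKernel R (z + 1 / 2)) z)).1 p := by
  obtain ⟨m, -, hm⟩ := starMul_elemX_mellinTransform hU τ hħ (1 / 2) p
  simp only [sub_self, zero_mul, add_zero] at hm
  have hk := (differentiableAt_mellinKernel_add_half hU.pos hz).hasDerivAt
  have h1 : HasDerivAt (fun z => starMul ħ κ τ (elemX ħ κ τ) (plusInv hU ħ τ z).1 p)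
      (starMul ħ κ τ (elemX ħ κ τ)
        (mellinTransform hU ħ τ (deriv (fun z => mellinKernel R (z + 1 / 2)) z)).1 p) z := by
    simp only [plusInv, hm]
    exact hasDerivAt_mellinFunctional_mul hk m
  have h2 : HasDerivAt (fun z => (plusInv hU ħ τ z).1 p)
      ((mellinTransform hU ħ τ (deriv (fun z => mellinKernel R (z + 1 / 2)) z)).1 p) z := by
    simp only [plusInv, mellinTransform_apply]
    exact hasDerivAt_mellinFunctional_mul hk _
  have h3 := ((hasDerivAt_id z).mul h2).const_sub 1
  refine (h1.unique (h3.congr_of_eventuallyEq ?_)).trans ?_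
  · filter_upwards [isOpen_inverseDomain.mem_nhds hz] with y hy
    rw [starMul_elemX_plusInv hU τ hħ hy]
    rfl
  · simp only [id]
    ring

variable (ħ) in
/-- The extension over `z = 0` of `(F(z) - F(-z)) / (2z)`, where `F(z)` is the inverse of `z + X`:
the divided difference is taken in the Banach algebra of densities. -/
def sameSignInv (z : ℂ) : Hol :=
  mellinTransform hU ħ τ (dslope
    (fun z => (1 / 2 : ℂ) • (mellinKernel R (z + 1 / 2) - mellinKernel R (-z + 1 / 2))) 0 z)

variable (ħ) in
theorem sameSignInv_of_ne {z : ℂ} (hz : z ≠ 0) :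
    sameSignInv hU ħ τ z = (1 / (2 * z)) • (plusInv hU ħ τ z - plusInv hU ħ τ (-z)) := by
  rw [sameSignInv, dslope_of_ne _ hz, slope_def_module]
  simp only [plusInv, mellinTransform, neg_zero, sub_self, smul_zero, sub_zero, smul_mul_assoc,
    map_smul, sub_mul, map_sub, smul_smul]
  congr 1
  field_simp

theorem symm_inverseDomain_mem_nhds_zero :
    {z : ℂ | z ∈ inverseDomain ∧ -z ∈ inverseDomain} ∈ 𝓝 (0 : ℂ) := by
  refine inter_mem (isOpen_inverseDomain.mem_nhds zero_mem_inverseDomain) ?_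
  have h : inverseDomain ∈ 𝓝 (-0 : ℂ) := by
    rw [neg_zero]; exact isOpen_inverseDomain.mem_nhds zero_mem_inverseDomain
  exact continuous_neg.continuousAt.preimage_mem_nhds h

theorem hasDerivAt_mellinKernel_neg (hR : 0 < R) {z : ℂ} (hz : -z ∈ inverseDomain) :
    HasDerivAt (fun z => mellinKernel R (-z + 1 / 2))
      (-deriv (fun z => mellinKernel R (z + 1 / 2)) (-z)) z := by
  have h := (differentiableAt_mellinKernel_add_half hR hz).hasDerivAt.scomp z (hasDerivAt_neg z)
  rwa [neg_one_smul] at h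

variable (ħ) in
theorem differentiableOn_sameSignInv : DifferentiableOn ℂ (sameSignInv hU ħ τ)
    {z | z ∈ inverseDomain ∧ -z ∈ inverseDomain} := by
  refine differentiableOn_mellinTransform hU ħ τ
    ((Complex.differentiableOn_dslope symm_inverseDomain_mem_nhds_zero).2 fun z hz => ?_)
  exact (((differentiableAt_mellinKernel_add_half hU.pos hz.1).sub
    (hasDerivAt_mellinKernel_neg hU.pos hz.2).differentiableAt).const_smul
      (1 / 2 : ℂ)).differentiableWithinAt

variable (ħ) in
theorem sameSignInv_zero : sameSignInv hU ħ τ 0 =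
    mellinTransform hU ħ τ (deriv (fun z => mellinKernel R (z + 1 / 2)) 0) := by
  have h1 := (differentiableAt_mellinKernel_add_half hU.pos zero_mem_inverseDomain).hasDerivAt
  have h2 := hasDerivAt_mellinKernel_neg (z := 0) hU.pos
    (by rw [neg_zero]; exact zero_mem_inverseDomain)
  have h : HasDerivAt
      (fun z => (1 / 2 : ℂ) • (mellinKernel R (z + 1 / 2) - mellinKernel R (-z + 1 / 2))) _ 0 :=
    (h1.sub h2).const_smul (1 / 2 : ℂ)
  rw [sameSignInv, dslope_same, h.deriv, neg_zero]
  congr 1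
  module

theorem isStarInverse_sameSignInv (hħ : ħ ≠ 0) {z : ℂ} (hz : z ∈ inverseDomain)
    (hz' : -z ∈ inverseDomain) :
    IsStarInverse ħ κ τ (fun p => z ^ 2 - starMul ħ κ τ (elemX ħ κ τ) (elemX ħ κ τ) p)
      (sameSignInv hU ħ τ z).1 := by
  rcases eq_or_ne z 0 with rfl | h0
  · have h : starMul ħ κ τ (elemX ħ κ τ) (sameSignInv hU ħ τ 0).1 =
        -((1 : ℂ) • ⇑(plusInv hU ħ τ 0).1) := by
      funext p
      rw [sameSignInv_zero, starMul_elemX_deriv hU τ hħ hz]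
      simp
    refine (isResolvent_plusInv hU τ hħ hz).isStarInverse_sq_zero (one_pow 2)
      (contDiff_mellinTransform hU ħ τ _) h ?_
    rw [← h]
    exact mellinTransform_starMul_elemX hU τ hħ _
  · rw [sameSignInv_of_ne hU ħ τ h0]
    have hr := isResolvent_plusInv hU τ hħ hz'
    have hX := isPoly_elemX ħ κ τ
    have hneg : IsResolvent ħ κ τ (-1) z ((-1 : ℂ) • ⇑(plusInv hU ħ τ (-z)).1) := by
      have h1 : starMul ħ κ τ (elemX ħ κ τ) ((-1 : ℂ) • ⇑(plusInv hU ħ τ (-z)).1) =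
          (-1 : ℂ) • ((fun _ => 1) - z • ((-1 : ℂ) • ⇑(plusInv hU ħ τ (-z)).1)) := by
        rw [starMul_smul_right hX hr.contDiff, hr.left]
        module
      refine ⟨contDiff_smul _ hr.contDiff, h1, ?_⟩
      rw [← h1]
      have h2 := mellinTransform_starMul_elemX hU τ hħ ((-1 : ℂ) • mellinKernel R (-z + 1 / 2))
      rw [mellinTransform, smul_mul_assoc, map_smul] at h2
      exact h2
    have h := (isResolvent_plusInv hU τ hħ hz).isStarInverse_sq h0 (one_pow 2) hneg
    convert h using 1
    funext p
    simp [sub_eq_add_neg]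

end PlusInv

theorem Hol.smul_apply (c : ℂ) (f : Hol) (p : ℂ × ℂ) : (c • f).1 p = c * f.1 p := rfl

theorem Hol.sub_apply (f g : Hol) (p : ℂ × ℂ) : (f - g).1 p = f.1 p - g.1 p := rfl

/-! ### Convergence of the integrals and the vacuum -/

section Integrals

variable {κ : ℂ} (ħ τ : ℂ)

theorem exists_norm_starGen_le (hκ : Admissible κ) {K : Set (ℂ × ℂ)} (hK : IsCompact K) :
    ∃ C, ∀ p ∈ K, ∀ t : ℝ, t ≤ 0 → ‖starGen ħ κ τ p (exp t)‖ ≤ C := by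
  have hI : IsCompact ((fun x : ℝ => (x : ℂ)) '' Icc 0 1) :=
    isCompact_Icc.image continuous_ofReal
  obtain ⟨C, hC⟩ := (hI.prod hK).exists_bound_of_continuousOn
    ((continuousOn_starGen ħ κ τ).mono (by
      rintro ⟨_, p⟩ ⟨⟨x, hx, rfl⟩, -⟩
      exact ⟨mobDen_ofReal_ne_zero hκ hx.1, mem_univ _⟩))
  refine ⟨C, fun p hp t ht => ?_⟩
  have := hC (((Real.exp t : ℝ) : ℂ), p)
    ⟨⟨_, ⟨(Real.exp_pos t).le, Real.exp_le_one_iff.2 ht⟩, rfl⟩, hp⟩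
  rwa [Complex.ofReal_exp] at this

theorem continuous_starGen_exp (hκ : Admissible κ) (p : ℂ × ℂ) :
    Continuous fun t : ℝ => starGen ħ κ τ p (exp t) :=
  (continuousOn_starGen ħ κ τ).comp_continuous (f := fun t : ℝ => (exp (t : ℂ), p))
    (by fun_prop) fun t => ⟨by
      have := mobDen_ofReal_ne_zero hκ (Real.exp_pos t).le
      rwa [Complex.ofReal_exp] at this, mem_univ _⟩

/-- In the variable `q = e^t` the integrand of the Laplace integral at `z` is that of a Mellin
integral with parameter `z + 1/2`. -/
theorem exp_smul_starExp_apply (z : ℂ) (t : ℝ) (p : ℂ × ℂ) :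
    (exp (t * z) • starExp ħ κ τ t).1 p =
      exp ((z + 1 / 2) * t) * starGen ħ κ τ p (exp t) := by
  rw [Hol.smul_apply, starExp_apply_eq_starGen, ← mul_assoc, ← Complex.exp_add]
  ring_nf

theorem exp_smul_starExp_add_apply (z : ℂ) (ts : ℝ × ℝ) (p : ℂ × ℂ) :
    (exp (ts.1 / 2 + ts.2 * z) • starExp ħ κ τ (ts.1 + ts.2)).1 p =
      exp ts.1 * (exp ((z + 1 / 2) * ts.2) * starGen ħ κ τ p (exp ((ts.1 + ts.2 : ℝ) : ℂ))) := by
  rw [Hol.smul_apply, starExp_apply_eq_starGen, ← mul_assoc, ← mul_assoc, ← Complex.exp_add,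
    ← Complex.exp_add]
  push_cast
  ring_nf

theorem re_add_half_pos {z : ℂ} (hz : -1 / 2 < z.re) : 0 < (z + 1 / 2).re := by
  have : (z + 1 / 2).re = z.re + 1 / 2 := by simp
  rw [this]
  linarith

theorem plusInv_eq_integral (hκ : Admissible κ) {R : ℝ} (hU : MellinDomain R (mobDomain κ))
    {z : ℂ} (hz : -1 / 2 < z.re) (p : ℂ × ℂ) :
    (plusInv hU ħ τ z).1 p =
      ∫ t in Iic (0 : ℝ), exp ((z + 1 / 2) * t) * starGen ħ κ τ p (exp t) := by
  obtain ⟨C, hC⟩ := exists_norm_starGen_le ħ τ hκ (isCompact_singleton (x := p))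
  rw [plusInv, mellinTransform_apply]
  exact mellin_eq_integral hU (differentiableOn_starGen ħ κ τ p) (re_add_half_pos hz)
    (represents_amp_mul_gauss hU ħ τ p) (integrableOn_exp_mul (continuous_starGen_exp ħ τ hκ p)
      (hC p rfl) (re_add_half_pos hz) le_rfl)

/-- Convergence is uniform on a compact set because `starGen` is bounded there, uniformly for `q` in
`[0, 1]`. -/
theorem isPlusInverse_plusInv (hκ : Admissible κ) {R : ℝ} (hU : MellinDomain R (mobDomain κ))
    {z : ℂ} (hz : -1 / 2 < z.re) : IsPlusInverse ħ κ τ z (plusInv hU ħ τ z) := by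
  have hw := re_add_half_pos hz
  refine ⟨fun p => ?_, Metric.tendstoLocallyUniformly_iff.2 fun ε hε p₀ => ?_⟩
  · obtain ⟨C, hC⟩ := exists_norm_starGen_le ħ τ hκ (isCompact_singleton (x := p))
    simp only [exp_smul_starExp_apply]
    exact integrableOn_exp_mul (continuous_starGen_exp ħ τ hκ p) (hC p rfl) hw le_rfl
  · obtain ⟨K, hK, hKn⟩ := exists_compact_mem_nhds p₀
    obtain ⟨C, hC⟩ := exists_norm_starGen_le ħ τ hκ hK
    have hlim : Tendsto (fun N : ℝ => Real.exp ((z + 1 / 2).re * -N) / (z + 1 / 2).re * C) atTop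
        (𝓝 0) := by
      have h1 : Tendsto (fun N : ℝ => (z + 1 / 2).re * -N) atTop atBot :=
        Tendsto.const_mul_atBot hw tendsto_neg_atTop_atBot
      simpa using ((Real.tendsto_exp_atBot.comp h1).div_const (z + 1 / 2).re).mul_const C
    refine ⟨K, hKn, ?_⟩
    filter_upwards [eventually_ge_atTop 0, hlim.eventually_lt_const hε] with N hN hNε p hp
    have hf := continuous_starGen_exp ħ τ hκ p
    have hN' : -N ≤ 0 := by linarith
    have h1 := intervalIntegral.integral_Iic_sub_Iic
      (integrableOn_exp_mul hf (hC p hp) hw hN') (integrableOn_exp_mul hf (hC p hp) hw le_rfl)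
    simp only [exp_smul_starExp_apply]
    rw [plusInv_eq_integral ħ τ hκ hU hz, ← h1, dist_eq_norm, sub_sub_cancel]
    exact (norm_integral_exp_mul_le (hC p hp) hw hN').trans_lt hNε

/-- The function `starGen` at the real point `|x|`, as an element of `Hol`. The absolute value makes
it continuous in all real `x`, since `starGen` is only known to be regular on `[0, ∞)`. -/
def starGenHol (κ : ℂ) (x : ℝ) : Hol :=
  ⟨⟨fun p => starGen ħ κ τ p ((|x| : ℝ) : ℂ), by unfold starGen; fun_prop⟩, by
    change Differentiable ℂ fun p => starGen ħ κ τ p ((|x| : ℝ) : ℂ)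
    unfold starGen
    fun_prop⟩

theorem continuous_starGenHol (hκ : Admissible κ) : Continuous (starGenHol ħ τ κ) := by
  refine Continuous.subtype_mk (ContinuousMap.continuous_of_continuous_uncurry _ ?_) _
  exact (continuousOn_starGen ħ κ τ).comp_continuous
    (f := fun x : ℝ × (ℂ × ℂ) => (((|x.1| : ℝ) : ℂ), x.2)) (by fun_prop)
    fun x => ⟨mobDen_ofReal_ne_zero hκ (abs_nonneg _), mem_univ _⟩

theorem isVacuum_starGenHol (hκ : Admissible κ) :
    IsVacuum ħ κ τ (starGenHol ħ τ κ 0) := by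
  have h := ((continuous_starGenHol ħ τ hκ).tendsto 0).comp Real.tendsto_exp_atBot
  refine h.congr fun t => ?_
  ext p
  change starGen ħ κ τ p (|Real.exp t| : ℝ) = exp (-t / 2) * (starExp ħ κ τ t).1 p
  rw [starExp_apply_eq_starGen, ← mul_assoc, ← Complex.exp_add, abs_of_pos (Real.exp_pos t),
    Complex.ofReal_exp, neg_div, neg_add_cancel, Complex.exp_zero, one_mul]

theorem starGenHol_zero_apply (κ : ℂ) (p : ℂ × ℂ) :
    (starGenHol ħ τ κ 0).1 p = starGen ħ κ τ p 0 := by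
  change starGen ħ κ τ p (|(0 : ℝ)| : ℝ) = _
  simp

/-- The double integral in the sliding identity. -/
theorem hasIntegralIic₂_plusInv (hκ : Admissible κ) {R : ℝ} (hU : MellinDomain R (mobDomain κ))
    {z : ℂ} (hz : -1 / 2 < z.re) (hz1 : z ≠ 1 / 2) :
    HasIntegralIic₂ (fun ts => exp (ts.1 / 2 + ts.2 * z) • starExp ħ κ τ (ts.1 + ts.2))
      ((z - 1 / 2)⁻¹ • (plusInv hU ħ τ (1 / 2) - plusInv hU ħ τ z)) := by
  intro p
  obtain ⟨C, hC⟩ := exists_norm_starGen_le ħ τ hκ (isCompact_singleton (x := p))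
  have hC := hC p rfl
  have hf := continuous_starGen_exp ħ τ hκ p
  have hw := re_add_half_pos hz
  have h1 := integrableOn_exp_mul_exp_mul hf hC hw
  have h2 := integral_exp_mul_exp_mul hf hC hw fun h => hz1 (by linear_combination h)
  simp only [← exp_smul_starExp_add_apply] at h1 h2
  refine ⟨h1, h2.trans ?_⟩
  rw [Hol.smul_apply, Hol.sub_apply, plusInv_eq_integral ħ τ hκ hU hz,
    plusInv_eq_integral ħ τ hκ hU (by norm_num), add_halves]
  congr 2
  ring

/-- The sliding identity, with the two outer multiplications carried out from left to right. -/
theorem sliding_identity {ħ : ℂ} (hħ : ħ ≠ 0) {R : ℝ} (hU : MellinDomain R (mobDomain κ))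
    {z : ℂ} (hz : -1 / 2 < z.re) (hz1 : z ≠ 1 / 2) :
    starMul ħ κ τ (starMul ħ κ τ genU ((1 / (I * ħ)) •
        ((z - 1 / 2)⁻¹ • (plusInv hU ħ τ (1 / 2) - plusInv hU ħ τ z))).1) genV +
      ((z - 1 / 2)⁻¹ • starGenHol ħ τ κ 0).1 = (plusInv hU ħ τ (z - 1)).1 := by
  have hz2 : z - 1 / 2 ≠ 0 := sub_ne_zero.2 hz1
  -- the only exceptional point with real part greater than `-3/2` is `-1/2`
  have hmem : z - 1 ∈ inverseDomain := by
    refine mem_inverseDomain_iff.2 fun n h => ?_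
    rcases n with _ | n
    · refine hz2 ?_
      simp only [Nat.cast_zero] at h
      linear_combination h
    · have := congrArg re h
      simp at this
      have hn : (0 : ℝ) ≤ n := n.cast_nonneg
      linarith
  have hB : ⇑((1 / (I * ħ)) • ((z - 1 / 2)⁻¹ •
      (plusInv hU ħ τ (1 / 2) - plusInv hU ħ τ z))).1 = (1 / (I * ħ) * (z - 1 / 2)⁻¹) •
        (⇑(plusInv hU ħ τ (1 / 2)).1 + (-1 : ℂ) • ⇑(plusInv hU ħ τ z).1) := by
    funext p
    simp
    ring
  rw [hB, genU_smul_sub_genV _ (contDiff_plusInv hU ħ τ _) (contDiff_plusInv hU ħ τ _)]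
  funext p
  have h1 := genU_plusInv_genV hU τ hħ hmem p
  have h2 := genU_plusInv_half_genV hU τ hħ p
  change (1 / (I * ħ) * (z - 1 / 2)⁻¹) *
    (starMul ħ κ τ (starMul ħ κ τ genU (plusInv hU ħ τ (1 / 2)).1) genV p +
      -1 * starMul ħ κ τ (starMul ħ κ τ genU (plusInv hU ħ τ z).1) genV p) +
    (z - 1 / 2)⁻¹ * (starGenHol ħ τ κ 0).1 p = _
  rw [starGenHol_zero_apply]
  linear_combination (z - 1 / 2)⁻¹ * (h2 - h1) +
    (plusInv hU ħ τ (z - 1)).1 p * inv_mul_cancel₀ hz2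

/-- The same identity with the two outer multiplications carried out from right to left. -/
theorem sliding_identity' {ħ : ℂ} (hħ : ħ ≠ 0) {R : ℝ} (hU : MellinDomain R (mobDomain κ))
    {z : ℂ} (hz : -1 / 2 < z.re) (hz1 : z ≠ 1 / 2) :
    starMul ħ κ τ genU (starMul ħ κ τ ((1 / (I * ħ)) •
        ((z - 1 / 2)⁻¹ • (plusInv hU ħ τ (1 / 2) - plusInv hU ħ τ z))).1 genV) +
      ((z - 1 / 2)⁻¹ • starGenHol ħ τ κ 0).1 = (plusInv hU ħ τ (z - 1)).1 := by
  rw [← sliding_identity τ hħ hU hz hz1]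
  congr 1
  have h : (1 / (I * ħ)) • ((z - 1 / 2)⁻¹ • (plusInv hU ħ τ (1 / 2) - plusInv hU ħ τ z)) =
      transform (mellinFunctional R) ħ τ (phaseElt hU) ((1 / (I * ħ)) • ((z - 1 / 2)⁻¹ •
        (mellinKernel R (1 / 2 + 1 / 2) * ampElt hU -
          mellinKernel R (z + 1 / 2) * ampElt hU))) := by
    rw [map_smul, map_smul, map_sub]
    rfl
  rw [h]
  exact genU_transform_genV' _ τ _ κ hħ _

end Integrals

/-! ### The reflection `(ħ, κ, τ, t) ↦ (-ħ, -κ, -τ, -t)` -/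

section Reflection

variable {ħ κ τ : ℂ}

theorem IsPlusInverse.neg {z : ℂ} {A : Hol} (h : IsPlusInverse (-ħ) (-κ) (-τ) z A) :
    IsMinusInverse ħ κ τ z A := by
  simpa only [IsMinusInverse, IsPlusInverse, starExp_neg] using h

theorem IsVacuum.neg {ϖ : Hol} (h : IsVacuum (-ħ) (-κ) (-τ) ϖ) : IsVacuumBar ħ κ τ ϖ := by
  refine (h.comp tendsto_neg_atTop_atBot).congr fun t => ?_
  have h1 : starExp (-ħ) (-κ) (-τ) (-t) = starExp ħ κ τ t := by
    rw [← starExp_neg, neg_neg]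
  rw [Function.comp_apply, starExpUV, starExpVU, h1]
  push_cast
  rw [neg_neg]

theorem IsStarInverse.neg_sq {z : ℂ} {f : ℂ × ℂ → ℂ}
    (h : IsStarInverse (-ħ) (-κ) (-τ)
      (fun p => z ^ 2 - starMul (-ħ) (-κ) (-τ) (elemX (-ħ) (-κ) (-τ)) (elemX (-ħ) (-κ) (-τ)) p) f) :
    IsStarInverse ħ κ τ (fun p => z ^ 2 - starMul ħ κ τ (elemX ħ κ τ) (elemX ħ κ τ) p) f := by
  rw [starMul_elemX_elemX_neg] at h
  exact ⟨by rw [← starMul_neg]; exact h.2, by rw [← starMul_neg]; exact h.1⟩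

/-- The reflection takes the double integral of one sliding identity to that of the other and
reverses the order of the factors. -/
theorem isUBulletMul_of_neg {z : ℂ} {B : Hol}
    (hB : HasIntegralIic₂
      (fun ts => exp (ts.1 / 2 + ts.2 * z) • starExp (-ħ) (-κ) (-τ) (ts.1 + ts.2)) B) :
    IsUBulletMul ħ κ τ z (starMul (-ħ) (-κ) (-τ) ((1 / (I * -ħ)) • B).1 genV) := by
  refine ⟨B, by simpa only [starExp_neg] using hB, ?_⟩
  rw [starMul_neg, mul_neg, div_neg]

end Reflection

/-- The partial fraction of two holomorphic families of inverses is holomorphic. -/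
theorem differentiableOn_add_plusInv {R R' : ℝ} {κ κ' : ℂ} (hU : MellinDomain R (mobDomain κ))
    (hU' : MellinDomain R' (mobDomain κ')) (ħ ħ' τ τ' : ℂ) :
    DifferentiableOn ℂ (fun z => (1 / (2 * z)) • (plusInv hU ħ τ z + plusInv hU' ħ' τ' z))
      (inverseDomain \ {0}) := by
  intro z hz
  have : ContinuousAdd Hol :=
    ⟨((continuous_subtype_val.comp continuous_fst).add
      (continuous_subtype_val.comp continuous_snd)).subtype_mk _⟩
  have hk := (differentiableAt_mellinKernel_add_half hU.pos hz.1).prodMk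
    (differentiableAt_mellinKernel_add_half hU'.pos hz.1)
  have hc : DifferentiableAt ℂ (fun z : ℂ => 1 / (2 * z)) z :=
    (differentiableAt_const _).div (differentiableAt_id.const_mul 2)
      (mul_ne_zero two_ne_zero hz.2)
  set T := ((transform (mellinFunctional R) ħ τ (phaseElt hU)).comp
    (mulConstCLM (ampElt hU))).coprod
      ((transform (mellinFunctional R') ħ' τ' (phaseElt hU')).comp (mulConstCLM (ampElt hU')))
  have h := DifferentiableWithinAt.continuousLinearMap_comp (H := Hol) T
    (hc.smul hk).differentiableWithinAt (S := inverseDomain \ {0})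
  refine h.congr_of_eventuallyEq_of_mem (Eventually.of_forall fun y => ?_) hz
  exact (map_smul T (1 / (2 * y)) (mellinKernel R (y + 1 / 2), mellinKernel R' (y + 1 / 2))).symm

end WeylStar

end

theorem mainTheorem2 (ħ κ τ : ℂ) (hħ : ħ ≠ 0) (hκ : Admissible κ) :
    ∃ F G : ℂ → Hol,
      -- the two inverses are given by convergent integrals for `Re z > -1/2`
      (∀ z : ℂ, -1 / 2 < z.re →
        IsPlusInverse ħ κ τ z (F z) ∧ IsMinusInverse ħ κ τ z (G z)) ∧
      -- they extend holomorphically to `ℂ ∖ {-(ℕ + 1/2)}`, and remain inverses there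
      DifferentiableOn ℂ F inverseDomain ∧
      DifferentiableOn ℂ G inverseDomain ∧
      (∀ z ∈ inverseDomain,
        IsStarInverse ħ κ τ (fun p => z + elemX ħ κ τ p) (F z).1 ∧
        IsStarInverse ħ κ τ (fun p => z - elemX ħ κ τ p) (G z).1) ∧
      -- the sliding identities which give the continuation
      (∃ ϖ ϖ' : Hol, IsVacuum ħ κ τ ϖ ∧ IsVacuumBar ħ κ τ ϖ' ∧
        ∀ z : ℂ, -1 / 2 < z.re → z ≠ 1 / 2 →
          (∃ A, IsVCircMul ħ κ τ z A ∧
            starMul ħ κ τ A genV + ((z - 1 / 2)⁻¹ • ϖ).1 = (F (z - 1)).1) ∧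
          (∃ A, IsUBulletMul ħ κ τ z A ∧
            starMul ħ κ τ A genU + ((z - 1 / 2)⁻¹ • ϖ').1 = (G (z - 1)).1)) ∧
      -- the inverse of `z² - (uv/(iħ))²` given by the resolvent formula
      DifferentiableOn ℂ (fun z => (1 / (2 * z)) • (F z + G z)) (inverseDomain \ {0}) ∧
      (∀ z ∈ inverseDomain \ {0},
        IsStarInverse ħ κ τ (fun p => z ^ 2 - starMul ħ κ τ (elemX ħ κ τ) (elemX ħ κ τ) p)
          ((1 / (2 * z)) • (F z + G z)).1) ∧
      -- the inverses of `z² - (uv/(iħ))²` in which both factors have the same sign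
      (∃ P Q : ℂ → Hol,
        (∀ z : ℂ, z ≠ 0 → P z = (1 / (2 * z)) • (F z - F (-z)) ∧
          Q z = (1 / (2 * z)) • (G z - G (-z))) ∧
        DifferentiableOn ℂ P {z | z ∈ inverseDomain ∧ -z ∈ inverseDomain} ∧
        DifferentiableOn ℂ Q {z | z ∈ inverseDomain ∧ -z ∈ inverseDomain} ∧
        ∀ z : ℂ, z ∈ inverseDomain → -z ∈ inverseDomain →
          IsStarInverse ħ κ τ (fun p => z ^ 2 - starMul ħ κ τ (elemX ħ κ τ) (elemX ħ κ τ) p)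
            (P z).1 ∧
          IsStarInverse ħ κ τ (fun p => z ^ 2 - starMul ħ κ τ (elemX ħ κ τ) (elemX ħ κ τ) p)
            (Q z).1) := by
  obtain ⟨R, hU⟩ := exists_mellinDomain hκ
  obtain ⟨R', hU'⟩ := exists_mellinDomain hκ.neg
  have hħ' : -ħ ≠ 0 := neg_ne_zero.2 hħ
  have hF : ∀ z ∈ inverseDomain, IsResolvent ħ κ τ 1 z (plusInv hU ħ τ z).1 :=
    fun z hz => isResolvent_plusInv hU τ hħ hz
  have hG : ∀ z ∈ inverseDomain, IsResolvent ħ κ τ (-1) z (plusInv hU' (-ħ) (-τ) z).1 :=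
    fun z hz => by simpa only [neg_neg] using (isResolvent_plusInv hU' (-τ) hħ' hz).symm
  refine ⟨plusInv hU ħ τ, plusInv hU' (-ħ) (-τ), fun z hz =>
      ⟨isPlusInverse_plusInv ħ τ hκ hU hz, (isPlusInverse_plusInv (-ħ) (-τ) hκ.neg hU' hz).neg⟩,
    differentiableOn_plusInv hU ħ τ, differentiableOn_plusInv hU' (-ħ) (-τ),
    fun z hz => ⟨?_, ?_⟩,
    ⟨starGenHol ħ τ κ 0, starGenHol (-ħ) (-τ) (-κ) 0, isVacuum_starGenHol ħ τ hκ,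
      (isVacuum_starGenHol (-ħ) (-τ) hκ.neg).neg, fun z hz hz1 =>
        ⟨⟨_, ⟨_, hasIntegralIic₂_plusInv ħ τ hκ hU hz hz1, rfl⟩, sliding_identity τ hħ hU hz hz1⟩,
          ⟨_, isUBulletMul_of_neg (hasIntegralIic₂_plusInv (-ħ) (-τ) hκ.neg hU' hz hz1), ?_⟩⟩⟩,
    differentiableOn_add_plusInv hU hU' ħ (-ħ) τ (-τ), fun z hz =>
      (hF z hz.1).isStarInverse_sq hz.2 (one_pow 2) (hG z hz.1),
    ⟨sameSignInv hU ħ τ, sameSignInv hU' (-ħ) (-τ), fun z hz =>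
        ⟨sameSignInv_of_ne hU ħ τ hz, sameSignInv_of_ne hU' (-ħ) (-τ) hz⟩,
      differentiableOn_sameSignInv hU ħ τ, differentiableOn_sameSignInv hU' (-ħ) (-τ),
      fun z hz hz' => ⟨isStarInverse_sameSignInv hU τ hħ hz hz',
        (isStarInverse_sameSignInv hU' (-τ) hħ' hz hz').neg_sq⟩⟩⟩
  · simpa only [one_mul] using (hF z hz).isStarInverse (one_pow 2)
  · simpa only [neg_mul, one_mul, ← sub_eq_add_neg] using
      (hG z hz).isStarInverse (by norm_num)
  · rw [← starMul_neg]
    exact sliding_identity' (-τ) hħ' hU' hz hz1
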